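/- Let $n\ge 2$, $2-n<A\le 2$ and $m>1-\frac{A}{n}$. Put $U(x)=\frac{|x|^A}{A}$ (with $U(x)=\log|x|$ if $A=0$), so that $\nabla U(x)=|x|^{A-2}x$ for $x\ne0$, and consider the Cauchy problem $$\partial_t\rho=\Delta\rho^m+\operatorname{div}\big(\rho\,\nabla(U*\rho)\big)\ \text{ in }(0,\infty)\times\mathbb R^n,\qquad \rho(\cdot,0)=\rho_0,$$ with $\rho_0\ge 0$, $\rho_0\in L^1(\mathbb R^n)\cap L^\infty(\mathbb R^n)$. A global weak solution is a measurable function $\rho\ge0$ on $(0,\infty)\times\mathbb R^n$ such that, writing $B_R=\{|x|<R\}$, for all $0<T,R<\infty$: - $\rho\in L^\infty\big(0,T;L^1(\mathbb R^n)\cap L^\infty(\mathbb R^n)\big)$ (with a bound that may depend on $T$); - $\rho^m$ has a distributional spatial gradient $\nabla\rho^m\in L^2((0,T)\times B_R)$; - $(t,x)\mapsto\int_{\mathbb R^n}|\nabla U(x-y)|\,\rho(t,y)\,dy$ belongs to $L^2((0,T)\times B_R)$, so that $\nabla (U*\rho):=(\nabla U)*\rho$ is well defined almost everywhere; - for every $\varphi\in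 C_c^\infty(\mathbb R\times\mathbb R^n)$, $$\int_0^\infty\!\!\int_{\mathbb R^n}\Big(\rho\,\partial_t\varphi-\big(\nabla\rho^m+\rho\,\nabla(U*\rho)\big)\cdot\nabla\varphi\Big)\,dx\,dt+\int_{\mathbb R^n}\rho_0(x)\,\varphi(0,x)\,dx=0 .$$ Then every global weak solution is bounded uniformly in time: for all $M_0,K_0\ge 0$ there is a constant $C$, depending only on $n,A,m,M_0,K_0$, such that every global weak solution $\rho$ with initial datum satisfying $\|\rho_0\|_{L^1}\le M_0$ and $\|\rho_0\|_{L^\infty}\le K_0$ satisfies $$\|\rho\|_{L^\infty(\mathbb R_+;L^\infty(\mathbb R^n))}\le C .$$ -/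

import Mathlib

open MeasureTheory Set
open scoped NNReal ENNReal

noncomputable section

namespace AggDiff

/-- The Euclidean space `ℝⁿ`. -/
abbrev E (n : ℕ) : Type := EuclideanSpace ℝ (Fin n)

/-- The attractive power-law potential `U(x) = |x|^A / A`, with the convention
`|x|^0 / 0 := log |x|`. -/
def potential {n : ℕ} (A : ℝ) (x : E n) : ℝ :=
  if A = 0 then Real.log ‖x‖ else ‖x‖ ^ A / A

/-- Away from the origin, `∇U(x) = |x|^(A-2) x`, including the logarithmic case `A = 0`. -/
theorem hasGradientAt_potential {n : ℕ} (A : ℝ) {x : E n} (hx : x ≠ 0) :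
    HasGradientAt (potential A) (‖x‖ ^ (A - 2) • x) x := by
  have hpos : 0 < ‖x‖ := norm_pos_iff.mpr hx
  have hsq : HasFDerivAt (fun y : E n => ‖y‖ ^ 2) (2 • innerSL ℝ x) x :=
    (hasStrictFDerivAt_norm_sq x).hasFDerivAt
  have hnorm : HasFDerivAt (fun y : E n => ‖y‖) (‖x‖⁻¹ • innerSL ℝ x) x := by
    have h := (Real.hasDerivAt_sqrt (pow_pos hpos 2).ne').comp_hasFDerivAt x hsq
    have h2 : (Real.sqrt ∘ fun y : E n => ‖y‖ ^ 2) = fun y => ‖y‖ := by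
      funext y
      simp [Real.sqrt_sq (norm_nonneg y)]
    rw [h2] at h
    refine h.congr_fderiv ?_
    rw [Real.sqrt_sq hpos.le]
    ext v
    simp
    field_simp
  rw [hasGradientAt_iff_hasFDerivAt]
  by_cases hA : A = 0
  · have h := (Real.hasDerivAt_log hpos.ne').comp_hasFDerivAt x hnorm
    have h2 : (potential A : E n → ℝ) = Real.log ∘ fun y => ‖y‖ := by
      funext y
      simp [potential, hA]
    rw [h2]
    refine h.congr_fderiv ?_
    have h3 : ‖x‖ ^ (A - 2) = ‖x‖⁻¹ * ‖x‖⁻¹ := by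
      rw [hA, zero_sub, Real.rpow_neg hpos.le, Real.rpow_two, sq, mul_inv]
    ext v
    simp [h3, mul_assoc]
  · have h := ((Real.hasDerivAt_rpow_const (p := A) (Or.inl hpos.ne')).div_const
      A).comp_hasFDerivAt x hnorm
    have h2 : (potential A : E n → ℝ) = (fun r : ℝ => r ^ A / A) ∘ fun y => ‖y‖ := by
      funext y
      simp [potential, hA]
    rw [h2]
    refine h.congr_fderiv ?_
    have h3 : ‖x‖ ^ (A - 1) = ‖x‖ ^ (A - 2) * ‖x‖ := by
      rw [← Real.rpow_add_one hpos.ne']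
      ring_nf
    ext v
    simp [h3]
    field_simp

/-- The velocity field `(∇U * ρ(t))(x) = ∫ ∇U(x - y) ρ(t, y) dy`. (Wherever `∇U` fails to exist,
which can happen only at the origin, `gradient` is zero; the origin is a null set.) -/
def velocity {n : ℕ} (A : ℝ) (ρ : ℝ → E n → ℝ) (t : ℝ) (x : E n) : E n :=
  ∫ y, ρ t y • gradient (potential A) (x - y)

/-- Test functions: real functions of class `C^∞` and compact support on `ℝ × ℝⁿ`
(time, space). They need not vanish at time `0`. -/
def IsTest {n : ℕ} (φ : ℝ × E n → ℝ) : Prop :=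
  ContDiff ℝ ((⊤ : ℕ∞) : WithTop ℕ∞) φ ∧ HasCompactSupport φ

/-- The time derivative of a test function. -/
def timeDeriv {n : ℕ} (φ : ℝ × E n → ℝ) (z : ℝ × E n) : ℝ :=
  deriv (fun s => φ (s, z.2)) z.1

/-- The spatial gradient of a test function. -/
def spaceGrad {n : ℕ} (φ : ℝ × E n → ℝ) (z : ℝ × E n) : E n :=
  gradient (fun y => φ (z.1, y)) z.2

/-- The space-time domain `(0, ∞) × ℝⁿ`. -/
def spaceTime (n : ℕ) : Set (ℝ × E n) := Ioi 0 ×ˢ univ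

/-- The bounded space-time cylinder `(0, T) × B(0, R)`. -/
def cylinder (n : ℕ) (T R : ℝ) : Set (ℝ × E n) := Ioo 0 T ×ˢ Metric.ball 0 R

/-- `G` is the distributional spatial gradient of `w` on `(0, ∞) × ℝⁿ`, and it belongs to
`L²((0, T) × B(0, R))` for all `T, R > 0`. -/
structure IsWeakSpaceGrad {n : ℕ} (w : ℝ × E n → ℝ) (G : ℝ × E n → E n) : Prop where
  locL2 : ∀ T R : ℝ, 0 < T → 0 < R → MemLp G 2 (volume.restrict (cylinder n T R))
  eq : ∀ φ : ℝ × E n → ℝ, IsTest φ →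
    ∫ z in spaceTime n, w z • spaceGrad φ z = - ∫ z in spaceTime n, φ z • G z

/-- Global weak solutions `ρ : (0, ∞) × ℝⁿ → [0, ∞)` of
`∂ₜρ = Δ ρ^m + div (ρ ∇(U * ρ))`, `ρ(0) = ρ₀`, where `U(x) = |x|^A / A`. -/
structure IsGlobalWeakSolution {n : ℕ} (A m : ℝ) (ρ₀ : E n → ℝ) (ρ : ℝ → E n → ℝ) : Prop where
  measurable : AEStronglyMeasurable (fun z : ℝ × E n => ρ z.1 z.2)
    (volume.restrict (spaceTime n))
  nonneg : ∀ᵐ t ∂(volume.restrict (Ioi (0 : ℝ))), 0 ≤ᵐ[volume] ρ t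
  /-- `ρ ∈ L^∞(0, T; L¹ ∩ L^∞)` for every finite `T`, with a bound that may depend on `T`. -/
  locBounded : ∀ T : ℝ, 0 < T → ∃ K : ℝ≥0, ∀ᵐ t ∂(volume.restrict (Ioo 0 T)),
    eLpNorm (ρ t) 1 volume ≤ K ∧ eLpNorm (ρ t) ⊤ volume ≤ K
  /-- The integral that defines the velocity field converges absolutely almost everywhere, to a
  field in `L²((0, T) × B(0, R))` for all `T, R > 0`. -/
  velocity_locL2 : ∀ T R : ℝ, 0 < T → 0 < R →
    ∫⁻ z in cylinder n T R,
      (∫⁻ y, ‖ρ z.1 y • gradient (potential A) (z.2 - y)‖ₑ) ^ 2 < ⊤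
  /-- `ρ^m` has a spatial gradient `G` in `L²` on bounded cylinders, and the equation and the
  initial condition hold in the sense of distributions on `[0, ∞) × ℝⁿ`. -/
  weak_form : ∃ G : ℝ × E n → E n,
    IsWeakSpaceGrad (fun z => ρ z.1 z.2 ^ m) G ∧
    ∀ φ : ℝ × E n → ℝ, IsTest φ →
      (∫ z in spaceTime n,
        (ρ z.1 z.2 * timeDeriv φ z
          - inner ℝ (G z + ρ z.1 z.2 • velocity A ρ z.1 z.2) (spaceGrad φ z)))
      + ∫ x, ρ₀ x * φ (0, x) = 0

end AggDiff

end

/-! The proof is a De Giorgi iteration. It shows that a bound `u ≤ K` on `{t < T}` improves to `u ≤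
K / 2` as soon as `K` exceeds a constant fixed by the data (`DriftDiffusion.halve_bound`). A weak
solution has some finite bound on every bounded time interval; finitely many halvings bring it down
to that constant, which does not depend on `T`, so the bound is uniform in time
(`exists_flow_bound`).

Two effects compete in the energy of the truncation `f = (u - k)₊`, `k ≥ K / 4`. Diffusion gives `∫
m u^(m-1) |∇f|²`, and on `{u > k}` the coefficient is at least a `d` of order `K^(m-1)`. Attraction
gives `∫ (div v)(f² / 2 + k f)` with `v = ∇U * u` and `div v = (n + A - 2) |x|^(A-2) * u`. Since `-n
< A - 2 ≤ 0`, cutting this convolution at `|x| = K^(-1/n)` yields `div v ≤ Λ` with `Λ` of order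
`K^((2-A)/n)` and a factor that depends on the mass (`exists_divLE_drift`). If `{f > 0}` has slices
of measure at most `s`, the Sobolev inequality gives `∫ f² ≤ C s^(2/n) ∫ |∇f|²`. Hence `y = ∫ f²`
satisfies `y' ≤ -μ y + 2 Λ Q`, and, starting from zero, it stays below the equilibrium for all times
(`level_bound`). Chebyshev controls `s` and `Q` by the energy at the previous level (`level_step`).
Along levels rising to `K / 2` the energies tend to zero provided `Λ (M / K)^(2/n)` is small
compared with `K^(m-1)`. The former is of order `K^(-A/n)`, so `m > 1 - A/n` is exactly what makes
this true for large `K` (`exists_smallness_threshold`).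

Weak solutions require care at four places. The density is continued to `t ≤ 0` by its initial
datum, with flux and drift zero there, so that the equation holds on all of space-time without an
initial term (`IsGlobalWeakSolution.exists_flow`). No time derivative of `u` is available; time
differences and the convexity of `(s - k)₊²` take its place (`WeakEvolution.energy`). Only `u^m` has
a weak gradient, but `(u - k)₊` is a truncated smooth function of it because `k > 0`
(`exists_excess_grad`). Finally the drift may grow linearly in space, so cutoffs are removed by
means of the integrability of `u |v| / (1 + |x|)` (`decay`).

The mass in `Λ` has to be bounded independently of time, which is `AttractiveFlow.mass_le`: the flux
through large spheres vanishes. For `m < 1` this uses `n (1 - m) < 2`, a consequence of `m > 1 -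
A/n` and `A ≤ 2`. -/

namespace AggDiff
open Filter Topology

/-! ### Translations and mollification in `L²` -/

section Mollify
variable {G V : Type*} [NormedAddCommGroup G] [NormedSpace ℝ G] [MeasurableSpace G] [BorelSpace G]
  [FiniteDimensional ℝ G] [NormedAddCommGroup V]
  {μ : Measure G} [μ.IsAddHaarMeasure]

/-- Translations are continuous in `L²`. -/
theorem tendsto_eLpNorm_translate {g : G → V} (hg : MemLp g 2 μ) :
    Tendsto (fun w : G => eLpNorm (fun z => g (z - w) - g z) 2 μ) (𝓝 0) (𝓝 0) := by
  have hc : Continuous (fun w : G => (⟨fun z => z - w, by fun_prop⟩ : C(G, G))) :=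
    ContinuousMap.continuous_of_continuous_uncurry _ (by
      change Continuous (fun p : G × G => p.2 - p.1); fun_prop)
  -- In `Lp` with finite exponent, composition with measure preserving maps is continuous in the
  -- map; here the maps are the translations.
  have h := (continuous_const (y := hg.toLp g)).compMeasurePreservingLp
    (μ := μ) (ν := μ) hc (fun w => measurePreserving_sub_right μ w) (by simp)
  have h0 := h.tendsto 0
  rw [tendsto_iff_edist_tendsto_0] at h0
  refine h0.congr fun w => ?_
  have e1 : Lp.compMeasurePreserving _ (measurePreserving_sub_right μ w) (hg.toLp g) =
      (hg.comp_measurePreserving (measurePreserving_sub_right μ w)).toLp _ :=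
    Lp.toLp_compMeasurePreserving hg (measurePreserving_sub_right μ w)
  have e2 : Lp.compMeasurePreserving _ (measurePreserving_sub_right μ (0:G)) (hg.toLp g) =
      (hg.comp_measurePreserving (measurePreserving_sub_right μ 0)).toLp _ :=
    Lp.toLp_compMeasurePreserving hg (measurePreserving_sub_right μ 0)
  simp only [ContinuousMap.coe_mk]
  rw [e1, e2, Lp.edist_toLp_toLp]
  congr 1
  ext z
  simp

variable [NormedSpace ℝ V] [CompleteSpace V]

/-- Mollification of an `L²` function converges in `L²`. -/
theorem tendsto_eLpNorm_mollify {g : G → V} (hg : MemLp g 2 μ) {φ : ℕ → ContDiffBump (0 : G)}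
    (hφ : Tendsto (fun i => (φ i).rOut) atTop (𝓝 0)) :
    Tendsto (fun i => eLpNorm (fun z =>
      convolution ((φ i).normed μ) g (ContinuousLinearMap.lsmul ℝ ℝ) μ z - g z) 2 μ)
      atTop (𝓝 0) := by
  have hloc : LocallyIntegrable g μ := hg.locallyIntegrable (by norm_num)
  rw [ENNReal.tendsto_atTop_zero]
  intro ε hε
  have h1 := (ENNReal.tendsto_nhds_zero.1 (tendsto_eLpNorm_translate hg)) ε hε
  obtain ⟨δ, hδ, hball⟩ := Metric.eventually_nhds_iff_ball.1 h1
  obtain ⟨N, hN⟩ := eventually_atTop.1 (hφ.eventually (gt_mem_nhds hδ))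
  refine ⟨N, fun i hi => ?_⟩
  set ψ := (φ i).normed μ with hψ
  -- With the kernel as density of a probability measure, the Jensen inequality for the average
  -- becomes the comparison of the `L¹` and `L²` norms for `ν`.
  let ν : Measure G := μ.withDensity (fun w => ENNReal.ofReal (ψ w))
  have hψc : Continuous ψ := (φ i).continuous_normed
  have hψn : ∀ w, 0 ≤ ψ w := (φ i).nonneg_normed
  have hψi : Integrable ψ μ := (φ i).integrable_normed
  have hprob : IsProbabilityMeasure ν := ⟨by
    rw [withDensity_apply _ MeasurableSet.univ, Measure.restrict_univ,
      ← ofReal_integral_eq_lintegral_ofReal hψi (ae_of_all _ hψn)]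
    simp [hψ, (φ i).integral_normed]⟩
  have hgm : AEStronglyMeasurable (fun p : G × G => g (p.1 - p.2)) (μ.prod μ) :=
    hg.1.comp_quasiMeasurePreserving (quasiMeasurePreserving_sub_of_right_invariant μ μ)
  have hgm2 : AEStronglyMeasurable (fun p : G × G => g (p.1 - p.2) - g p.1) (μ.prod μ) :=
    hgm.sub hg.1.comp_fst
  have hνac : ν ≪ μ := withDensity_absolutelyContinuous _ _
  have hgm3 : AEStronglyMeasurable (fun p : G × G => g (p.1 - p.2) - g p.1) (μ.prod ν) :=
    hgm2.mono_ac (Measure.AbsolutelyContinuous.rfl.prod hνac)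
  -- pointwise bound
  have hpt : ∀ᵐ z ∂μ, ‖convolution ψ g (ContinuousLinearMap.lsmul ℝ ℝ) μ z - g z‖ₑ ^ (2:ℝ) ≤
      ∫⁻ w, ‖g (z - w) - g z‖ₑ ^ (2:ℝ) ∂ν := by
    filter_upwards [hgm3.prodMk_left] with z hz
    have hzi : Integrable (fun w => ψ w • g (z - w)) μ :=
      (HasCompactSupport.convolutionExists_left (ContinuousLinearMap.lsmul ℝ ℝ)
        (φ i).hasCompactSupport_normed hψc hloc z)
    have e : convolution ψ g (ContinuousLinearMap.lsmul ℝ ℝ) μ z - g z =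
        ∫ w, ψ w • (g (z - w) - g z) ∂μ := by
      simp_rw [smul_sub]
      rw [integral_sub hzi (hψi.smul_const _), integral_smul_const, (φ i).integral_normed, one_smul]
      rfl
    rw [e]
    have hb : ‖∫ w, ψ w • (g (z - w) - g z) ∂μ‖ₑ ≤ eLpNorm (fun w => g (z - w) - g z) 1 ν := by
      rw [eLpNorm_one_eq_lintegral_enorm, lintegral_withDensity_eq_lintegral_mul₀'
        (by fun_prop) hz.enorm]
      refine (enorm_integral_le_lintegral_enorm _).trans (lintegral_mono fun w => ?_)
      simp [enorm_smul, Real.enorm_eq_ofReal (hψn w)]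
    have hb2 := hb.trans (eLpNorm_le_eLpNorm_of_exponent_le (q := 2) (by norm_num) hz)
    rw [eLpNorm_eq_lintegral_rpow_enorm_toReal (by norm_num) (by norm_num)] at hb2
    have := ENNReal.rpow_le_rpow hb2 (z := 2) (by norm_num)
    rw [← ENNReal.rpow_mul] at this
    simpa using this
  rw [eLpNorm_eq_lintegral_rpow_enorm_toReal (by norm_num) (by norm_num)]
  -- The measure only sees shifts shorter than `δ`, for which the translation estimate holds; after
  -- Tonelli the average of these errors is at most `ε ^ 2`.
  have hsupp : ∀ᵐ w ∂ν, w ∈ Metric.ball (0:G) δ := by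
    rw [ae_withDensity_iff (by fun_prop)]
    refine ae_of_all _ fun w hw => ?_
    have hne : w ∈ Function.support ψ := by
      intro h0
      simp [h0] at hw
    rw [(φ i).support_normed_eq] at hne
    exact Metric.ball_subset_ball (hN i hi).le hne
  have key : ∫⁻ z, ‖convolution ψ g (ContinuousLinearMap.lsmul ℝ ℝ) μ z - g z‖ₑ ^ (2:ℝ) ∂μ
      ≤ ε ^ (2:ℝ) := by
    calc _ ≤ ∫⁻ z, ∫⁻ w, ‖g (z - w) - g z‖ₑ ^ (2:ℝ) ∂ν ∂μ := lintegral_mono_ae hpt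
      _ = ∫⁻ w, ∫⁻ z, ‖g (z - w) - g z‖ₑ ^ (2:ℝ) ∂μ ∂ν :=
        lintegral_lintegral_swap (f := fun z w => ‖g (z - w) - g z‖ₑ ^ (2:ℝ)) (hgm3.enorm.pow_const _)
      _ ≤ ∫⁻ w, ε ^ (2:ℝ) ∂ν := by
        refine lintegral_mono_ae (hsupp.mono fun w hw => ?_)
        have := hball w hw
        rw [eLpNorm_eq_lintegral_rpow_enorm_toReal (by norm_num) (by norm_num)] at this
        have := ENNReal.rpow_le_rpow this (z := 2) (by norm_num)
        rw [← ENNReal.rpow_mul] at this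
        simpa using this
      _ = ε ^ (2:ℝ) := by simp
  have := ENNReal.rpow_le_rpow key (z := 1/2) (by norm_num)
  rw [← ENNReal.rpow_mul] at this
  simpa using this

end Mollify

/-! ### Test functions on space-time and their derivatives -/

/-- Space-time `ℝ × ℝⁿ`. -/
abbrev Z (n : ℕ) : Type := ℝ × E n

variable {n : ℕ}

instance : (volume : Measure (Z n)).IsAddHaarMeasure :=
  inferInstanceAs ((volume : Measure ℝ).prod (volume : Measure (E n))).IsAddHaarMeasure

/-- The Riesz representative of the spatial part of a functional on space-time. -/
noncomputable def gradL (n : ℕ) : (Z n →L[ℝ] ℝ) →L[ℝ] E n :=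
  LinearMap.mkContinuous
    { toFun := fun L => (InnerProductSpace.toDual ℝ (E n)).symm
        (L.comp (ContinuousLinearMap.inr ℝ ℝ (E n)))
      map_add' := fun L L' => by rw [ContinuousLinearMap.add_comp, map_add]
      map_smul' := fun c L => by
        rw [ContinuousLinearMap.smul_comp, LinearIsometryEquiv.map_smulₛₗ]; simp } 1 (fun L => by
      simp only [LinearMap.coe_mk, AddHom.coe_mk, LinearIsometryEquiv.norm_map, one_mul]
      refine (L.opNorm_comp_le _).trans ?_
      exact mul_le_of_le_one_right (norm_nonneg _) (ContinuousLinearMap.norm_inr_le_one ℝ ℝ (E n)))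

theorem inner_gradL (L : Z n →L[ℝ] ℝ) (e : E n) : inner ℝ (gradL n L) e = L (0, e) := by
  change inner ℝ ((InnerProductSpace.toDual ℝ (E n)).symm _) e = _
  rw [InnerProductSpace.toDual_symm_apply]; rfl

theorem spaceGrad_eq {φ : Z n → ℝ} {z : Z n} (h : DifferentiableAt ℝ φ z) :
    spaceGrad φ z = gradL n (fderiv ℝ φ z) := by
  have : HasFDerivAt (fun y => φ (z.1, y))
      ((fderiv ℝ φ z).comp (ContinuousLinearMap.inr ℝ ℝ (E n))) z.2 :=
    HasFDerivAt.comp z.2 (f := fun y => (z.1, y)) (g := φ) h.hasFDerivAt (hasFDerivAt_prodMk_right z.1 z.2)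
  unfold spaceGrad gradient
  rw [this.fderiv]; rfl

theorem timeDeriv_eq {φ : Z n → ℝ} {z : Z n} (h : DifferentiableAt ℝ φ z) :
    timeDeriv φ z = fderiv ℝ φ z (1, 0) := by
  have : HasFDerivAt (fun s => φ (s, z.2))
      ((fderiv ℝ φ z).comp (ContinuousLinearMap.inl ℝ ℝ (E n))) z.1 :=
    HasFDerivAt.comp z.1 (f := fun s => (s, z.2)) (g := φ) h.hasFDerivAt (hasFDerivAt_prodMk_left z.1 z.2)
  unfold timeDeriv
  rw [this.hasDerivAt.deriv]; rfl

namespace IsTest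
variable {φ ψ : Z n → ℝ}

theorem differentiable (h : IsTest φ) : Differentiable ℝ φ := h.1.differentiable (by simp)
theorem continuous (h : IsTest φ) : Continuous φ := h.1.continuous

theorem continuous_fderiv (h : IsTest φ) : Continuous (fderiv ℝ φ) :=
  h.1.continuous_fderiv (by simp)

theorem spaceGrad_eq (h : IsTest φ) : spaceGrad φ = fun z => gradL n (fderiv ℝ φ z) :=
  funext fun z => AggDiff.spaceGrad_eq (h.differentiable z)

theorem timeDeriv_eq (h : IsTest φ) : timeDeriv φ = fun z => fderiv ℝ φ z (1, 0) :=
  funext fun z => AggDiff.timeDeriv_eq (h.differentiable z)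

theorem continuous_spaceGrad (h : IsTest φ) : Continuous (spaceGrad φ) := by
  rw [h.spaceGrad_eq]; exact (gradL n).continuous.comp h.continuous_fderiv

theorem continuous_timeDeriv (h : IsTest φ) : Continuous (timeDeriv φ) := by
  rw [h.timeDeriv_eq]; exact h.continuous_fderiv.clm_apply continuous_const

theorem hasCompactSupport_spaceGrad (h : IsTest φ) : HasCompactSupport (spaceGrad φ) := by
  rw [h.spaceGrad_eq]
  exact (h.2.fderiv (𝕜 := ℝ)).comp_left (g := gradL n) (map_zero _)

theorem hasCompactSupport_timeDeriv (h : IsTest φ) : HasCompactSupport (timeDeriv φ) := by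
  rw [h.timeDeriv_eq]
  exact (h.2.fderiv (𝕜 := ℝ)).comp_left (g := fun L : Z n →L[ℝ] ℝ => L (1, 0)) rfl

theorem mul_contDiff (h : IsTest φ) {χ : Z n → ℝ} (hχ : ContDiff ℝ ((⊤ : ℕ∞) : WithTop ℕ∞) χ) :
    IsTest (fun z => φ z * χ z) := ⟨h.1.mul hχ, h.2.mul_right⟩

theorem mul (h : IsTest φ) (h' : IsTest ψ) : IsTest (fun z => φ z * ψ z) := h.mul_contDiff h'.1

theorem spaceGrad_mul_apply {φ ψ : Z n → ℝ} {z : Z n} (h : DifferentiableAt ℝ φ z)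
    (h' : DifferentiableAt ℝ ψ z) :
    spaceGrad (fun z => φ z * ψ z) z = φ z • spaceGrad ψ z + ψ z • spaceGrad φ z := by
  rw [AggDiff.spaceGrad_eq (φ := fun z => φ z * ψ z) (h.mul h'), AggDiff.spaceGrad_eq h, AggDiff.spaceGrad_eq h',
    fderiv_fun_mul h h']
  simp

theorem comp_sub (h : IsTest φ) (w : Z n) : IsTest (fun z => φ (z - w)) := by
  refine ⟨h.1.comp (contDiff_id.sub contDiff_const), ?_⟩
  exact h.2.comp_homeomorph (Homeomorph.subRight w)

theorem comp_sub_left (h : IsTest φ) (w : Z n) : IsTest (fun z => φ (w - z)) := by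
  refine ⟨h.1.comp (contDiff_const.sub contDiff_id), ?_⟩
  exact h.2.comp_homeomorph (Homeomorph.subLeft w)

theorem spaceGrad_comp_sub (h : IsTest φ) (w z : Z n) :
    spaceGrad (fun z => φ (z - w)) z = spaceGrad φ (z - w) := by
  rw [(h.comp_sub w).spaceGrad_eq, h.spaceGrad_eq]
  simp only [_root_.fderiv_comp_sub]

theorem timeDeriv_comp_sub (h : IsTest φ) (w z : Z n) :
    timeDeriv (fun z => φ (z - w)) z = timeDeriv φ (z - w) := by
  rw [(h.comp_sub w).timeDeriv_eq, h.timeDeriv_eq]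
  simp only [_root_.fderiv_comp_sub]

theorem spaceGrad_comp_sub_left (h : IsTest φ) (w z : Z n) :
    spaceGrad (fun z => φ (w - z)) z = - spaceGrad φ (w - z) := by
  rw [(h.comp_sub_left w).spaceGrad_eq, h.spaceGrad_eq]
  have : fderiv ℝ (fun z => φ (w - z)) z = - fderiv ℝ φ (w - z) := by
    have h2 : HasFDerivAt (fun z => φ (w - z)) ((fderiv ℝ φ (w - z)).comp
        (- ContinuousLinearMap.id ℝ (Z n))) z :=
      HasFDerivAt.comp z (h.differentiable (w - z)).hasFDerivAt ((hasFDerivAt_id z).const_sub w)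
    rw [h2.fderiv]; ext <;> simp
  simp only [this, map_neg]

theorem exists_radius (h : IsTest φ) : ∃ r : ℝ, 0 < r ∧ (∀ z, z ∉ Metric.closedBall (0 : Z n) r →
    φ z = 0 ∧ spaceGrad φ z = 0 ∧ timeDeriv φ z = 0) := by
  obtain ⟨r, hr, hs⟩ := h.2.isCompact.isBounded.subset_closedBall_lt 0 0
  refine ⟨r, hr, fun z hz => ?_⟩
  have hz' : z ∉ tsupport φ := fun h' => hz (hs h')
  have h0 : fderiv ℝ φ z = 0 := by
    by_contra hne
    exact hz' (support_fderiv_subset ℝ hne)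
  refine ⟨image_eq_zero_of_notMem_tsupport hz', ?_, ?_⟩
  · simp [h.spaceGrad_eq, h0]
  · simp [h.timeDeriv_eq, h0]

theorem memLp (h : IsTest φ) (p : ℝ≥0∞) : MemLp φ p volume :=
  h.continuous.memLp_of_hasCompactSupport h.2

theorem memLp_spaceGrad (h : IsTest φ) (p : ℝ≥0∞) : MemLp (spaceGrad φ) p volume :=
  h.continuous_spaceGrad.memLp_of_hasCompactSupport h.hasCompactSupport_spaceGrad

end IsTest

/-! ### Weak spatial gradients: mollification, product rule and chain rule -/

/-- Local square integrability on space-time. -/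
def LocL2 {V : Type*} [NormedAddCommGroup V] (f : Z n → V) : Prop :=
  ∀ r : ℝ, MemLp f 2 (volume.restrict (Metric.closedBall (0 : Z n) r))

theorem LocL2.locallyIntegrable {V : Type*} [NormedAddCommGroup V] {f : Z n → V} (h : LocL2 f) :
    LocallyIntegrable f volume := by
  rw [locallyIntegrable_iff]
  intro k hk
  obtain ⟨r, hr⟩ := hk.isBounded.subset_closedBall 0
  have : IsFiniteMeasure (volume.restrict (Metric.closedBall (0 : Z n) r)) :=
    ⟨by rw [Measure.restrict_apply_univ]; exact (isCompact_closedBall _ _).measure_lt_top⟩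
  exact IntegrableOn.mono_set ((h r).integrable (by norm_num)) hr

theorem LocL2.aestronglyMeasurable {V : Type*} [NormedAddCommGroup V] {f : Z n → V} (h : LocL2 f) :
    AEStronglyMeasurable f volume := h.locallyIntegrable.aestronglyMeasurable

/-- `g` is the weak spatial gradient of `f` on all of space-time. -/
def WeakGrad (f : Z n → ℝ) (g : Z n → E n) : Prop :=
  ∀ φ : Z n → ℝ, IsTest φ → ∫ z, f z • spaceGrad φ z = - ∫ z, φ z • g z

/-- A square integrable function with bounded support and square integrable spatial gradient. -/
structure CPair (ψ : Z n → ℝ) (P : Z n → E n) : Prop where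
  memLp : MemLp ψ 2 volume
  memLp_grad : MemLp P 2 volume
  supp : ∃ r : ℝ, ∀ z, z ∉ Metric.closedBall (0 : Z n) r → ψ z = 0 ∧ P z = 0
  weakGrad : WeakGrad ψ P

/-- The standard mollifiers. -/
noncomputable def bump (n : ℕ) (j : ℕ) : ContDiffBump (0 : Z n) where
  rIn := 1 / (2 * ((j : ℝ) + 1))
  rOut := 1 / ((j : ℝ) + 1)
  rIn_pos := by positivity
  rIn_lt_rOut := by
    have : (0:ℝ) < (j : ℝ) + 1 := by positivity
    apply one_div_lt_one_div_of_lt this; linarith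

theorem tendsto_bump_rOut : Tendsto (fun j => (bump n j).rOut) atTop (𝓝 0) :=
  tendsto_one_div_add_atTop_nhds_zero_nat

/-- Mollification. -/
noncomputable def moll {V : Type*} [NormedAddCommGroup V] [NormedSpace ℝ V] (j : ℕ) (f : Z n → V) : Z n → V :=
  convolution ((bump n j).normed volume) f (ContinuousLinearMap.lsmul ℝ ℝ) volume

theorem isTest_bump (j : ℕ) : IsTest ((bump n j).normed volume) :=
  ⟨(bump n j).contDiff_normed, (bump n j).hasCompactSupport_normed⟩

section
variable {V : Type*} [NormedAddCommGroup V] [NormedSpace ℝ V]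

theorem moll_apply (j : ℕ) (f : Z n → V) (z : Z n) :
    moll j f z = ∫ w, (bump n j).normed volume (z - w) • f w := convolution_eq_swap _

theorem moll_contDiff (j : ℕ) {f : Z n → V} [CompleteSpace V] (hf : LocallyIntegrable f volume) :
    ContDiff ℝ ((⊤ : ℕ∞) : WithTop ℕ∞) (moll j f) :=
  (bump n j).hasCompactSupport_normed.contDiff_convolution_left _ (bump n j).contDiff_normed hf

theorem moll_eq_zero {j : ℕ} {f : Z n → V} {z : Z n}
    (h : ∀ w, dist w z ≤ 1 / ((j : ℝ) + 1) → f w = 0) : moll j f z = 0 := by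
  rw [moll_apply]
  refine integral_eq_zero_of_ae (ae_of_all _ fun w => ?_)
  by_cases hw : dist w z ≤ 1 / ((j : ℝ) + 1)
  · simp [h w hw]
  · have : z - w ∉ Function.support ((bump n j).normed volume) := by
      rw [(bump n j).support_normed_eq, mem_ball_zero_iff, ← dist_eq_norm, dist_comm]
      intro h'; exact hw (le_of_lt h')
    simp [Function.notMem_support.1 this]

theorem tendsto_moll [CompleteSpace V] {f : Z n → V} (hf : MemLp f 2 volume) :
    Tendsto (fun j => eLpNorm (fun z => moll j f z - f z) 2 volume) atTop (𝓝 0) :=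
  tendsto_eLpNorm_mollify hf tendsto_bump_rOut
end

theorem moll_nonneg (j : ℕ) {f : Z n → ℝ} (hf : 0 ≤ᵐ[volume] f) (z : Z n) : 0 ≤ moll j f z := by
  rw [moll_apply]
  exact integral_nonneg_of_ae (hf.mono fun w hw =>
    smul_nonneg ((bump n j).nonneg_normed _) hw)

theorem abs_moll_le (j : ℕ) {f : Z n → ℝ} {B : ℝ} (hf : ∀ᵐ z, |f z| ≤ B) (z : Z n) :
    |moll j f z| ≤ B := by
  rw [moll_apply, ← Real.norm_eq_abs]
  have hi : Integrable (fun w => (bump n j).normed volume (z - w) * B) volume :=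
    ((bump n j).integrable_normed.comp_sub_left z).mul_const B
  refine (norm_integral_le_of_norm_le hi (hf.mono fun w hw => ?_)).trans ?_
  · rw [norm_smul, Real.norm_of_nonneg ((bump n j).nonneg_normed _)]
    exact mul_le_mul_of_nonneg_left hw ((bump n j).nonneg_normed _)
  · rw [integral_mul_const, integral_sub_left_eq_self ((bump n j).normed volume) volume z,
      (bump n j).integral_normed, one_mul]

/-- The derivative of the convolution falls on the kernel. For fixed `z` the reflected kernel `w ↦ φ
(z - w)` is a test function whose gradient carries a minus sign, so the definition of the weak
gradient moves the derivative onto `f`. -/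
theorem spaceGrad_moll (j : ℕ) {f : Z n → ℝ} {g : Z n → E n} (hf : LocallyIntegrable f volume)
    (h : WeakGrad f g) : spaceGrad (moll j f) = moll j g := by
  funext z
  set φ := (bump n j).normed (volume : Measure (Z n)) with hφ
  have hT : IsTest φ := isTest_bump j
  rw [spaceGrad_eq ((moll_contDiff j hf).differentiable (by simp) z), moll_apply]
  have h1 := hT.2.hasFDerivAt_convolution_left (μ := volume) (ContinuousLinearMap.lsmul ℝ ℝ)
    (hT.1.of_le (by simp)) hf z
  have h2 : fderiv ℝ (moll j f) z = _ := h1.fderiv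
  rw [h2, convolution_eq_swap]
  have e : ∀ w, ((ContinuousLinearMap.lsmul ℝ ℝ).precompL (Z n) (fderiv ℝ φ (z - w))) (f w) =
      f w • fderiv ℝ φ (z - w) := by
    intro w; ext <;> simp [mul_comm]
  simp_rw [e]
  have hint : Integrable (fun w => f w • fderiv ℝ φ (z - w)) volume := by
    refine hf.integrable_smul_right_of_hasCompactSupport ?_ ?_
    · exact hT.continuous_fderiv.comp (continuous_const.sub continuous_id)
    · exact (hT.2.fderiv (𝕜 := ℝ)).comp_homeomorph (Homeomorph.subLeft z)
  rw [← ContinuousLinearMap.integral_comp_comm _ hint]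
  have h3 := h _ (hT.comp_sub_left z)
  simp_rw [hT.spaceGrad_comp_sub_left, hT.spaceGrad_eq] at h3
  simp only [smul_neg, integral_neg, neg_inj] at h3
  simpa using h3

/-- Smooth approximation of pairs with bounded support. -/
theorem CPair.moll {ψ : Z n → ℝ} {P : Z n → E n} (h : CPair ψ P) :
    (∀ j, IsTest (moll j ψ)) ∧ (∀ j, spaceGrad (AggDiff.moll j ψ) = AggDiff.moll j P) ∧
    (∃ r : ℝ, ∀ j z, z ∉ Metric.closedBall (0 : Z n) r → AggDiff.moll j ψ z = 0 ∧ AggDiff.moll j P z = 0) := by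
  obtain ⟨r, hr⟩ := h.supp
  have hl : LocallyIntegrable ψ volume := h.memLp.locallyIntegrable (by norm_num)
  have hs : ∀ j z, z ∉ Metric.closedBall (0 : Z n) (r + 1) → AggDiff.moll j ψ z = 0 ∧ AggDiff.moll j P z = 0 := by
    intro j z hz
    have : ∀ w, dist w z ≤ 1 / ((j : ℝ) + 1) → w ∉ Metric.closedBall (0 : Z n) r := by
      intro w hw hw2
      apply hz
      rw [Metric.mem_closedBall] at hw2 ⊢
      have : 1 / ((j : ℝ) + 1) ≤ 1 := by
        rw [div_le_one (by positivity)]; linarith [Nat.cast_nonneg (α := ℝ) j]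
      linarith [dist_triangle_left z 0 w]
    exact ⟨moll_eq_zero fun w hw => (hr w (this w hw)).1, moll_eq_zero fun w hw => (hr w (this w hw)).2⟩
  refine ⟨fun j => ⟨moll_contDiff j hl, ?_⟩, fun j => spaceGrad_moll j hl h.weakGrad, r + 1, hs⟩
  exact HasCompactSupport.intro (isCompact_closedBall _ _) fun z hz => (hs j z hz).1

/-- Cauchy–Schwarz. In the applications `D j` is the error of an `L²` approximation, so this is the
common form of the passages to the limit under mollification. -/
theorem tendsto_integral_zero_of_le_mul {X V : Type*} [MeasurableSpace X] {μ : Measure X}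
    [NormedAddCommGroup V] {A : X → ℝ} (hA : MemLp A 2 μ) {D : ℕ → X → V}
    (hD : ∀ j, MemLp (D j) 2 μ) (h0 : Tendsto (fun j => eLpNorm (D j) 2 μ) atTop (𝓝 0))
    {h : ℕ → X → ℝ} (hh : ∀ j, ∀ᵐ x ∂μ, |h j x| ≤ A x * ‖D j x‖) :
    Tendsto (fun j => ∫ x, h j x ∂μ) atTop (𝓝 0) := by
  rw [tendsto_zero_iff_enorm_tendsto_zero]
  have hb : ∀ j, ‖∫ x, h j x ∂μ‖ₑ ≤ eLpNorm A 2 μ * eLpNorm (D j) 2 μ := by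
    intro j
    refine (enorm_integral_le_lintegral_enorm _).trans ?_
    have h1 : ∫⁻ x, ‖h j x‖ₑ ∂μ ≤ ∫⁻ x, ((fun x => ‖A x‖ₑ) * (fun x => ‖D j x‖ₑ)) x ∂μ := by
      refine lintegral_mono_ae ((hh j).mono fun x hx => ?_)
      have : ‖h j x‖ ≤ ‖A x‖ * ‖D j x‖ := by
        rw [Real.norm_eq_abs]
        exact hx.trans (mul_le_mul_of_nonneg_right (le_abs_self _) (norm_nonneg _))
      simp only [Pi.mul_apply]
      rw [← ofReal_norm, ← ofReal_norm, ← ofReal_norm, ← ENNReal.ofReal_mul (norm_nonneg _)]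
      exact ENNReal.ofReal_le_ofReal this
    refine h1.trans ((ENNReal.lintegral_mul_le_Lp_mul_Lq μ Real.HolderConjugate.two_two
      hA.1.enorm (hD j).1.enorm).trans (le_of_eq ?_))
    rw [eLpNorm_eq_lintegral_rpow_enorm_toReal (by norm_num) (by norm_num),
      eLpNorm_eq_lintegral_rpow_enorm_toReal (by norm_num) (by norm_num)]
    simp
  refine tendsto_of_tendsto_of_tendsto_of_le_of_le tendsto_const_nhds ?_ (fun _ => zero_le) hb
  have := ENNReal.Tendsto.const_mul (a := eLpNorm A 2 μ) h0 (Or.inr hA.2.ne)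
  simpa using this

theorem integrable_inner_of_memLp {X V : Type*} [MeasurableSpace X] {μ : Measure X}
    [NormedAddCommGroup V] [InnerProductSpace ℝ V] {F D : X → V} (hF : MemLp F 2 μ) (hD : MemLp D 2 μ) :
    Integrable (fun x => inner ℝ (F x) (D x)) μ :=
  (hF.norm.integrable_mul hD.norm).mono' (hF.1.inner hD.1)
    (ae_of_all _ fun x => norm_inner_le_norm (F x) (D x))

/-- `L²` convergence passes to the limit in an inner product with a fixed `L²` function. -/
theorem tendsto_integral_inner {X V : Type*} [MeasurableSpace X] {μ : Measure X}
    [NormedAddCommGroup V] [InnerProductSpace ℝ V] {F : X → V} (hF : MemLp F 2 μ) {D : ℕ → X → V}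
    {D₀ : X → V} (hD : ∀ j, MemLp (D j) 2 μ) (hD₀ : MemLp D₀ 2 μ)
    (h0 : Tendsto (fun j => eLpNorm (fun x => D j x - D₀ x) 2 μ) atTop (𝓝 0)) :
    Tendsto (fun j => ∫ x, inner ℝ (F x) (D j x) ∂μ) atTop (𝓝 (∫ x, inner ℝ (F x) (D₀ x) ∂μ)) := by
  have h1 := tendsto_integral_zero_of_le_mul hF.norm (fun j => (hD j).sub hD₀) h0
    (h := fun j x => inner ℝ (F x) (D j x - D₀ x))
    (fun j => ae_of_all _ fun x => by simpa using abs_real_inner_le_norm (F x) (D j x - D₀ x))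
  have h2 : ∀ j, ∫ x, inner ℝ (F x) (D j x - D₀ x) ∂μ =
      ∫ x, inner ℝ (F x) (D j x) ∂μ - ∫ x, inner ℝ (F x) (D₀ x) ∂μ := by
    intro j
    simp_rw [inner_sub_right]
    exact integral_sub (integrable_inner_of_memLp hF (hD j)) (integrable_inner_of_memLp hF hD₀)
  simp_rw [h2] at h1
  simpa using h1.add_const (∫ x, inner ℝ (F x) (D₀ x) ∂μ)

section
variable {V : Type*} [NormedAddCommGroup V]

theorem LocL2.memLp_of_supp {f : Z n → V} (h : LocL2 f) {r : ℝ}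
    (hr : ∀ z, z ∉ Metric.closedBall (0 : Z n) r → f z = 0) : MemLp f 2 volume := by
  have : (Metric.closedBall (0 : Z n) r).indicator f = f := by
    refine indicator_eq_self.2 fun z hz => ?_
    by_contra hne
    exact hz (hr z hne)
  rw [← this, memLp_indicator_iff_restrict Metric.isClosed_closedBall.measurableSet]
  exact h r

theorem LocL2.add {f g : Z n → V} (h : LocL2 f) (h' : LocL2 g) : LocL2 (fun z => f z + g z) :=
  fun r => (h r).add (h' r)

variable [NormedSpace ℝ V]

theorem LocL2.smul_bdd {f : Z n → V} (h : LocL2 f) {ω : Z n → ℝ}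
    (hm : AEStronglyMeasurable ω volume)
    (hb : ∀ r, ∃ B, ∀ᵐ z, z ∈ Metric.closedBall (0 : Z n) r → |ω z| ≤ B) :
    LocL2 (fun z => ω z • f z) := by
  intro r
  obtain ⟨B, hB⟩ := hb r
  refine (h r).of_le_mul (c := B) (hm.restrict.smul (h r).1) ?_
  filter_upwards [(ae_restrict_iff' Metric.isClosed_closedBall.measurableSet).2 hB] with z hz
  rw [norm_smul]
  exact mul_le_mul_of_nonneg_right hz (norm_nonneg _)

theorem _root_.Continuous.locBdd {V : Type*} [NormedAddCommGroup V] {ω : Z n → V} (h : Continuous ω)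
    (r : ℝ) : ∃ B, ∀ᵐ z, z ∈ Metric.closedBall (0 : Z n) r → ‖ω z‖ ≤ B := by
  obtain ⟨B, hB⟩ := (isCompact_closedBall (0 : Z n) r).exists_bound_of_continuousOn h.continuousOn
  exact ⟨B, ae_of_all _ hB⟩

theorem LocL2.smul_continuous {f : Z n → V} (h : LocL2 f) {ω : Z n → ℝ} (hω : Continuous ω) :
    LocL2 (fun z => ω z • f z) :=
  h.smul_bdd hω.aestronglyMeasurable hω.locBdd

theorem LocL2.smul_continuous_right {f : Z n → ℝ} (h : LocL2 f) {ω : Z n → V} (hω : Continuous ω) :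
    LocL2 (fun z => f z • ω z) := by
  intro r
  obtain ⟨B, hB⟩ := (isCompact_closedBall (0 : Z n) r).exists_bound_of_continuousOn hω.continuousOn
  refine (h r).of_le_mul (c := B) ((h r).1.smul hω.aestronglyMeasurable) ?_
  filter_upwards [ae_restrict_mem Metric.isClosed_closedBall.measurableSet] with z hz
  rw [norm_smul, mul_comm]
  exact mul_le_mul_of_nonneg_right (hB z hz) (norm_nonneg _)

end

/-- Local essential boundedness. -/
def LocBdd (f : Z n → ℝ) : Prop :=
  ∀ r : ℝ, ∃ B, ∀ᵐ z, z ∈ Metric.closedBall (0 : Z n) r → |f z| ≤ B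

theorem LocBdd.locL2 {f : Z n → ℝ} (h : LocBdd f) (hm : AEStronglyMeasurable f volume) : LocL2 f := by
  have h1 : LocL2 (fun _ : Z n => (1:ℝ)) := fun r => by
    have : IsFiniteMeasure (volume.restrict (Metric.closedBall (0 : Z n) r)) :=
      ⟨by rw [Measure.restrict_apply_univ]; exact (isCompact_closedBall _ _).measure_lt_top⟩
    exact memLp_const 1
  simpa using h1.smul_bdd hm h

/-- Multiplication by `χ` turns local objects into compactly supported ones and leaves both them and
their gradients unchanged on the given ball. -/
theorem exists_cutoff (n : ℕ) (r : ℝ) : ∃ χ : Z n → ℝ, IsTest χ ∧ (∀ z, 0 ≤ χ z) ∧ (∀ z, χ z ≤ 1) ∧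
    (∀ z ∈ Metric.closedBall (0 : Z n) r, χ z = 1 ∧ spaceGrad χ z = 0) := by
  let b : ContDiffBump (0 : Z n) := ⟨|r| + 1, |r| + 2, by positivity, by linarith⟩
  have hb : IsTest (b : Z n → ℝ) := ⟨b.contDiff, b.hasCompactSupport⟩
  refine ⟨b, hb, fun _ => b.nonneg, fun _ => b.le_one, fun z hz => ?_⟩
  have hz' : z ∈ Metric.ball (0 : Z n) (|r| + 1) :=
    Metric.closedBall_subset_ball (by linarith [le_abs_self r]) hz
  refine ⟨b.one_of_mem_closedBall (Metric.ball_subset_closedBall hz'), ?_⟩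
  have he : (b : Z n → ℝ) =ᶠ[𝓝 z] fun _ => 1 := b.eventuallyEq_one_of_mem_ball hz'
  rw [hb.spaceGrad_eq]
  simp [he.fderiv_eq]

/-- Weak gradients tested componentwise. -/
theorem weakGrad_iff {f : Z n → ℝ} {g : Z n → E n} (hf : LocallyIntegrable f volume)
    (hg : LocallyIntegrable g volume) : WeakGrad f g ↔ ∀ φ : Z n → ℝ, IsTest φ → ∀ e : E n,
      ∫ z, f z * inner ℝ (spaceGrad φ z) e = - ∫ z, φ z * inner ℝ (g z) e := by
  unfold WeakGrad
  refine forall₂_congr fun φ hφ => ?_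
  have i1 : Integrable (fun z => f z • spaceGrad φ z) volume :=
    hf.integrable_smul_right_of_hasCompactSupport hφ.continuous_spaceGrad hφ.hasCompactSupport_spaceGrad
  have i2 : Integrable (fun z => φ z • g z) volume :=
    hg.integrable_smul_left_of_hasCompactSupport hφ.continuous hφ.2
  have e1 : ∀ e : E n, ∫ z, f z * inner ℝ (spaceGrad φ z) e = inner ℝ (∫ z, f z • spaceGrad φ z) e := by
    intro e
    rw [real_inner_comm, ← integral_inner i1 e]
    simp [inner_smul_right, real_inner_comm]
  have e2 : ∀ e : E n, ∫ z, φ z * inner ℝ (g z) e = inner ℝ (∫ z, φ z • g z) e := by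
    intro e
    rw [real_inner_comm, ← integral_inner i2 e]
    simp [inner_smul_right, real_inner_comm]
  simp_rw [e1, e2, ← inner_neg_left]
  exact ⟨fun h e => by rw [h], fun h => ext_inner_right ℝ h⟩

theorem IsTest.smul_test_integrable {f : Z n → ℝ} (hf : LocallyIntegrable f volume) {φ : Z n → ℝ}
    (hφ : IsTest φ) : Integrable (fun z => f z * φ z) volume :=
  hf.integrable_smul_right_of_hasCompactSupport hφ.continuous hφ.2

/-- Product rule: a weakly differentiable function times a test function. -/
theorem WeakGrad.mul_test {f : Z n → ℝ} {g : Z n → E n} (h : WeakGrad f g) (hf : LocL2 f)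
    (hg : LocL2 g) {ω : Z n → ℝ} (hω : IsTest ω) :
    CPair (fun z => f z * ω z) (fun z => ω z • g z + f z • spaceGrad ω z) := by
  obtain ⟨r, hr, hs⟩ := hω.exists_radius
  have l1 : LocL2 (fun z => f z * ω z) := by
    simpa [mul_comm] using hf.smul_continuous hω.continuous
  have l2 : LocL2 (fun z => ω z • g z + f z • spaceGrad ω z) :=
    (hg.smul_continuous hω.continuous).add (hf.smul_continuous_right hω.continuous_spaceGrad)
  have s1 : ∀ z, z ∉ Metric.closedBall (0 : Z n) r → f z * ω z = 0 ∧
      ω z • g z + f z • spaceGrad ω z = 0 := fun z hz => by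
    simp [(hs z hz).1, (hs z hz).2.1]
  refine ⟨l1.memLp_of_supp fun z hz => (s1 z hz).1, l2.memLp_of_supp fun z hz => (s1 z hz).2,
    ⟨r, s1⟩, fun φ hφ => ?_⟩
  -- Testing with `ω * φ` and expanding its gradient by the Leibniz rule isolates the term that
  -- contains the gradient of `φ`.
  have hp := h _ (hω.mul hφ)
  have e : ∀ z, (f z * ω z) • spaceGrad φ z = f z • spaceGrad (fun z => ω z * φ z) z -
      φ z • (f z • spaceGrad ω z) := by
    intro z
    rw [IsTest.spaceGrad_mul_apply (hω.differentiable z) (hφ.differentiable z), smul_add, smul_smul,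
      smul_smul, smul_smul, mul_comm (φ z)]
    abel
  have i1 : Integrable (fun z => f z • spaceGrad (fun z => ω z * φ z) z) volume :=
    hf.locallyIntegrable.integrable_smul_right_of_hasCompactSupport (hω.mul hφ).continuous_spaceGrad
      (hω.mul hφ).hasCompactSupport_spaceGrad
  have i2 : Integrable (fun z => φ z • (f z • spaceGrad ω z)) volume :=
    (hf.smul_continuous_right hω.continuous_spaceGrad).locallyIntegrable.integrable_smul_left_of_hasCompactSupport
      hφ.continuous hφ.2
  have i3 : Integrable (fun z => (ω z * φ z) • g z) volume :=
    hg.locallyIntegrable.integrable_smul_left_of_hasCompactSupport (hω.mul hφ).continuous (hω.mul hφ).2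
  simp_rw [e]
  rw [integral_sub i1 i2, hp]
  have e2 : ∀ z, φ z • (ω z • g z + f z • spaceGrad ω z) =
      (ω z * φ z) • g z + φ z • (f z • spaceGrad ω z) := by
    intro z; rw [smul_add, smul_smul, mul_comm (φ z)]
  simp_rw [e2]
  rw [integral_add i3 i2]; abel

/-- Stability of weak gradients under dominated almost everywhere convergence. -/
theorem WeakGrad.of_tendsto {f : ℕ → Z n → ℝ} {g : ℕ → Z n → E n} {f₀ : Z n → ℝ} {g₀ : Z n → E n}
    (h : ∀ j, WeakGrad (f j) (g j)) (hfm : ∀ j, AEStronglyMeasurable (f j) volume)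
    (hgm : ∀ j, AEStronglyMeasurable (g j) volume)
    {D D' : Z n → ℝ} (hD : LocallyIntegrable D volume) (hD' : LocallyIntegrable D' volume)
    (hb : ∀ j, ∀ᵐ z, |f j z| ≤ D z) (hb' : ∀ j, ∀ᵐ z, ‖g j z‖ ≤ D' z)
    (hf : ∀ᵐ z, Tendsto (fun j => f j z) atTop (𝓝 (f₀ z)))
    (hg : ∀ᵐ z, Tendsto (fun j => g j z) atTop (𝓝 (g₀ z))) : WeakGrad f₀ g₀ := by
  intro φ hφ
  have t1 : Tendsto (fun j => ∫ z, f j z • spaceGrad φ z) atTop (𝓝 (∫ z, f₀ z • spaceGrad φ z)) := by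
    refine tendsto_integral_of_dominated_convergence (fun z => ‖D z • spaceGrad φ z‖)
      (fun j => (hfm j).smul hφ.continuous_spaceGrad.aestronglyMeasurable) ?_ ?_ ?_
    · exact (hD.integrable_smul_right_of_hasCompactSupport hφ.continuous_spaceGrad
        hφ.hasCompactSupport_spaceGrad).norm
    · intro j
      filter_upwards [hb j] with z hz
      rw [norm_smul, norm_smul]
      exact mul_le_mul_of_nonneg_right (hz.trans (le_abs_self _)) (norm_nonneg _)
    · filter_upwards [hf] with z hz using hz.smul_const _
  have t2 : Tendsto (fun j => ∫ z, φ z • g j z) atTop (𝓝 (∫ z, φ z • g₀ z)) := by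
    refine tendsto_integral_of_dominated_convergence (fun z => ‖φ z • D' z‖)
      (fun j => hφ.continuous.aestronglyMeasurable.smul (hgm j)) ?_ ?_ ?_
    · exact (hD'.integrable_smul_left_of_hasCompactSupport hφ.continuous hφ.2).norm
    · intro j
      filter_upwards [hb' j] with z hz
      rw [norm_smul, norm_smul]
      exact mul_le_mul_of_nonneg_left (hz.trans (le_abs_self _)) (norm_nonneg _)
    · filter_upwards [hg] with z hz using hz.const_smul _
  refine tendsto_nhds_unique (t1.congr fun j => ?_) t2.neg
  exact h j φ hφ

/-- Chain rule for weak gradients. -/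
theorem WeakGrad.comp {W : Z n → ℝ} {G : Z n → E n} (h : WeakGrad W G) (hWm : AEStronglyMeasurable W volume)
    (hW : LocBdd W) (hG : LocL2 G) {F F' : ℝ → ℝ} (hF : ∀ s, HasDerivAt F (F' s) s) (hF' : Continuous F') :
    WeakGrad (fun z => F (W z)) (fun z => F' (W z) • G z) := by
  have hFc : Continuous F := continuous_iff_continuousAt.2 fun s => (hF s).continuousAt
  have comp_bdd : ∀ H : ℝ → ℝ, Continuous H → LocBdd (fun z => H (W z)) := by
    intro H hH r
    obtain ⟨B, hB⟩ := hW r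
    obtain ⟨C, hC⟩ := (isCompact_Icc (a := -B) (b := B)).exists_bound_of_continuousOn hH.continuousOn
    exact ⟨C, hB.mono fun z hz hzr => hC _ (abs_le.1 (hz hzr))⟩
  have lF : LocL2 (fun z => F (W z)) := (comp_bdd F hFc).locL2 (hFc.comp_aestronglyMeasurable hWm)
  have lG : LocL2 (fun z => F' (W z) • G z) := hG.smul_bdd (hF'.comp_aestronglyMeasurable hWm) (comp_bdd F' hF')
  rw [weakGrad_iff lF.locallyIntegrable lG.locallyIntegrable]
  intro φ hφ e
  obtain ⟨r, hr, hs⟩ := hφ.exists_radius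
  -- The identity only involves values on the support of `φ`, where `χ = 1`. So `W` may be replaced
  -- by `W * χ`, which is square integrable on the whole space and can be mollified.
  obtain ⟨χ, hχ, hχ0, hχ1, hχb⟩ := exists_cutoff n r
  have hW2 := hW.locL2 hWm
  set ψ : Z n → ℝ := fun z => W z * χ z with hψ
  set P : Z n → E n := fun z => χ z • G z + W z • spaceGrad χ z with hP
  have hc : CPair ψ P := h.mul_test hW2 hG hχ
  obtain ⟨B, hB⟩ : ∃ B, ∀ᵐ z, |ψ z| ≤ B := by
    obtain ⟨r', hr'⟩ := hc.supp
    obtain ⟨B, hB⟩ := hW r'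
    refine ⟨max B 0, hB.mono fun z hz => ?_⟩
    by_cases hzr : z ∈ Metric.closedBall (0 : Z n) r'
    · simp only [hψ, abs_mul, abs_of_nonneg (hχ0 z)]
      exact (mul_le_of_le_one_right (abs_nonneg _) (hχ1 z)).trans ((hz hzr).trans (le_max_left _ _))
    · rw [(hr' z hzr).1]; simp
  obtain ⟨hT, hgr, -⟩ := hc.moll
  obtain ⟨C, hC⟩ := (isCompact_Icc (a := -B) (b := B)).exists_bound_of_continuousOn hFc.continuousOn
  obtain ⟨C', hC'⟩ := (isCompact_Icc (a := -B) (b := B)).exists_bound_of_continuousOn hF'.continuousOn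
  -- Mollification does not enlarge the range, so bounds for `F` and `F'` on `[-B, B]` serve all `j`
  -- at once.
  have hjB : ∀ j z, AggDiff.moll j ψ z ∈ Icc (-B) B := fun j z => abs_le.1 (abs_moll_le j hB z)
  have hae : ∀ᵐ z, Tendsto (fun j => AggDiff.moll j ψ z) atTop (𝓝 (ψ z)) := by
    -- The outer and inner radii keep the ratio `2`; a bounded ratio is what the Lebesgue
    -- differentiation theorem asks for.
    refine ContDiffBump.ae_convolution_tendsto_right_of_locallyIntegrable (K := 2) tendsto_bump_rOut
      (Eventually.of_forall fun j => ?_) (hc.memLp.locallyIntegrable (by norm_num))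
    simp only [bump]
    have : (0:ℝ) < (j:ℝ) + 1 := by positivity
    apply le_of_eq; field_simp
  -- the identity for the mollified functions
  have hid : ∀ j, ∫ z, F (moll j ψ z) * inner ℝ (spaceGrad φ z) e =
      - ∫ z, φ z * (F' (moll j ψ z) * inner ℝ (moll j P z) e) := by
    intro j
    have hd : ∀ z, HasFDerivAt (fun z => F (moll j ψ z)) (F' (moll j ψ z) • fderiv ℝ (moll j ψ) z) z :=
      fun z => (hF _).comp_hasFDerivAt z ((hT j).differentiable z).hasFDerivAt
    have hcm : Continuous (moll j ψ) := (hT j).continuous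
    have e1 : ∀ z, inner ℝ (spaceGrad φ z) e = fderiv ℝ φ z (0, e) := fun z => by
      rw [hφ.spaceGrad_eq, inner_gradL]
    have e2 : ∀ z, F' (moll j ψ z) * inner ℝ (moll j P z) e = fderiv ℝ (fun z => F (moll j ψ z)) z (0, e) := by
      intro z
      rw [← hgr j, (hT j).spaceGrad_eq, inner_gradL, (hd z).fderiv]; simp
    have hFc' : Continuous fun z => fderiv ℝ (fun z => F (moll j ψ z)) z (0, e) := by
      simp_rw [← e2]
      rw [← hgr j]
      exact (hF'.comp hcm).mul ((hT j).continuous_spaceGrad.inner continuous_const)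
    simp_rw [e1, e2]
    rw [integral_mul_fderiv_eq_neg_fderiv_mul_of_integrable]
    · simp_rw [mul_comm]
    · exact (hFc'.mul hφ.continuous).integrable_of_hasCompactSupport hφ.2.mul_left
    · refine Continuous.integrable_of_hasCompactSupport
        ((hFc.comp hcm).mul (hφ.continuous_fderiv.clm_apply continuous_const)) ?_
      exact HasCompactSupport.mul_left ((hφ.2.fderiv (𝕜 := ℝ)).comp_left (g := fun L : Z n →L[ℝ] ℝ => L (0, e)) rfl)
    · exact ((hFc.comp hcm).mul hφ.continuous).integrable_of_hasCompactSupport hφ.2.mul_left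
    · exact fun x _ => (hd x).differentiableAt
    · exact fun x _ => hφ.differentiable x
  have t1 : Tendsto (fun j => ∫ z, F (moll j ψ z) * inner ℝ (spaceGrad φ z) e) atTop
      (𝓝 (∫ z, F (ψ z) * inner ℝ (spaceGrad φ z) e)) := by
    refine tendsto_integral_of_dominated_convergence (fun z => C * ‖inner ℝ (spaceGrad φ z) e‖)
      (fun j => ?_) ?_ ?_ ?_
    · exact ((hFc.comp (hT j).continuous).mul (hφ.continuous_spaceGrad.inner continuous_const)).aestronglyMeasurable
    · exact ((memLp_one_iff_integrable.1 (hφ.memLp_spaceGrad 1)).inner_const e).norm.const_mul C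
    · intro j
      refine ae_of_all _ fun z => ?_
      rw [norm_mul]
      exact mul_le_mul_of_nonneg_right (hC _ (hjB j z)) (norm_nonneg _)
    · filter_upwards [hae] with z hz using ((hFc.tendsto _).comp hz).mul_const _
  -- In the product of `F'` and the gradient both factors vary with `j`. It is split into a part
  -- with the gradient frozen at its limit, handled by dominated convergence, and a part with the
  -- gradient error, which tends to zero by Cauchy–Schwarz (`t3`).
  have t2 : Tendsto (fun j => ∫ z, φ z * (F' (moll j ψ z) * inner ℝ (P z) e)) atTop
      (𝓝 (∫ z, φ z * (F' (ψ z) * inner ℝ (P z) e))) := by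
    refine tendsto_integral_of_dominated_convergence (fun z => C' * ‖φ z * inner ℝ (P z) e‖)
      (fun j => ?_) ?_ ?_ ?_
    · exact hφ.continuous.aestronglyMeasurable.mul
        ((hF'.comp (hT j).continuous).aestronglyMeasurable.mul (hc.memLp_grad.1.inner aestronglyMeasurable_const))
    · refine Integrable.const_mul (Integrable.norm ?_) C'
      exact (hφ.memLp 2).integrable_mul (hc.memLp_grad.inner_const e)
    · intro j
      refine ae_of_all _ fun z => ?_
      have := hC' _ (hjB j z)
      rw [norm_mul, norm_mul, norm_mul]
      calc ‖φ z‖ * (‖F' (moll j ψ z)‖ * ‖inner ℝ (P z) e‖)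
          = ‖F' (moll j ψ z)‖ * (‖φ z‖ * ‖inner ℝ (P z) e‖) := by ring
        _ ≤ _ := by gcongr
    · filter_upwards [hae] with z hz
      exact (((hF'.tendsto _).comp hz).mul_const _).const_mul _
  have hmP : ∀ j, MemLp (moll j P) 2 volume := fun j => by
    rw [← hgr j]; exact (hT j).memLp_spaceGrad 2
  have t3 : Tendsto (fun j => ∫ z, φ z * (F' (moll j ψ z) * inner ℝ (moll j P z - P z) e)) atTop (𝓝 0) := by
    refine tendsto_integral_zero_of_le_mul (((hφ.memLp 2).norm.const_mul (C' * ‖e‖)))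
      (fun j => (hmP j).sub hc.memLp_grad) (tendsto_moll hc.memLp_grad) (fun j => ae_of_all _ fun z => ?_)
    have h1 := hC' _ (hjB j z)
    have h2 := abs_real_inner_le_norm (moll j P z - P z) e
    rw [abs_mul, abs_mul, ← Real.norm_eq_abs, ← Real.norm_eq_abs (F' _)]
    calc ‖φ z‖ * (‖F' (moll j ψ z)‖ * |inner ℝ (moll j P z - P z) e|)
          ≤ ‖φ z‖ * (C' * (‖moll j P z - P z‖ * ‖e‖)) := by
            have : 0 ≤ C' := (norm_nonneg _).trans h1
            gcongr
      _ = _ := by simp only [Pi.sub_apply]; ring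
  have hint : ∀ j, ∀ Q : Z n → E n, MemLp Q 2 volume →
      Integrable (fun z => φ z * (F' (moll j ψ z) * inner ℝ (Q z) e)) volume := by
    intro j Q hQ
    refine (hφ.memLp 2).integrable_mul (MemLp.of_le_mul (g := fun z => inner ℝ (Q z) e) (c := C') (hQ.inner_const e)
      ((hF'.comp (hT j).continuous).aestronglyMeasurable.mul (hQ.1.inner aestronglyMeasurable_const)) (ae_of_all _ fun z => ?_))
    rw [norm_mul]
    exact mul_le_mul_of_nonneg_right (hC' _ (hjB j z)) (norm_nonneg _)
  have t4 : Tendsto (fun j => ∫ z, φ z * (F' (moll j ψ z) * inner ℝ (moll j P z) e)) atTop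
      (𝓝 (∫ z, φ z * (F' (ψ z) * inner ℝ (P z) e))) := by
    have := t3.add t2
    rw [zero_add] at this
    refine this.congr fun j => ?_
    have ha := integral_add (hint j _ ((hmP j).sub hc.memLp_grad)) (hint j _ hc.memLp_grad)
    simp only [Pi.sub_apply] at ha
    rw [← ha]
    refine integral_congr_ae (ae_of_all _ fun z => ?_)
    simp only [inner_sub_left]; ring
  have hfin := tendsto_nhds_unique (t1.congr hid) t4.neg
  have r1 : ∫ z, F (W z) * inner ℝ (spaceGrad φ z) e = ∫ z, F (ψ z) * inner ℝ (spaceGrad φ z) e := by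
    refine integral_congr_ae (ae_of_all _ fun z => ?_)
    by_cases hz : z ∈ Metric.closedBall (0 : Z n) r
    · simp [hψ, (hχb z hz).1]
    · simp [(hs z hz).2.1]
  have r2 : ∫ z, φ z * inner ℝ (F' (W z) • G z) e = ∫ z, φ z * (F' (ψ z) * inner ℝ (P z) e) := by
    refine integral_congr_ae (ae_of_all _ fun z => ?_)
    by_cases hz : z ∈ Metric.closedBall (0 : Z n) r
    · simp [hψ, hP, (hχb z hz).1, (hχb z hz).2, inner_smul_left]
    · simp [(hs z hz).1]
  rw [r1, r2, hfin]

/-- Chain rule for a primitive with a single jump in its derivative. -/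
theorem WeakGrad.comp_truncated {W : Z n → ℝ} {G : Z n → E n} (h : WeakGrad W G)
    (hWm : AEStronglyMeasurable W volume)
    (hW : LocBdd W) (hG : LocL2 G) {c : ℝ → ℝ} (hc : Continuous c) (κ : ℝ) :
    WeakGrad (fun z => ∫ s in κ..max (W z) κ, c s) (fun z => (if κ < W z then c (W z) else 0) • G z) := by
  -- The jump at `κ` is replaced by a ramp of slope `j` that vanishes on `s ≤ κ`. The continuous
  -- chain rule applies to each primitive, and `|c|` dominates all of them.
  let a : ℕ → ℝ → ℝ := fun j s => min 1 (j * max (s - κ) 0) * c s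
  have ha : ∀ j, Continuous (a j) := fun j => by fun_prop
  have hab : ∀ j s, |a j s| ≤ |c s| := by
    intro j s
    have h0 : 0 ≤ min 1 (j * max (s - κ) 0) := le_min zero_le_one (by positivity)
    simp only [a, abs_mul, abs_of_nonneg h0]
    exact mul_le_of_le_one_left (abs_nonneg _) (min_le_left _ _)
  have hat : ∀ s, Tendsto (fun j => a j s) atTop (𝓝 (if κ < s then c s else 0)) := by
    intro s
    split_ifs with hs
    · have hev : ∀ᶠ j : ℕ in atTop, a j s = c s := by
        obtain ⟨N, hN⟩ := exists_nat_ge (1 / (s - κ))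
        filter_upwards [eventually_ge_atTop N] with j hj
        have hpos : 0 < s - κ := sub_pos.2 hs
        have : 1 ≤ j * max (s - κ) 0 := by
          rw [max_eq_left hpos.le]
          rw [div_le_iff₀ hpos] at hN
          refine hN.trans (mul_le_mul_of_nonneg_right (by exact_mod_cast hj) hpos.le)
        simp [a, min_eq_left this]
      exact tendsto_const_nhds.congr' (hev.mono fun j hj => hj.symm)
    · have : ∀ j, a j s = 0 := fun j => by
        simp [a, max_eq_right (sub_nonpos.2 (not_lt.1 hs))]
      simp [this]
  have hat0 : ∀ j s, s ≤ κ → a j s = 0 := fun j s hs => by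
    simp [a, max_eq_right (sub_nonpos.2 hs)]
  have hd : ∀ j s, HasDerivAt (fun s => ∫ r in κ..s, a j r) (a j s) s := fun j s =>
    intervalIntegral.integral_hasDerivAt_right ((ha j).intervalIntegrable _ _)
      (ha j).stronglyMeasurable.stronglyMeasurableAtFilter (ha j).continuousAt
  have hcomp := fun j => h.comp hWm hW hG (hd j) (ha j)
  -- the dominating primitive
  let A : ℝ → ℝ := fun s => ∫ r in κ..max s κ, |c r|
  have hAc : Continuous A := by
    have : Continuous fun s => ∫ r in κ..s, |c r| :=
      intervalIntegral.continuous_primitive (fun a b => hc.abs.intervalIntegrable a b) κ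
    exact this.comp (continuous_id.max continuous_const)
  have comp_bdd : ∀ H : ℝ → ℝ, Continuous H → LocBdd (fun z => H (W z)) := by
    intro H hH r
    obtain ⟨B, hB⟩ := hW r
    obtain ⟨C, hC⟩ := (isCompact_Icc (a := -B) (b := B)).exists_bound_of_continuousOn hH.continuousOn
    exact ⟨C, hB.mono fun z hz hzr => hC _ (abs_le.1 (hz hzr))⟩
  -- For `s ≤ κ` the integrand vanishes identically, so truncating the upper limit changes nothing.
  have hmax : ∀ j s, ∫ r in κ..s, a j r = ∫ r in κ..max s κ, a j r := by
    intro j s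
    rcases le_total κ s with hs | hs
    · rw [max_eq_left hs]
    · rw [max_eq_right hs, intervalIntegral.integral_same]
      refine (intervalIntegral.integral_congr (g := fun _ => 0) fun r hr => ?_).trans (by simp)
      rw [uIcc_of_ge hs] at hr
      exact hat0 j r hr.2
  refine WeakGrad.of_tendsto hcomp (fun j => ?_) (fun j => ?_) (D := fun z => A (W z))
    (D' := fun z => |c (W z)| * ‖G z‖)
    ((comp_bdd A hAc).locL2 (hAc.comp_aestronglyMeasurable hWm)).locallyIntegrable ?_ ?_ ?_ ?_ ?_
  · exact (continuous_iff_continuousAt.2 fun s => (hd j s).continuousAt).comp_aestronglyMeasurable hWm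
  · exact ((ha j).comp_aestronglyMeasurable hWm).smul hG.aestronglyMeasurable
  · have : LocL2 (fun z => |c (W z)| • G z) := hG.smul_bdd (hc.abs.comp_aestronglyMeasurable hWm) (by
      intro r; obtain ⟨B, hB⟩ := comp_bdd _ hc.abs r; exact ⟨B, hB⟩)
    have h2 : LocallyIntegrable (fun z => ‖|c (W z)| • G z‖) volume := fun x => (this.locallyIntegrable x).norm
    simpa [norm_smul] using h2
  · intro j
    refine ae_of_all _ fun z => ?_
    rw [hmax]
    refine (intervalIntegral.abs_integral_le_integral_abs (le_max_right _ _)).trans ?_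
    exact intervalIntegral.integral_mono_on (le_max_right _ _) ((ha j).abs.intervalIntegrable _ _)
      (hc.abs.intervalIntegrable _ _) fun r _ => hab j r
  · intro j
    refine ae_of_all _ fun z => ?_
    rw [norm_smul]
    exact mul_le_mul_of_nonneg_right (hab j _) (norm_nonneg _)
  · refine ae_of_all _ fun z => ?_
    refine Tendsto.congr (fun j => (hmax j _).symm) ?_
    refine intervalIntegral.tendsto_integral_filter_of_dominated_convergence (fun r => |c r|)
      (Eventually.of_forall fun j => (ha j).aestronglyMeasurable)
      (Eventually.of_forall fun j => ae_of_all _ fun r _ => hab j r)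
      (hc.abs.intervalIntegrable _ _) (ae_of_all _ fun r hr => ?_)
    rw [uIoc_of_le (le_max_right _ _)] at hr
    simpa [hr.1] using hat r
  · exact ae_of_all _ fun z => (hat _).smul_const _

/-! ### The evolution equation and the energy inequality -/

/-- Time translation of space-time. -/
theorem measurePreserving_add_time (s : ℝ) :
    MeasurePreserving (fun z : Z n => z + (s, 0)) volume volume :=
  measurePreserving_add_right volume ((s, 0) : Z n)

theorem norm_time (s : ℝ) : ‖((s, 0) : Z n)‖ = |s| := by simp [Prod.norm_def]

theorem tendsto_eLpNorm_time {V : Type*} [NormedAddCommGroup V] [NormedSpace ℝ V] [CompleteSpace V]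
    {P : Z n → V} (hP : MemLp P 2 volume)
    {σ : ℕ → ℝ} {s : ℝ} (hσ : Tendsto σ atTop (𝓝 s)) :
    Tendsto (fun k => eLpNorm (fun z => P (z + (σ k, 0)) - P (z + (s, 0))) 2 volume) atTop (𝓝 0) := by
  have h1 : Tendsto (fun k => ((s - σ k, 0) : Z n)) atTop (𝓝 0) := by
    have : Tendsto (fun k => ((s - σ k, 0) : Z n)) atTop (𝓝 (s - s, 0)) :=
      (tendsto_const_nhds.sub hσ).prodMk_nhds tendsto_const_nhds
    rwa [sub_self, Prod.mk_zero_zero] at this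
  refine ((tendsto_eLpNorm_translate hP).comp h1).congr fun k => ?_
  have hm : AEStronglyMeasurable (fun z => P (z - ((s - σ k, 0) : Z n)) - P z) volume :=
    (hP.1.comp_measurePreserving (measurePreserving_sub_right volume ((s - σ k, 0) : Z n))).sub hP.1
  have := eLpNorm_comp_measurePreserving (p := 2) hm (measurePreserving_add_time (n := n) s)
  simp only [Function.comp_def]
  rw [← this]
  congr 1
  ext z
  simp only [Function.comp]
  congr 2
  ext1
  · simp; ring
  · simp

/-- Continuity of translations in `L²`. Continuity at `s = 0` later makes the time averages of the
flux converge to its value. -/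
theorem continuous_integral_inner_time {F P : Z n → E n} (hF : MemLp F 2 volume) (hP : MemLp P 2 volume) :
    Continuous (fun s : ℝ => ∫ z, inner ℝ (F z) (P (z + (s, 0)))) := by
  refine continuous_iff_seqContinuous.2 fun σ s hσ => ?_
  exact tendsto_integral_inner hF (fun k => hP.comp_measurePreserving (measurePreserving_add_time (σ k)))
    (hP.comp_measurePreserving (measurePreserving_add_time s)) (tendsto_eLpNorm_time hP hσ)

/-- The evolution equation `∂ₜ u = div J` on all of space-time, in the sense of distributions. -/
def WeakEvolution (u : Z n → ℝ) (J : Z n → E n) : Prop :=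
  ∀ φ : Z n → ℝ, IsTest φ → ∫ z, (u z * timeDeriv φ z - inner ℝ (J z) (spaceGrad φ z)) = 0

theorem IsTest.comp_add_time {φ : Z n → ℝ} (h : IsTest φ) (s : ℝ) : IsTest (fun z => φ (z + (s, 0))) := by
  simpa only [sub_neg_eq_add] using h.comp_sub (-((s, 0) : Z n))

theorem IsTest.spaceGrad_comp_add_time {φ : Z n → ℝ} (h : IsTest φ) (s : ℝ) (z : Z n) :
    spaceGrad (fun z => φ (z + (s, 0))) z = spaceGrad φ (z + (s, 0)) := by
  simpa only [sub_neg_eq_add] using h.spaceGrad_comp_sub (-((s, 0) : Z n)) z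

theorem IsTest.timeDeriv_comp_add_time {φ : Z n → ℝ} (h : IsTest φ) (s : ℝ) (z : Z n) :
    timeDeriv (fun z => φ (z + (s, 0))) z = timeDeriv φ (z + (s, 0)) := by
  simpa only [sub_neg_eq_add] using h.timeDeriv_comp_sub (-((s, 0) : Z n)) z

theorem LocL2.memLp_indicator {V : Type*} [NormedAddCommGroup V] {f : Z n → V} (h : LocL2 f) (r : ℝ) :
    MemLp ((Metric.closedBall (0 : Z n) r).indicator f) 2 volume := by
  rw [memLp_indicator_iff_restrict Metric.isClosed_closedBall.measurableSet]
  exact h r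

/-- A shift in time by `s` moves the support of `P` by at most `|s|`, so the merely locally square
integrable `J` may be cut off at radius `R` once and for all admissible shifts. -/
theorem inner_indicator_eq {J P : Z n → E n} {r R : ℝ} (hP : ∀ z, z ∉ Metric.closedBall (0 : Z n) r → P z = 0)
    {s : ℝ} (hs : r + |s| ≤ R) (z : Z n) :
    inner ℝ ((Metric.closedBall (0 : Z n) R).indicator J z) (P (z + (s, 0))) =
      inner ℝ (J z) (P (z + (s, 0))) := by
  by_cases hz : z ∈ Metric.closedBall (0 : Z n) R
  · rw [indicator_of_mem hz]
  · have : z + (s, 0) ∉ Metric.closedBall (0 : Z n) r := by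
      intro h'
      apply hz
      rw [mem_closedBall_zero_iff] at h' ⊢
      have := norm_sub_le (z + (s, 0)) ((s, 0) : Z n)
      rw [add_sub_cancel_right, norm_time] at this
      linarith
    rw [hP _ this]; simp

theorem hasDerivAt_time {φ : Z n → ℝ} (h : IsTest φ) (z : Z n) (s : ℝ) :
    HasDerivAt (fun s => φ (z + (s, 0))) (timeDeriv φ (z + (s, 0))) s := by
  have h1 : HasDerivAt (fun s : ℝ => z + ((s, 0) : Z n)) ((1, 0) : Z n) s :=
    ((hasDerivAt_id s).prodMk (hasDerivAt_const s (0 : E n))).const_add z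
  have := (h.differentiable (z + (s, 0))).hasFDerivAt.comp_hasDerivAt s h1
  rwa [h.timeDeriv_eq]

section evolution
variable {u : Z n → ℝ} {J : Z n → E n}

theorem WeakEvolution.slice (h : WeakEvolution u J) (hu : LocallyIntegrable u volume)
    (hJ : LocL2 J) {φ : Z n → ℝ} (hφ : IsTest φ) :
    ∫ z, u z * timeDeriv φ z = ∫ z, inner ℝ (J z) (spaceGrad φ z) := by
  have i1 : Integrable (fun z => u z * timeDeriv φ z) volume :=
    hu.integrable_smul_right_of_hasCompactSupport hφ.continuous_timeDeriv hφ.hasCompactSupport_timeDeriv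
  have i2 : Integrable (fun z => inner ℝ (J z) (spaceGrad φ z)) volume := by
    obtain ⟨r, hr, hs⟩ := hφ.exists_radius
    have := integrable_inner_of_memLp (hJ.memLp_indicator r) (hφ.memLp_spaceGrad 2)
    refine this.congr (ae_of_all _ fun z => ?_)
    have e := inner_indicator_eq (J := J) (P := spaceGrad φ) (r := r) (R := r) (s := 0)
      (fun z hz => (hs z hz).2.1) (by simp) z
    simpa [Prod.mk_zero_zero] using e
  have := h φ hφ
  rw [integral_sub i1 i2] at this
  linarith

/-- The equation integrated over a time step, for smooth test functions. -/
theorem WeakEvolution.increment_test (h : WeakEvolution u J) (hu : LocallyIntegrable u volume)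
    (hJ : LocL2 J) {ψ : Z n → ℝ} (hψ : IsTest ψ) {δ : ℝ} (hδ : 0 ≤ δ) :
    ∫ z, (u z - u (z - (δ, 0))) * ψ z = - ∫ s in 0..δ, ∫ z, inner ℝ (J z) (spaceGrad ψ (z + (s, 0))) := by
  -- The equation is tested with each time shift of `ψ`. Integrated over the shift, the time
  -- derivatives telescope to `ψ (z + (δ, 0)) - ψ z`.
  have e1 : ∀ s, ∫ z, inner ℝ (J z) (spaceGrad ψ (z + (s, 0))) = ∫ z, u z * timeDeriv ψ (z + (s, 0)) := by
    intro s
    have := h.slice hu hJ (hψ.comp_add_time s)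
    simp_rw [hψ.spaceGrad_comp_add_time, hψ.timeDeriv_comp_add_time] at this
    exact this.symm
  simp_rw [e1]
  obtain ⟨r, hr, hs⟩ := hψ.exists_radius
  obtain ⟨C, hC⟩ := hψ.hasCompactSupport_timeDeriv.exists_bound_of_continuous hψ.continuous_timeDeriv
  have hC0 : 0 ≤ C := (norm_nonneg _).trans (hC 0)
  have hiu : IntegrableOn u (Metric.closedBall (0 : Z n) (r + δ)) volume :=
    hu.integrableOn_isCompact (isCompact_closedBall _ _)
  have hcomp : Continuous (fun p : ℝ × Z n => timeDeriv ψ (p.2 + (p.1, 0))) :=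
    hψ.continuous_timeDeriv.comp (by fun_prop)
  have hint : Integrable (Function.uncurry fun (s : ℝ) (z : Z n) => u z * timeDeriv ψ (z + (s, 0)))
      ((volume.restrict (uIoc 0 δ)).prod volume) := by
    have hdom : Integrable (fun p : ℝ × Z n => C *
        (fun z => ‖(Metric.closedBall (0 : Z n) (r + δ)).indicator u z‖) p.2)
        ((volume.restrict (uIoc 0 δ)).prod volume) := by
      have : IsFiniteMeasure (volume.restrict (uIoc (0:ℝ) δ)) := ⟨by
        rw [Measure.restrict_apply_univ, uIoc_of_le hδ]; simp⟩
      exact (((integrable_indicator_iff Metric.isClosed_closedBall.measurableSet).2 hiu).norm.comp_snd _).const_mul C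
    refine hdom.mono' ?_ ?_
    · exact (hu.aestronglyMeasurable.comp_snd).mul hcomp.aestronglyMeasurable
    · have : ∀ᵐ p ∂((volume.restrict (uIoc (0:ℝ) δ)).prod (volume : Measure (Z n))), p.1 ∈ uIoc 0 δ :=
        Measure.quasiMeasurePreserving_fst.ae (ae_restrict_mem measurableSet_uIoc)
      filter_upwards [this] with p hp
      rw [uIoc_of_le hδ] at hp
      simp only [Function.uncurry, norm_mul]
      by_cases hz : p.2 ∈ Metric.closedBall (0 : Z n) (r + δ)
      · rw [indicator_of_mem hz, mul_comm]
        exact mul_le_mul_of_nonneg_right (hC _) (norm_nonneg _)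
      · have : p.2 + (p.1, 0) ∉ Metric.closedBall (0 : Z n) r := by
          intro h'
          apply hz
          rw [mem_closedBall_zero_iff] at h' ⊢
          have := norm_sub_le (p.2 + (p.1, 0)) ((p.1, 0) : Z n)
          rw [add_sub_cancel_right, norm_time, abs_of_pos hp.1] at this
          linarith [hp.2]
        rw [(hs _ this).2.2]
        simp only [norm_zero, mul_zero]
        positivity
  rw [MeasureTheory.intervalIntegral_integral_swap hint]
  have e2 : ∀ z, ∫ s in 0..δ, u z * timeDeriv ψ (z + (s, 0)) = u z * (ψ (z + (δ, 0)) - ψ z) := by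
    intro z
    rw [intervalIntegral.integral_const_mul, intervalIntegral.integral_eq_sub_of_hasDerivAt
      (fun s _ => hasDerivAt_time hψ z s)
      ((hψ.continuous_timeDeriv.comp (by fun_prop : Continuous fun s : ℝ => z + ((s, 0) : Z n))).intervalIntegrable _ _)]
    simp [Prod.mk_zero_zero]
  simp_rw [e2]
  have i1 : Integrable (fun z => u z * ψ z) volume := hψ.smul_test_integrable hu
  have i2 : Integrable (fun z => u z * ψ (z + (δ, 0))) volume := (hψ.comp_add_time δ).smul_test_integrable hu
  have e3 : ∀ z, (u (z - (δ, 0))) * ψ z = (fun z => u z * ψ (z + (δ, 0))) (z - (δ, 0)) := by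
    intro z; simp
  have i3 : Integrable (fun z => u (z - (δ, 0)) * ψ z) volume := by
    simp_rw [e3]
    exact i2.comp_sub_right _
  simp_rw [sub_mul, mul_sub]
  rw [integral_sub i1 i3, integral_sub i2 i1]
  simp_rw [e3]
  rw [integral_sub_right_eq_self (fun z => u z * ψ (z + (δ, 0))) ((δ, 0) : Z n)]
  ring

/-- The equation integrated over a time step. -/
theorem WeakEvolution.increment (h : WeakEvolution u J) (hum : AEStronglyMeasurable u volume) (hu : LocBdd u)
    (hJ : LocL2 J) {ψ : Z n → ℝ} {P : Z n → E n} (hψ : CPair ψ P) {δ : ℝ} (hδ : 0 ≤ δ) :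
    ∫ z, (u z - u (z - (δ, 0))) * ψ z = - ∫ s in 0..δ, ∫ z, inner ℝ (J z) (P (z + (s, 0))) := by
  -- Both sides are continuous under `L²` convergence of `ψ` and `P`, so the identity for smooth
  -- functions passes to the limit along the mollifications.
  obtain ⟨hT, hgr, r₁, hr₁⟩ := hψ.moll
  obtain ⟨r₂, hr₂⟩ := hψ.supp
  set r := max r₁ r₂ with hrdef
  have hball : ∀ r', r' ≤ r → ∀ z, z ∉ Metric.closedBall (0 : Z n) r → z ∉ Metric.closedBall (0 : Z n) r' :=
    fun r' hr' z hz hz' => hz (Metric.closedBall_subset_closedBall hr' hz')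
  have hsj : ∀ j z, z ∉ Metric.closedBall (0 : Z n) r → moll j ψ z = 0 ∧ moll j P z = 0 :=
    fun j z hz => hr₁ j z (hball _ (le_max_left _ _) z hz)
  have hs : ∀ z, z ∉ Metric.closedBall (0 : Z n) r → ψ z = 0 ∧ P z = 0 :=
    fun z hz => hr₂ z (hball _ (le_max_right _ _) z hz)
  have hul := (hu.locL2 hum)
  set JR := (Metric.closedBall (0 : Z n) (r + δ)).indicator J with hJR
  have hJR2 : MemLp JR 2 volume := hJ.memLp_indicator _
  have hmP : ∀ j, MemLp (moll j P) 2 volume := fun j => by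
    rw [← hgr j]; exact (hT j).memLp_spaceGrad 2
  -- right-hand side
  have hin : ∀ {Q : Z n → E n}, (∀ z, z ∉ Metric.closedBall (0 : Z n) r → Q z = 0) →
      ∫ s in 0..δ, ∫ z, inner ℝ (J z) (Q (z + (s, 0))) = ∫ s in 0..δ, ∫ z, inner ℝ (JR z) (Q (z + (s, 0))) := by
    intro Q hQ
    refine intervalIntegral.integral_congr fun s hs' => ?_
    rw [uIcc_of_le hδ] at hs'
    refine integral_congr_ae (ae_of_all _ fun z => ?_)
    exact (inner_indicator_eq hQ (by rw [abs_of_nonneg hs'.1]; linarith [hs'.2]) z).symm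
  have tR : Tendsto (fun j => ∫ s in 0..δ, ∫ z, inner ℝ (JR z) (moll j P (z + (s, 0)))) atTop
      (𝓝 (∫ s in 0..δ, ∫ z, inner ℝ (JR z) (P (z + (s, 0))))) := by
    obtain ⟨B, hB⟩ : ∃ B : ℝ, ∀ j s, ‖∫ z, inner ℝ (JR z) (moll j P (z + (s, 0)))‖ ≤ B := by
      -- The norms of a convergent sequence are bounded; this gives a constant that dominates the
      -- integrand in `s` uniformly in `j`.
      have hbd : ∃ A : ℝ≥0, ∀ j, eLpNorm (moll j P) 2 volume ≤ A := by
        have ht := (tendsto_moll hψ.memLp_grad)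
        have hfin : ∀ j, eLpNorm (fun z => moll j P z - P z) 2 volume ≠ ⊤ := fun j =>
          ((hmP j).sub hψ.memLp_grad).2.ne
        have ht' : Tendsto (fun j => (eLpNorm (fun z => moll j P z - P z) 2 volume).toReal) atTop (𝓝 0) := by
          simpa [Function.comp_def] using (ENNReal.tendsto_toReal (by simp : (0:ℝ≥0∞) ≠ ⊤)).comp ht
        obtain ⟨A, hA⟩ := ht'.bddAbove_range
        refine ⟨A.toNNReal + (eLpNorm P 2 volume).toNNReal, fun j => ?_⟩
        have e : moll j P = (fun z => moll j P z - P z) + P := by ext1 z; simp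
        rw [e]
        refine (eLpNorm_add_le ((hmP j).1.sub hψ.memLp_grad.1) hψ.memLp_grad.1 (by norm_num)).trans ?_
        push_cast
        rw [ENNReal.coe_toNNReal hψ.memLp_grad.2.ne]
        gcongr
        refine (ENNReal.ofReal_toReal (hfin j)).symm.le.trans ?_
        exact ENNReal.ofReal_le_ofReal (hA ⟨j, rfl⟩)
      obtain ⟨A, hA⟩ := hbd
      refine ⟨(eLpNorm JR 2 volume * A).toReal, fun j s => ?_⟩
      have hmp := (hmP j).comp_measurePreserving (measurePreserving_add_time (n := n) s)
      rw [← toReal_enorm]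
      refine ENNReal.toReal_mono (ENNReal.mul_ne_top hJR2.2.ne (by simp)) ?_
      refine (enorm_integral_le_lintegral_enorm _).trans ?_
      have := eLpNorm_le_eLpNorm_mul_eLpNorm_of_nnnorm (p := 2) (q := 2) (r := 1) hJR2.1 hmp.1
        (fun a b => inner ℝ a b) 1 (ae_of_all _ fun z => by simpa using nnnorm_inner_le_nnnorm (𝕜 := ℝ) (JR z) (moll j P (z + (s, 0))))
      rw [eLpNorm_one_eq_lintegral_enorm] at this
      refine this.trans ?_
      rw [ENNReal.coe_one, one_mul]
      gcongr
      rw [eLpNorm_comp_measurePreserving (hmP j).1 (measurePreserving_add_time s)]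
      exact hA j
    refine intervalIntegral.tendsto_integral_filter_of_dominated_convergence (fun _ => B)
      (Eventually.of_forall fun j => (continuous_integral_inner_time hJR2 (hmP j)).aestronglyMeasurable)
      (Eventually.of_forall fun j => ae_of_all _ fun s _ => hB j s) (by simp) (ae_of_all _ fun s _ => ?_)
    refine tendsto_integral_inner hJR2 (fun j => (hmP j).comp_measurePreserving (measurePreserving_add_time s))
      (hψ.memLp_grad.comp_measurePreserving (measurePreserving_add_time s)) ?_
    refine (tendsto_moll hψ.memLp_grad).congr fun j => ?_
    exact (eLpNorm_comp_measurePreserving ((hmP j).1.sub hψ.memLp_grad.1) (measurePreserving_add_time s)).symm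
  -- left-hand side
  have hd2 : LocL2 (fun z => u z - u (z - (δ, 0))) := by
    have h2 : LocL2 (fun z => u (z - (δ, 0))) := by
      intro ρ
      have hmp : MeasurePreserving (fun z : Z n => z - (δ, 0)) volume volume :=
        measurePreserving_sub_right volume ((δ, 0) : Z n)
      have := (hul.memLp_indicator (ρ + δ)).comp_measurePreserving hmp
      refine (this.restrict (Metric.closedBall 0 ρ)).ae_eq ?_
      filter_upwards [ae_restrict_mem Metric.isClosed_closedBall.measurableSet] with z hz
      have : z - (δ, 0) ∈ Metric.closedBall (0 : Z n) (ρ + δ) := by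
        rw [mem_closedBall_zero_iff] at hz ⊢
        have := norm_sub_le z ((δ, 0) : Z n)
        rw [norm_time, abs_of_nonneg hδ] at this
        linarith
      simp [Function.comp, indicator_of_mem this]
    exact fun r => (hul r).sub (h2 r)
  set d := (Metric.closedBall (0 : Z n) r).indicator (fun z => u z - u (z - (δ, 0))) with hd
  have hdm : MemLp d 2 volume := hd2.memLp_indicator r
  have hin2 : ∀ {q : Z n → ℝ}, (∀ z, z ∉ Metric.closedBall (0 : Z n) r → q z = 0) →
      ∫ z, inner ℝ (d z) (q z) = ∫ z, (u z - u (z - (δ, 0))) * q z := by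
    intro q hq
    refine integral_congr_ae (ae_of_all _ fun z => ?_)
    by_cases hz : z ∈ Metric.closedBall (0 : Z n) r
    · simp [hd, indicator_of_mem hz, mul_comm]
    · simp [hq z hz]
  have tL := tendsto_integral_inner hdm (fun j => (hT j).memLp 2) hψ.memLp (tendsto_moll hψ.memLp)
  rw [hin2 fun z hz => (hs z hz).1] at tL
  rw [hin fun z hz => (hs z hz).2]
  refine tendsto_nhds_unique tL (tR.neg.congr fun j => ?_)
  rw [hin2 fun z hz => (hsj j z hz).1, ← hin fun z hz => (hsj j z hz).2]
  have := h.increment_test hul.locallyIntegrable hJ (hT j) hδ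
  rw [this, hgr j]

/-- The tangent at `b` lies below the convex function `s ↦ (s - k)₊² / 2`, whose derivative is `(s -
k)₊`. This inequality replaces the chain rule for `(u - k)₊ ∂ₜu`, which has no meaning here. -/
theorem sq_pos_part_convex (a b k : ℝ) :
    (max (b - k) 0 ^ 2 - max (a - k) 0 ^ 2) / 2 ≤ (b - a) * max (b - k) 0 := by
  rcases le_total (b - k) 0 with hb | hb <;> rcases le_total (a - k) 0 with ha | ha <;>
    simp only [hb, ha, max_eq_left, max_eq_right] <;> nlinarith [sq_nonneg (b - a), sq_nonneg (b - k)]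

/-- Energy inequality for the truncation `f = (u - k)₊`. -/
theorem WeakEvolution.energy (h : WeakEvolution u J) (hum : AEStronglyMeasurable u volume) (hu : LocBdd u)
    (hJ : LocL2 J) {f : Z n → ℝ} {g : Z n → E n} (hfg : WeakGrad f g) (hfm : AEStronglyMeasurable f volume)
    (hf : LocBdd f) (hg : LocL2 g) {k T : ℝ} (hfu : ∀ᵐ z, z.1 < T → f z = max (u z - k) 0)
    {ω : Z n → ℝ} (hω : IsTest ω) (hω0 : ∀ z, 0 ≤ ω z) (hωT : ∀ z, T ≤ z.1 → ω z = 0) :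
    ∫ z, inner ℝ (J z) (ω z • g z + f z • spaceGrad ω z) ≤ ∫ z, f z ^ 2 / 2 * timeDeriv ω z := by
  have hf2 := hf.locL2 hfm
  have hc := hfg.mul_test hf2 hg hω
  set P : Z n → E n := fun z => ω z • g z + f z • spaceGrad ω z with hP
  obtain ⟨r, hr⟩ := hc.supp
  set JR := (Metric.closedBall (0 : Z n) (r + 1)).indicator J with hJR
  have hJR2 : MemLp JR 2 volume := hJ.memLp_indicator _
  have hcont := continuous_integral_inner_time hJR2 hc.memLp_grad
  set D : ℝ → ℝ := fun s => ∫ z, inner ℝ (JR z) (P (z + (s, 0))) with hD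
  have hDs : ∀ s, |s| ≤ 1 → ∫ z, inner ℝ (J z) (P (z + (s, 0))) = D s := by
    intro s hs
    refine integral_congr_ae (ae_of_all _ fun z => ?_)
    exact (inner_indicator_eq (fun z hz => (hr z hz).2) (by linarith) z).symm
  have hqm : LocallyIntegrable (fun z => f z ^ 2 / 2) volume := by
    have : LocBdd (fun z => f z ^ 2 / 2) := by
      intro r
      obtain ⟨B, hB⟩ := hf r
      refine ⟨B ^ 2 / 2, hB.mono fun z hz hzr => ?_⟩
      have := hz hzr
      rw [abs_of_nonneg (by positivity)]
      have := sq_le_sq' (abs_le.1 this).1 (abs_le.1 this).2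
      linarith
    exact (this.locL2 (by fun_prop)).locallyIntegrable
  -- inequality for a positive time step
  have hstep : ∀ δ, 0 ≤ δ → δ ≤ 1 → ∫ s in 0..δ, D s ≤ ∫ z, f z ^ 2 / 2 * (ω (z + (δ, 0)) - ω z) := by
    intro δ hδ hδ1
    have h1 := h.increment hum hu hJ hc hδ
    have h2 : ∫ s in 0..δ, ∫ z, inner ℝ (J z) (P (z + (s, 0))) = ∫ s in 0..δ, D s := by
      refine intervalIntegral.integral_congr fun s hs => ?_
      rw [uIcc_of_le hδ] at hs
      exact hDs s (by rw [abs_of_nonneg hs.1]; linarith [hs.2])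
    rw [h2] at h1
    have i1 : Integrable (fun z => f z ^ 2 / 2 * ω z) volume := hω.smul_test_integrable hqm
    have i2 : Integrable (fun z => f z ^ 2 / 2 * ω (z + (δ, 0))) volume := (hω.comp_add_time δ).smul_test_integrable hqm
    have e3 : ∀ z, f (z - (δ, 0)) ^ 2 / 2 * ω z = (fun z => f z ^ 2 / 2 * ω (z + (δ, 0))) (z - (δ, 0)) := by
      intro z; simp
    have i3 : Integrable (fun z => f (z - (δ, 0)) ^ 2 / 2 * ω z) volume := by
      simp_rw [e3]
      exact i2.comp_sub_right _
    have hae : ∀ᵐ z : Z n, (z - (δ, 0)).1 < T → f (z - (δ, 0)) = max (u (z - (δ, 0)) - k) 0 :=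
      (measurePreserving_sub_right volume ((δ, 0) : Z n)).quasiMeasurePreserving.ae hfu
    have hiu : Integrable (fun z => (u z - u (z - (δ, 0))) * (f z * ω z)) volume := by
      have hmp : MeasurePreserving (fun z : Z n => z - (δ, 0)) volume volume :=
        measurePreserving_sub_right volume ((δ, 0) : Z n)
      obtain ⟨B, hB⟩ := hu r
      obtain ⟨B', hB'⟩ := hu (r + 1)
      refine (memLp_one_iff_integrable.1 ?_)
      have hψ1 : MemLp (fun z => f z * ω z) 1 volume := by
        rw [memLp_one_iff_integrable]; exact hω.smul_test_integrable hf2.locallyIntegrable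
      refine hψ1.of_le_mul (c := B + B') ((hum.sub (hum.comp_measurePreserving hmp)).mul hψ1.1) ?_
      filter_upwards [hB, hmp.quasiMeasurePreserving.ae hB'] with z hz hz'
      rw [norm_mul]
      by_cases hzr : z ∈ Metric.closedBall (0 : Z n) r
      · refine mul_le_mul_of_nonneg_right ?_ (norm_nonneg _)
        have : z - (δ, 0) ∈ Metric.closedBall (0 : Z n) (r + 1) := by
          rw [mem_closedBall_zero_iff] at hzr ⊢
          have := norm_sub_le z ((δ, 0) : Z n)
          rw [norm_time, abs_of_nonneg hδ] at this
          linarith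
        exact (norm_sub_le _ _).trans (add_le_add (hz hzr) (hz' this))
      · simp [(hr z hzr).1]
    -- Convexity is applied between the times `z.1 - δ` and `z.1`. Where `z.1 < T`, both are below
    -- `T` and `f` is the truncation at both; elsewhere the weight vanishes.
    have hle : ∫ z, (f z ^ 2 / 2 * ω z - f (z - (δ, 0)) ^ 2 / 2 * ω z) ≤
        ∫ z, (u z - u (z - (δ, 0))) * (f z * ω z) := by
      refine integral_mono_ae (i1.sub i3) hiu ?_
      filter_upwards [hfu, hae] with z hz hz'
      by_cases hzT : z.1 < T
      · rw [hz hzT, hz' (by simp; linarith)]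
        have := mul_le_mul_of_nonneg_right (sq_pos_part_convex (u (z - (δ, 0))) (u z) k) (hω0 z)
        linarith
      · simp [hωT z (not_lt.1 hzT)]
    rw [integral_sub i1 i3] at hle
    simp_rw [e3] at hle
    rw [integral_sub_right_eq_self (fun z => f z ^ 2 / 2 * ω (z + (δ, 0))) ((δ, 0) : Z n), h1] at hle
    simp_rw [mul_sub]
    rw [integral_sub i2 i1]
    linarith
  -- pass to the limit
  let δ : ℕ → ℝ := fun j => 1 / ((j : ℝ) + 1)
  have hδ0 : ∀ j, 0 < δ j := fun j => by positivity
  have hδ1 : ∀ j, δ j ≤ 1 := fun j => by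
    simp only [δ]; rw [div_le_one (by positivity)]; linarith [Nat.cast_nonneg (α := ℝ) j]
  have hδt : Tendsto δ atTop (𝓝 0) := tendsto_one_div_add_atTop_nhds_zero_nat
  have hδt' : Tendsto δ atTop (𝓝[≠] 0) :=
    tendsto_nhdsWithin_iff.2 ⟨hδt, Eventually.of_forall fun j => (hδ0 j).ne'⟩
  -- Since `D` is continuous, its averages over `[0, δ]` converge to `D 0`.
  have tL : Tendsto (fun j => (δ j)⁻¹ * ∫ s in 0..δ j, D s) atTop (𝓝 (D 0)) := by
    have hd : HasDerivAt (fun t => ∫ s in 0..t, D s) (D 0) 0 :=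
      intervalIntegral.integral_hasDerivAt_right (hcont.intervalIntegrable _ _)
        hcont.stronglyMeasurable.stronglyMeasurableAtFilter hcont.continuousAt
    have := hd.tendsto_slope_zero.comp hδt'
    simpa [Function.comp_def] using this
  obtain ⟨C, hC⟩ := hω.hasCompactSupport_timeDeriv.exists_bound_of_continuous hω.continuous_timeDeriv
  have hC0 : 0 ≤ C := (norm_nonneg _).trans (hC 0)
  obtain ⟨ρ, hρ, hωs⟩ := hω.exists_radius
  -- The mean value inequality bounds the difference quotients of `ω` uniformly, as dominated
  -- convergence requires.
  have hlip : ∀ z δ, 0 ≤ δ → |ω (z + (δ, 0)) - ω z| ≤ C * δ := by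
    intro z δ hδ
    have := Convex.norm_image_sub_le_of_norm_hasDerivWithin_le (s := Icc 0 δ) (C := C)
      (f := fun s => ω (z + (s, 0))) (fun s _ => (hasDerivAt_time hω z s).hasDerivWithinAt) (fun s _ => hC _)
      (convex_Icc _ _) (left_mem_Icc.2 hδ) (right_mem_Icc.2 hδ)
    simpa [Prod.mk_zero_zero, abs_of_nonneg hδ] using this
  have tR : Tendsto (fun j => (δ j)⁻¹ * ∫ z, f z ^ 2 / 2 * (ω (z + (δ j, 0)) - ω z)) atTop
      (𝓝 (∫ z, f z ^ 2 / 2 * timeDeriv ω z)) := by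
    simp_rw [← integral_const_mul]
    refine tendsto_integral_of_dominated_convergence
      (fun z => C * ‖(Metric.closedBall (0 : Z n) (ρ + 1)).indicator (fun z => f z ^ 2 / 2) z‖) ?_ ?_ ?_ ?_
    · intro j
      have := hω.continuous
      exact AEStronglyMeasurable.const_mul (AEStronglyMeasurable.mul (by fun_prop)
        (Continuous.aestronglyMeasurable (by fun_prop))) _
    · exact ((integrable_indicator_iff Metric.isClosed_closedBall.measurableSet).2
        (hqm.integrableOn_isCompact (isCompact_closedBall _ _))).norm.const_mul C
    · intro j
      refine ae_of_all _ fun z => ?_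
      by_cases hz : z ∈ Metric.closedBall (0 : Z n) (ρ + 1)
      · rw [indicator_of_mem hz, norm_mul, norm_mul, Real.norm_eq_abs (ω _ - _), norm_inv, Real.norm_of_nonneg (hδ0 j).le]
        have := hlip z (δ j) (hδ0 j).le
        calc (δ j)⁻¹ * (‖f z ^ 2 / 2‖ * |ω (z + (δ j, 0)) - ω z|) ≤ (δ j)⁻¹ * (‖f z ^ 2 / 2‖ * (C * δ j)) := by
              have := (hδ0 j).le
              gcongr
          _ = _ := by have := (hδ0 j).ne'; field_simp
      · have h1 : z ∉ Metric.closedBall (0 : Z n) ρ := fun h' =>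
          hz (Metric.closedBall_subset_closedBall (by linarith) h')
        have h2 : z + (δ j, 0) ∉ Metric.closedBall (0 : Z n) ρ := by
          intro h'
          apply hz
          rw [mem_closedBall_zero_iff] at h' ⊢
          have := norm_sub_le (z + (δ j, 0)) ((δ j, 0) : Z n)
          rw [add_sub_cancel_right, norm_time, abs_of_pos (hδ0 j)] at this
          linarith [hδ1 j]
        rw [(hωs _ h1).1, (hωs _ h2).1]
        simp only [sub_self, mul_zero, norm_zero]
        positivity
    · refine ae_of_all _ fun z => ?_
      have := (hasDerivAt_time hω z 0).tendsto_slope_zero.comp hδt'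
      simp only [Function.comp_def, Prod.mk_zero_zero, add_zero, zero_add, smul_eq_mul] at this
      refine (this.const_mul (f z ^ 2 / 2)).congr fun j => ?_
      ring
  have hfin : D 0 ≤ ∫ z, f z ^ 2 / 2 * timeDeriv ω z := by
    refine le_of_tendsto_of_tendsto' tL tR fun j => ?_
    exact mul_le_mul_of_nonneg_left (hstep _ (hδ0 j).le (hδ1 j)) (inv_nonneg.2 (hδ0 j).le)
  have e0 := hDs 0 (by simp)
  simp only [Prod.mk_zero_zero, add_zero] at e0
  rw [e0]; exact hfin

end evolution

/-! ### One-sided divergence bounds and the Faber–Krahn inequality -/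

/-- An upper bound `div v ≤ Λ` in the sense of distributions on `{t < T}`. -/
def DivLE (v : Z n → E n) (Λ T : ℝ) : Prop :=
  ∀ ζ : Z n → ℝ, IsTest ζ → (∀ z, 0 ≤ ζ z) → (∀ z, T ≤ z.1 → ζ z = 0) →
    - ∫ z, inner ℝ (v z) (spaceGrad ζ z) ≤ Λ * ∫ z, ζ z

theorem integral_inner_indicator {v Q : Z n → E n} {r : ℝ}
    (hQ : ∀ z, z ∉ Metric.closedBall (0 : Z n) r → Q z = 0) :
    ∫ z, inner ℝ ((Metric.closedBall (0 : Z n) r).indicator v z) (Q z) = ∫ z, inner ℝ (v z) (Q z) := by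
  refine integral_congr_ae (ae_of_all _ fun z => ?_)
  by_cases hz : z ∈ Metric.closedBall (0 : Z n) r
  · simp [indicator_of_mem hz]
  · simp [hQ z hz]

theorem CPair.exists_radius {ψ : Z n → ℝ} {P : Z n → E n} (h : CPair ψ P) :
    ∃ r : ℝ, (∀ z, z ∉ Metric.closedBall (0 : Z n) r → ψ z = 0 ∧ P z = 0) ∧
      ∀ j z, z ∉ Metric.closedBall (0 : Z n) r → AggDiff.moll j ψ z = 0 ∧ AggDiff.moll j P z = 0 := by
  obtain ⟨-, -, r₁, hr₁⟩ := h.moll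
  obtain ⟨r₂, hr₂⟩ := h.supp
  have hball : ∀ r', r' ≤ max r₁ r₂ → ∀ z, z ∉ Metric.closedBall (0 : Z n) (max r₁ r₂) →
    z ∉ Metric.closedBall (0 : Z n) r' :=
    fun r' hr' z hz hz' => hz (Metric.closedBall_subset_closedBall hr' hz')
  exact ⟨max r₁ r₂, fun z hz => hr₂ z (hball _ (le_max_right _ _) z hz),
    fun j z hz => hr₁ j z (hball _ (le_max_left _ _) z hz)⟩

theorem CPair.integrable {ψ : Z n → ℝ} {P : Z n → E n} (h : CPair ψ P) : Integrable ψ volume := by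
  obtain ⟨r, hr⟩ := h.supp
  have h1 := (h.memLp.restrict (Metric.closedBall (0 : Z n) r))
  have : IsFiniteMeasure (volume.restrict (Metric.closedBall (0 : Z n) r)) :=
    ⟨by rw [Measure.restrict_apply_univ]; exact (isCompact_closedBall _ _).measure_lt_top⟩
  have h2 : IntegrableOn ψ (Metric.closedBall (0 : Z n) r) volume := h1.integrable (by norm_num)
  exact (integrableOn_iff_integrable_of_support_subset (fun z hz => by
    by_contra hne; exact hz (hr z hne).1)).1 h2

theorem CPair.integrable_grad {ψ : Z n → ℝ} {P : Z n → E n} (h : CPair ψ P) : Integrable P volume := by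
  obtain ⟨r, hr⟩ := h.supp
  have h1 := (h.memLp_grad.restrict (Metric.closedBall (0 : Z n) r))
  have : IsFiniteMeasure (volume.restrict (Metric.closedBall (0 : Z n) r)) :=
    ⟨by rw [Measure.restrict_apply_univ]; exact (isCompact_closedBall _ _).measure_lt_top⟩
  have h2 : IntegrableOn P (Metric.closedBall (0 : Z n) r) volume := h1.integrable (by norm_num)
  exact (integrableOn_iff_integrable_of_support_subset (fun z hz => by
    by_contra hne; exact hz (hr z hne).2)).1 h2

theorem memLp_one_indicator (r : ℝ) :
    MemLp ((Metric.closedBall (0 : Z n) r).indicator (fun _ => (1:ℝ))) 2 volume :=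
  memLp_indicator_const 2 Metric.isClosed_closedBall.measurableSet 1
    (Or.inr (isCompact_closedBall _ _).measure_lt_top.ne)

/-- The distributional bound on the divergence extends to non-smooth test functions. -/
theorem DivLE.cpair {v : Z n → E n} {Λ T : ℝ} (h : DivLE v Λ T) (hv : LocL2 v)
    {ψ : Z n → ℝ} {P : Z n → E n} (hψ : CPair ψ P) (h0 : 0 ≤ᵐ[volume] ψ) {T' : ℝ} (hT' : T' < T)
    (hψT : ∀ z, T' ≤ z.1 → ψ z = 0) :
    - ∫ z, inner ℝ (v z) (P z) ≤ Λ * ∫ z, ψ z := by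
  obtain ⟨hT, hgr, -⟩ := hψ.moll
  obtain ⟨r, hs, hsj⟩ := hψ.exists_radius
  have hmP : ∀ j, MemLp (moll j P) 2 volume := fun j => by
    rw [← hgr j]; exact (hT j).memLp_spaceGrad 2
  have t1 := tendsto_integral_inner (hv.memLp_indicator r) hmP hψ.memLp_grad (tendsto_moll hψ.memLp_grad)
  have t2 := tendsto_integral_inner (memLp_one_indicator (n := n) r) (fun j => (hT j).memLp 2) hψ.memLp
    (tendsto_moll hψ.memLp)
  have e2 : ∀ q : Z n → ℝ, (∀ z, z ∉ Metric.closedBall (0 : Z n) r → q z = 0) →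
      ∫ z, inner ℝ ((Metric.closedBall (0 : Z n) r).indicator (fun _ => (1:ℝ)) z) (q z) = ∫ z, q z := by
    intro q hq
    refine integral_congr_ae (ae_of_all _ fun z => ?_)
    by_cases hz : z ∈ Metric.closedBall (0 : Z n) r
    · simp [indicator_of_mem hz]
    · simp [hq z hz]
  rw [integral_inner_indicator fun z hz => (hs z hz).2] at t1
  rw [e2 _ fun z hz => (hs z hz).1] at t2
  refine le_of_tendsto_of_tendsto t1.neg (t2.const_mul Λ) ?_
  -- Mollification spreads the support in time by at most `1 / (j + 1)`; the gap between `T'` and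
  -- `T` leaves room for it.
  have hev : ∀ᶠ j : ℕ in atTop, 1 / ((j : ℝ) + 1) < T - T' :=
    tendsto_one_div_add_atTop_nhds_zero_nat.eventually (gt_mem_nhds (sub_pos.2 hT'))
  filter_upwards [hev] with j hj
  rw [integral_inner_indicator fun z hz => (hsj j z hz).2, e2 _ fun z hz => (hsj j z hz).1, ← hgr j]
  refine h _ (hT j) (moll_nonneg j h0) fun z hz => moll_eq_zero fun w hw => hψT w ?_
  have : |w.1 - z.1| ≤ dist w z := by rw [Prod.dist_eq]; exact le_max_left _ _
  have := (abs_le.1 this).1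
  linarith

/-- The constant in the Sobolev inequality `‖f‖_{n/(n-1)} ≤ C ‖∇f‖₁`. -/
noncomputable def sobolevConst (n : ℕ) : ℝ≥0 :=
  eLpNormLESNormFDerivOneConst (volume : Measure (E n)) (((n : ℝ≥0) / (n - 1) : ℝ≥0) : ℝ)

/-- The Sobolev inequality bounds the norm of `f` in `L^(n/(n-1))` by that of its gradient in `L¹`.
Hölder on `S` then gains the power `1 - (n - 1)/n = 1/n` of the measure. -/
theorem sobolev_slice (hn : 2 ≤ n) {f : E n → ℝ} (hf : ContDiff ℝ 1 f) (hc : HasCompactSupport f)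
    {S : Set (E n)} (s : ℝ≥0∞) (hS : volume S ≤ s) :
    ∫⁻ x in S, ‖f x‖ₑ ≤ sobolevConst n * s ^ (1 / (n : ℝ)) * ∫⁻ x, ‖gradient f x‖ₑ := by
  have hn1 : (1 : ℝ≥0) < n := by exact_mod_cast (by omega : 1 < n)
  have hn2 : (0 : ℝ) < n - 1 := by
    have : (1 : ℝ) < n := by exact_mod_cast (by omega : 1 < n)
    linarith
  set p : ℝ≥0 := (n : ℝ≥0) / (n - 1) with hp
  have hpc : (p : ℝ) = n / (n - 1) := by
    rw [hp, NNReal.coe_div, NNReal.coe_sub hn1.le]; simp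
  have hconj : NNReal.HolderConjugate (Module.finrank ℝ (E n)) p := by
    rw [NNReal.holderConjugate_iff]
    rw [finrank_euclideanSpace_fin]
    refine ⟨hn1, ?_⟩
    rw [← NNReal.coe_inj]
    push_cast
    rw [hpc]; field_simp
    ring
  have h1 := eLpNorm_le_eLpNorm_fderiv_one volume hf hc hconj
  have h2 : ∫⁻ x in S, ‖f x‖ₑ ≤ eLpNorm f p (volume.restrict S) * (volume S) ^ (1 / (n : ℝ)) := by
    have := eLpNorm_le_eLpNorm_mul_rpow_measure_univ (p := 1) (q := p) (μ := volume.restrict S) (f := f)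
      (by
        have : (1 : ℝ≥0) ≤ p := by
          rw [← NNReal.coe_le_coe, hpc, NNReal.coe_one, le_div_iff₀ hn2]; linarith
        exact_mod_cast this) hf.continuous.aestronglyMeasurable
    rw [eLpNorm_one_eq_lintegral_enorm, Measure.restrict_apply_univ] at this
    refine this.trans (le_of_eq ?_)
    congr 2
    simp only [ENNReal.toReal_one, ENNReal.coe_toReal, hpc]
    field_simp
    ring
  have h3 : eLpNorm (fderiv ℝ f) 1 volume = ∫⁻ x, ‖gradient f x‖ₑ := by
    rw [eLpNorm_one_eq_lintegral_enorm]
    refine lintegral_congr fun x => ?_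
    unfold gradient
    rw [← ofReal_norm, ← ofReal_norm, LinearIsometryEquiv.norm_map]
  rw [h3] at h1
  calc _ ≤ eLpNorm f p (volume.restrict S) * (volume S) ^ (1 / (n : ℝ)) := h2
    _ ≤ (sobolevConst n * ∫⁻ x, ‖gradient f x‖ₑ) * s ^ (1 / (n : ℝ)) := by
        gcongr
        exact (eLpNorm_mono_measure f Measure.restrict_le_self).trans h1
    _ = _ := by ring

/-- Tonelli reduces the claim to single times. Only the measure of the time slices of `S` enters, so
the constant does not see the length of the time interval. -/
theorem sobolev_test (hn : 2 ≤ n) {φ : Z n → ℝ} (hφ : IsTest φ) {S : Set (Z n)} (hS : MeasurableSet S)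
    (s : ℝ≥0∞) (hs : ∀ᵐ t : ℝ, volume {x : E n | (t, x) ∈ S} ≤ s) :
    ∫⁻ z in S, ‖φ z‖ₑ ≤ sobolevConst n * s ^ (1 / (n : ℝ)) * ∫⁻ z, ‖spaceGrad φ z‖ₑ := by
  have hm1 : Measurable fun z => ‖φ z‖ₑ := hφ.continuous.measurable.enorm
  have hm2 : Measurable fun z => ‖spaceGrad φ z‖ₑ := hφ.continuous_spaceGrad.measurable.enorm
  rw [← lintegral_indicator hS, Measure.volume_eq_prod, lintegral_prod _ (hm1.indicator hS).aemeasurable,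
    lintegral_prod _ hm2.aemeasurable, ← lintegral_const_mul _ hm2.lintegral_prod_right']
  refine lintegral_mono_ae (hs.mono fun t ht => ?_)
  have e : ∀ x, S.indicator (fun z => ‖φ z‖ₑ) (t, x) = {x : E n | (t, x) ∈ S}.indicator (fun x => ‖φ (t, x)‖ₑ) x := by
    intro x; rfl
  simp_rw [e]
  rw [lintegral_indicator (show MeasurableSet {x : E n | (t, x) ∈ S} from measurable_prodMk_left hS)]
  have hc : HasCompactSupport fun x => φ (t, x) := by
    obtain ⟨r, hr, hz⟩ := hφ.exists_radius
    refine HasCompactSupport.intro (isCompact_closedBall (0 : E n) r) fun x hx => (hz _ fun h => hx ?_).1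
    rw [mem_closedBall_zero_iff] at h ⊢
    exact (norm_snd_le (t, x)).trans h
  exact sobolev_slice hn ((hφ.1.of_le (by simp)).comp (contDiff_prodMk_right t)) hc s ht

/-- Faber–Krahn type inequality on space-time sets with small time slices. -/
theorem CPair.faberKrahn (hn : 2 ≤ n) {ψ : Z n → ℝ} {P : Z n → E n} (hψ : CPair ψ P)
    {S : Set (Z n)} (hS : MeasurableSet S) (s : ℝ≥0)
    (hs : ∀ᵐ t : ℝ, volume {x : E n | (t, x) ∈ S} ≤ s) :
    ∫ z in S, |ψ z| ≤ sobolevConst n * (s : ℝ) ^ (1 / (n : ℝ)) * ∫ z, ‖P z‖ := by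
  obtain ⟨hT, hgr, -⟩ := hψ.moll
  obtain ⟨r, hz, hzj⟩ := hψ.exists_radius
  have hmP : ∀ j, MemLp (AggDiff.moll j P) 2 volume := fun j => by
    rw [← hgr j]; exact (hT j).memLp_spaceGrad 2
  have hiP : ∀ j, Integrable (AggDiff.moll j P) volume := fun j => by
    rw [← hgr j]; exact memLp_one_iff_integrable.1 ((hT j).memLp_spaceGrad 1)
  have hiψ : ∀ j, Integrable (AggDiff.moll j ψ) volume := fun j =>
    memLp_one_iff_integrable.1 ((hT j).memLp 1)
  have t1 : Tendsto (fun j => ∫ z, ‖AggDiff.moll j P z‖) atTop (𝓝 (∫ z, ‖P z‖)) := by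
    have := tendsto_integral_zero_of_le_mul (memLp_one_indicator (n := n) r)
      (fun j => (hmP j).sub hψ.memLp_grad) (tendsto_moll hψ.memLp_grad)
      (h := fun j z => ‖AggDiff.moll j P z‖ - ‖P z‖) (fun j => ae_of_all _ fun z => by
        by_cases hzr : z ∈ Metric.closedBall (0 : Z n) r
        · simpa [indicator_of_mem hzr] using abs_norm_sub_norm_le (AggDiff.moll j P z) (P z)
        · simp [(hz z hzr).2, (hzj j z hzr).2])
    have h2 := this.add_const (∫ z, ‖P z‖)
    rw [zero_add] at h2
    refine h2.congr fun j => ?_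
    rw [integral_sub (hiP j).norm hψ.integrable_grad.norm]; ring
  have t2 : Tendsto (fun j => ∫ z in S, |AggDiff.moll j ψ z|) atTop (𝓝 (∫ z in S, |ψ z|)) := by
    have := tendsto_integral_zero_of_le_mul (μ := volume.restrict S) ((memLp_one_indicator (n := n) r).restrict S)
      (fun j => (((hT j).memLp 2).sub hψ.memLp).restrict S) (tendsto_of_tendsto_of_tendsto_of_le_of_le tendsto_const_nhds
        (tendsto_moll hψ.memLp) (fun _ => zero_le) (fun j => eLpNorm_mono_measure _ Measure.restrict_le_self))
      (h := fun j z => |AggDiff.moll j ψ z| - |ψ z|) (fun j => ae_of_all _ fun z => by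
        by_cases hzr : z ∈ Metric.closedBall (0 : Z n) r
        · simpa [indicator_of_mem hzr] using abs_abs_sub_abs_le (AggDiff.moll j ψ z) (ψ z)
        · simp [(hz z hzr).1, (hzj j z hzr).1])
    have h2 := this.add_const (∫ z in S, |ψ z|)
    rw [zero_add] at h2
    refine h2.congr fun j => ?_
    rw [integral_sub (hiψ j).abs.integrableOn hψ.integrable.abs.integrableOn]; ring
  refine le_of_tendsto_of_tendsto' t2 (t1.const_mul _) fun j => ?_
  have h := sobolev_test hn (hT j) hS s hs
  rw [hgr j] at h
  have e1 : ∫ z in S, |AggDiff.moll j ψ z| = (∫⁻ z in S, ‖AggDiff.moll j ψ z‖ₑ).toReal := by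
    rw [← integral_norm_eq_lintegral_enorm (hiψ j).1.restrict]; rfl
  have e2 : ∫ z, ‖AggDiff.moll j P z‖ = (∫⁻ z, ‖AggDiff.moll j P z‖ₑ).toReal :=
    integral_norm_eq_lintegral_enorm (hiP j).1
  rw [e1, e2]
  have hfin : (sobolevConst n * (s : ℝ≥0∞) ^ (1 / (n : ℝ)) * ∫⁻ z, ‖AggDiff.moll j P z‖ₑ) ≠ ⊤ := by
    refine ENNReal.mul_ne_top (ENNReal.mul_ne_top (by simp) ?_) (hiP j).2.ne
    exact ENNReal.rpow_ne_top_of_nonneg (by positivity) (by simp)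
  refine (ENNReal.toReal_mono hfin h).trans (le_of_eq ?_)
  rw [ENNReal.toReal_mul, ENNReal.toReal_mul, ← ENNReal.toReal_rpow]
  simp

/-! ### A differential inequality in the sense of distributions -/

/-- A differential inequality in the sense of distributions: a function which is nonpositive for
negative times and satisfies `z' ≤ - μ z` on `(-∞, T)` stays nonpositive. -/
theorem ae_nonpos_of_distributional_ode {z : ℝ → ℝ} (hz : LocallyIntegrable z volume) {μ T : ℝ}
    (h : ∀ η : ℝ → ℝ, ContDiff ℝ ((⊤ : ℕ∞) : WithTop ℕ∞) η → HasCompactSupport η → (∀ t, 0 ≤ η t) →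
      (∀ t, T ≤ t → η t = 0) → μ * ∫ t, z t * η t ≤ ∫ t, z t * deriv η t)
    (h0 : ∀ᵐ t : ℝ, t < 0 → z t ≤ 0) : ∀ᵐ t : ℝ, t < T → z t ≤ 0 := by
  -- the weighted function `w = exp (μ t) z` is nonincreasing
  let w : ℝ → ℝ := fun t => Real.exp (μ * t) * z t
  have hec : ContDiff ℝ ((⊤ : ℕ∞) : WithTop ℕ∞) (fun t : ℝ => Real.exp (μ * t)) :=
    (contDiff_const.mul contDiff_id).exp
  have hw : LocallyIntegrable w volume := by
    have := hz.locallyIntegrableOn (univ : Set ℝ)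
    rw [← locallyIntegrableOn_univ]
    exact this.continuousOn_mul hec.continuous.continuousOn isOpen_univ.isLocallyClosed
  have hmono : ∀ θ : ℝ → ℝ, ContDiff ℝ ((⊤ : ℕ∞) : WithTop ℕ∞) θ → HasCompactSupport θ → (∀ t, 0 ≤ θ t) →
      (∀ t, T ≤ t → θ t = 0) → 0 ≤ ∫ t, w t * deriv θ t := by
    intro θ hθ hc hθ0 hθT
    have h1 := h (fun t => Real.exp (μ * t) * θ t) (hec.mul hθ) hc.mul_left
      (fun t => mul_nonneg (Real.exp_pos _).le (hθ0 t)) (fun t ht => by simp [hθT t ht])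
    have hd : ∀ t, deriv (fun t => Real.exp (μ * t) * θ t) t =
        μ * (Real.exp (μ * t) * θ t) + Real.exp (μ * t) * deriv θ t := by
      intro t
      have e1 : HasDerivAt (fun t : ℝ => Real.exp (μ * t)) (Real.exp (μ * t) * (μ * 1)) t :=
        ((hasDerivAt_id t).const_mul μ).exp
      have e2 : HasDerivAt θ (deriv θ t) t := (hθ.differentiable (by simp) t).hasDerivAt
      refine (e1.fun_mul e2).deriv.trans ?_; ring
    have i1 : Integrable (fun t => z t * (Real.exp (μ * t) * θ t)) volume :=
      hz.integrable_smul_right_of_hasCompactSupport (hec.continuous.mul hθ.continuous) hc.mul_left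
    have i2 : Integrable (fun t => w t * deriv θ t) volume :=
      hw.integrable_smul_right_of_hasCompactSupport (hθ.continuous_deriv (by simp)) hc.deriv
    have e : ∀ t, z t * deriv (fun t => Real.exp (μ * t) * θ t) t =
        μ * (z t * (Real.exp (μ * t) * θ t)) + w t * deriv θ t := by
      intro t; rw [hd]; simp only [w]; ring
    simp_rw [e] at h1
    rw [integral_add (i1.const_mul μ) i2, integral_const_mul] at h1
    linarith
  -- compare mollifications at a time `t < T` and at a negative time
  let b : ℕ → ContDiffBump (0 : ℝ) := fun j => ⟨1 / (2 * ((j : ℝ) + 1)), 1 / ((j : ℝ) + 1), by positivity, by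
    have : (0:ℝ) < (j : ℝ) + 1 := by positivity
    apply one_div_lt_one_div_of_lt this; linarith⟩
  have hb : Tendsto (fun j => (b j).rOut) atTop (𝓝 0) := tendsto_one_div_add_atTop_nhds_zero_nat
  have hae : ∀ᵐ t, Tendsto (fun j => convolution ((b j).normed volume) w (ContinuousLinearMap.lsmul ℝ ℝ) volume t)
      atTop (𝓝 (w t)) := by
    refine ContDiffBump.ae_convolution_tendsto_right_of_locallyIntegrable (K := 2) hb
      (Eventually.of_forall fun j => ?_) hw
    simp only [b]
    have : (0:ℝ) < (j:ℝ) + 1 := by positivity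
    apply le_of_eq; field_simp
  filter_upwards [hae, h0] with t ht ht0 htT
  by_cases htneg : t < 0
  · exact ht0 htneg
  have htneg' : 0 ≤ t := not_lt.1 htneg
  suffices w t ≤ 0 by
    by_contra hpos
    exact absurd this (not_le.2 (mul_pos (Real.exp_pos _) (not_le.1 hpos)))
  refine le_of_tendsto ht ?_
  have hev : ∀ᶠ j : ℕ in atTop, 1 / ((j : ℝ) + 1) < T - t :=
    tendsto_one_div_add_atTop_nhds_zero_nat.eventually (gt_mem_nhds (sub_pos.2 htT))
  filter_upwards [hev] with j hj
  set β := (b j).normed volume with hβ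
  have hβc : ContDiff ℝ ((⊤ : ℕ∞) : WithTop ℕ∞) β := (b j).contDiff_normed
  have hβs : HasCompactSupport β := (b j).hasCompactSupport_normed
  have hβ0 : ∀ x, 0 ≤ β x := (b j).nonneg_normed
  have hβz : ∀ x, 1 / ((j : ℝ) + 1) ≤ |x| → β x = 0 := by
    intro x hx
    have : x ∉ Function.support β := by
      rw [hβ, (b j).support_normed_eq, mem_ball_zero_iff]
      exact not_lt.2 hx
    simpa using this
  have hj1 : 1 / ((j : ℝ) + 1) ≤ 1 := by
    rw [div_le_one (by positivity)]; linarith [Nat.cast_nonneg (α := ℝ) j]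
  have hj0 : 0 < 1 / ((j : ℝ) + 1) := by positivity
  have hβsymm : ∀ x, β (-x) = β x := fun x => (b j).normed_neg x
  -- the competitor `θ(s) = ∫ over r ≤ s of β(r + 2) - β(r - t)`
  let θ' : ℝ → ℝ := fun s => β (s + 2) - β (s - t)
  have hθ'c : ContDiff ℝ ((⊤ : ℕ∞) : WithTop ℕ∞) θ' :=
    (hβc.comp (contDiff_id.add contDiff_const)).sub (hβc.comp (contDiff_id.sub contDiff_const))
  let B : ℝ → ℝ := fun s => ∫ r in (-4)..s, β r
  have hβcont : Continuous β := hβc.continuous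
  have hBd : ∀ s, HasDerivAt B (β s) s := fun s =>
    intervalIntegral.integral_hasDerivAt_right (hβcont.intervalIntegrable _ _)
      hβcont.stronglyMeasurable.stronglyMeasurableAtFilter hβcont.continuousAt
  have hBmono : Monotone B := monotone_of_deriv_nonneg (fun s => (hBd s).differentiableAt)
    (fun s => by rw [(hBd s).deriv]; exact hβ0 s)
  have hBlow : ∀ s, s ≤ -1 → B s = 0 := by
    intro s hs
    have : ∀ a b : ℝ, a ≤ -1 → b ≤ -1 → ∫ r in a..b, β r = 0 := by
      intro a b ha hb
      refine (intervalIntegral.integral_congr (g := fun _ => 0) fun r hr => ?_).trans (by simp)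
      have hr1 : r ≤ -1 := hr.2.trans (max_le ha hb)
      exact hβz r (by rw [abs_of_nonpos (by linarith)]; linarith)
    exact this _ _ (by norm_num) hs
  have hBhigh : ∀ s, 1 / ((j : ℝ) + 1) ≤ s → B s = B (1 / ((j : ℝ) + 1)) := by
    intro s hs
    have e : B s = B (1 / ((j : ℝ) + 1)) + ∫ r in (1 / ((j : ℝ) + 1))..s, β r :=
      (intervalIntegral.integral_add_adjacent_intervals (hβcont.intervalIntegrable _ _)
        (hβcont.intervalIntegrable _ _)).symm
    rw [e]
    have : ∫ r in (1 / ((j : ℝ) + 1))..s, β r = 0 := by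
      refine (intervalIntegral.integral_congr (g := fun _ => 0) fun r hr => ?_).trans (by simp)
      rw [uIcc_of_le hs] at hr
      exact hβz r (hr.1.trans (le_abs_self r))
    rw [this, add_zero]
  have hBc : ContDiff ℝ ((⊤ : ℕ∞) : WithTop ℕ∞) B := by
    rw [contDiff_infty_iff_deriv]
    exact ⟨fun s => (hBd s).differentiableAt, by rw [show deriv B = β from funext fun s => (hBd s).deriv]; exact hβc⟩
  -- A step up near time `-2` and a step down near `t`. It is nonnegative because `B` is monotone
  -- and `t > -2`, and compactly supported because the two steps cancel. Around `-2` only negative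
  -- times are met, where the sign of `w` is known, so monotonicity of `w` bounds its mollification
  -- at `t`.
  let θ : ℝ → ℝ := fun s => B (s + 2) - B (s - t)
  have hθd : ∀ s, deriv θ s = β (s + 2) - β (s - t) := by
    intro s
    have e1 := (hBd (s + 2)).comp_add_const s 2
    have e2 := (hBd (s - t)).comp_sub_const s t
    exact (e1.sub e2).deriv
  have hθc : ContDiff ℝ ((⊤ : ℕ∞) : WithTop ℕ∞) θ :=
    (hBc.comp (contDiff_id.add contDiff_const)).sub (hBc.comp (contDiff_id.sub contDiff_const))
  have hθT : ∀ s, t + 1 / ((j : ℝ) + 1) ≤ s → θ s = 0 := by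
    intro s hs
    simp only [θ]
    rw [hBhigh (s + 2) (by linarith), hBhigh (s - t) (by linarith), sub_self]
  have hθs : HasCompactSupport θ := by
    refine HasCompactSupport.intro (isCompact_Icc (a := -3) (b := t + 1)) fun s hs => ?_
    rw [mem_Icc, not_and_or, not_le, not_le] at hs
    rcases hs with hs | hs
    · simp only [θ]
      rw [hBlow _ (by linarith), hBlow _ (by linarith), sub_self]
    · exact hθT s (by linarith)
  have key := hmono θ hθc hθs (fun s => sub_nonneg.2 (hBmono (by linarith))) (fun s hs => hθT s (by linarith))
  simp_rw [hθd, mul_sub] at key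
  have i1 : Integrable (fun s => w s * β (s + 2)) volume :=
    hw.integrable_smul_right_of_hasCompactSupport (hβcont.comp (continuous_id.add continuous_const))
      (hβs.comp_homeomorph (Homeomorph.addRight 2))
  have i2 : Integrable (fun s => w s * β (s - t)) volume :=
    hw.integrable_smul_right_of_hasCompactSupport (hβcont.comp (continuous_id.sub continuous_const))
      (hβs.comp_homeomorph (Homeomorph.subRight t))
  rw [integral_sub i1 i2] at key
  have hneg : ∫ s, w s * β (s + 2) ≤ 0 := by
    refine integral_nonpos_of_ae ?_
    filter_upwards [h0] with s hs
    simp only [Pi.zero_apply]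
    by_cases hs0 : s < 0
    · exact mul_nonpos_of_nonpos_of_nonneg (mul_nonpos_of_nonneg_of_nonpos (Real.exp_pos _).le (hs hs0)) (hβ0 _)
    · rw [hβz (s + 2) (by rw [abs_of_nonneg (by linarith)]; linarith), mul_zero]
  rw [convolution_eq_swap]
  have e : ∫ s, (ContinuousLinearMap.lsmul ℝ ℝ (β (t - s))) (w s) = ∫ s, w s * β (s - t) := by
    refine integral_congr_ae (ae_of_all _ fun s => ?_)
    simp only [ContinuousLinearMap.lsmul_apply, smul_eq_mul]
    rw [← hβsymm, neg_sub, mul_comm]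
  rw [e]
  linarith

/-! ### The localized energy estimate for the truncated density -/

section product
variable {χ : E n → ℝ} {η : ℝ → ℝ}

theorem isTest_prod (hχ : ContDiff ℝ ((⊤ : ℕ∞) : WithTop ℕ∞) χ) (hχc : HasCompactSupport χ)
    (hη : ContDiff ℝ ((⊤ : ℕ∞) : WithTop ℕ∞) η) (hηc : HasCompactSupport η) :
    IsTest (fun z : Z n => χ z.2 * η z.1) := by
  refine ⟨(hχ.comp contDiff_snd).mul (hη.comp contDiff_fst), ?_⟩
  refine HasCompactSupport.intro (K := tsupport η ×ˢ tsupport χ)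
    (hηc.isCompact.prod hχc.isCompact) fun z hz => ?_
  rw [mem_prod, not_and_or] at hz
  rcases hz with hz | hz
  · simp [image_eq_zero_of_notMem_tsupport hz]
  · simp [image_eq_zero_of_notMem_tsupport hz]

theorem spaceGrad_prod (hχ : Differentiable ℝ χ) (z : Z n) :
    spaceGrad (fun z : Z n => χ z.2 * η z.1) z = η z.1 • gradient χ z.2 := by
  have h := (((hχ z.2).hasFDerivAt).mul_const (η z.1)).hasGradientAt
  unfold spaceGrad
  rw [h.gradient, gradient, map_smul]

theorem timeDeriv_prod (z : Z n) :
    timeDeriv (fun z : Z n => χ z.2 * η z.1) z = χ z.2 * deriv η z.1 := by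
  unfold timeDeriv
  simp

theorem gradient_sq (hχ : Differentiable ℝ χ) (x : E n) :
    gradient (fun x => χ x ^ 2) x = (2 * χ x) • gradient χ x := by
  have h := ((hχ x).hasFDerivAt.pow 2).hasGradientAt
  rw [h.gradient, gradient]
  simp [mul_smul]

end product

/-- A bounded density driven by nonlinear diffusion and a drift field, on all of space-time; the
diffusive flux `G` is the gradient of `u ^ m` for positive times and vanishes before. -/
structure DriftDiffusion (m : ℝ) (u : Z n → ℝ) (G v : Z n → E n) : Prop where
  measurable : Measurable u
  nonneg : ∀ z, 0 ≤ u z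
  locBdd : LocBdd u
  locL2_flux : LocL2 G
  locL2_drift : LocL2 v
  weakGrad : WeakGrad (fun z => if 0 < z.1 then u z ^ m else 0) G
  evolution : WeakEvolution u (fun z => G z + u z • v z)

/-- The part of `u` above the level `k`, for positive times. -/
noncomputable def excess (u : Z n → ℝ) (k : ℝ) (z : Z n) : ℝ := if 0 < z.1 then max (u z - k) 0 else 0

section excess
variable {u : Z n → ℝ} {k : ℝ}

theorem excess_nonneg (z : Z n) : 0 ≤ excess u k z := by
  unfold excess; split_ifs
  · exact le_max_right _ _
  · exact le_rfl

theorem excess_pos {z : Z n} (h : 0 < excess u k z) : 0 < z.1 ∧ k < u z ∧ excess u k z = u z - k := by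
  unfold excess at h ⊢
  split_ifs at h ⊢ with ht
  · have hk : k < u z := by
      by_contra hle
      rw [max_eq_right (by linarith [not_lt.1 hle])] at h
      exact lt_irrefl _ h
    exact ⟨ht, hk, max_eq_left (by linarith)⟩
  · exact absurd h (lt_irrefl _)

theorem excess_le (hu : ∀ z, 0 ≤ u z) (hk : 0 ≤ k) (z : Z n) : excess u k z ≤ u z := by
  rcases (excess_nonneg (u := u) (k := k) z).eq_or_lt with h | h
  · rw [← h]; exact hu z
  · rw [(excess_pos h).2.2]; linarith

theorem measurable_excess (hu : Measurable u) : Measurable (excess u k) := by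
  unfold excess
  exact Measurable.ite (measurableSet_lt measurable_const measurable_fst) ((hu.sub_const k).max measurable_const) measurable_const

theorem locBdd_excess (hu0 : ∀ z, 0 ≤ u z) (hu : LocBdd u) (hk : 0 ≤ k) : LocBdd (excess u k) := by
  intro r
  obtain ⟨B, hB⟩ := hu r
  refine ⟨B, hB.mono fun z hz hzr => ?_⟩
  rw [abs_of_nonneg (excess_nonneg z)]
  exact (excess_le hu0 hk z).trans ((le_abs_self _).trans (hz hzr))
end excess

/-- The function `s ↦ s^(1/m)` undoes the power `m`. Freezing its derivative below `k^m` makes it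
continuous even for `m > 1`, where it is singular at zero. This exhibits `(u - k)₊` as a truncated
primitive evaluated at `u^m`, the form that `WeakGrad.comp_truncated` needs. -/
theorem truncated_primitive {m k w : ℝ} (hm : 0 < m) (hk : 0 < k) (hw : 0 ≤ w) :
    ∫ s in (k ^ m)..max (w ^ m) (k ^ m), (1 / m) * max s (k ^ m) ^ (1 / m - 1) = max (w - k) 0 := by
  have hκ : 0 < k ^ m := Real.rpow_pos_of_pos hk m
  have hle : k ^ m ≤ max (w ^ m) (k ^ m) := le_max_right _ _
  have hd : ∀ s ∈ uIcc (k ^ m) (max (w ^ m) (k ^ m)), HasDerivAt (fun s : ℝ => s ^ (1 / m)) ((1 / m) * max s (k ^ m) ^ (1 / m - 1)) s := by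
    intro s hs
    rw [uIcc_of_le hle] at hs
    rw [max_eq_left hs.1]
    exact Real.hasDerivAt_rpow_const (Or.inl (hκ.trans_le hs.1).ne')
  have hc : Continuous fun s : ℝ => (1 / m) * max s (k ^ m) ^ (1 / m - 1) :=
    continuous_const.mul ((continuous_id.max continuous_const).rpow_const fun s =>
      Or.inl (hκ.trans_le (le_max_right _ _)).ne')
  rw [intervalIntegral.integral_eq_sub_of_hasDerivAt hd (hc.intervalIntegrable _ _)]
  have e : ∀ x : ℝ, 0 ≤ x → (x ^ m) ^ (1 / m) = x := fun x hx => by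
    rw [← Real.rpow_mul hx, mul_one_div_cancel hm.ne', Real.rpow_one]
  rcases le_total w k with h | h
  · rw [max_eq_right (Real.rpow_le_rpow hw h hm.le), max_eq_right (by linarith), sub_self]
  · rw [max_eq_left (Real.rpow_le_rpow hk.le h hm.le), max_eq_left (by linarith), e w hw, e k hk.le]

namespace DriftDiffusion
variable {m : ℝ} {u : Z n → ℝ} {G v : Z n → E n}

theorem locL2_u (h : DriftDiffusion m u G v) : LocL2 u := h.locBdd.locL2 h.measurable.aestronglyMeasurable

theorem locL2_total (h : DriftDiffusion m u G v) : LocL2 (fun z => G z + u z • v z) :=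
  h.locL2_flux.add (h.locL2_drift.smul_bdd h.measurable.aestronglyMeasurable h.locBdd)

/-- The excess above a positive level has a weak gradient, through which the flux factors. -/
theorem exists_excess_grad (h : DriftDiffusion m u G v) (hm : 0 < m) {k : ℝ} (hk : 0 < k) :
    ∃ g : Z n → E n, LocL2 g ∧ WeakGrad (excess u k) g ∧ ∀ z, (excess u k z = 0 → g z = 0) ∧
      (0 < excess u k z → G z = (m * u z ^ (m - 1)) • g z) := by
  set W : Z n → ℝ := fun z => if 0 < z.1 then u z ^ m else 0 with hW
  have hκ : 0 < k ^ m := Real.rpow_pos_of_pos hk m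
  have hc : Continuous fun s : ℝ => (1 / m) * max s (k ^ m) ^ (1 / m - 1) :=
    continuous_const.mul ((continuous_id.max continuous_const).rpow_const fun s =>
      Or.inl (hκ.trans_le (le_max_right _ _)).ne')
  have hWm : Measurable W := Measurable.ite (measurableSet_lt measurable_const measurable_fst) (h.measurable.pow_const m) measurable_const
  have hWb : LocBdd W := by
    intro r
    obtain ⟨B, hB⟩ := h.locBdd r
    refine ⟨|B| ^ m, hB.mono fun z hz hzr => ?_⟩
    simp only [hW]
    split_ifs
    · rw [abs_of_nonneg (Real.rpow_nonneg (h.nonneg z) m)]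
      exact Real.rpow_le_rpow (h.nonneg z) ((le_abs_self _).trans ((hz hzr).trans (le_abs_self _))) hm.le
    · simp; positivity
  have hf : ∀ z, ∫ s in (k ^ m)..max (W z) (k ^ m), (1 / m) * max s (k ^ m) ^ (1 / m - 1) = excess u k z := by
    intro z
    simp only [hW, excess]
    split_ifs
    · exact truncated_primitive hm hk (h.nonneg z)
    · have := truncated_primitive hm hk (le_refl (0 : ℝ))
      rw [Real.zero_rpow hm.ne'] at this
      rw [this, max_eq_right (by linarith)]
  have key := h.weakGrad.comp_truncated hWm.aestronglyMeasurable hWb h.locL2_flux hc (k ^ m)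
  -- For `t ≤ 0` the function `W` is `0`, hence below `k^m`, which matches the value `0` of the
  -- excess there.
  have key' : WeakGrad (excess u k) (fun z => (if k ^ m < W z then
      (1 / m) * max (W z) (k ^ m) ^ (1 / m - 1) else 0) • G z) := by
    rw [← funext hf]; exact key
  refine ⟨_, ?_, key', fun z => ⟨fun h0 => ?_, fun hpos => ?_⟩⟩
  · refine h.locL2_flux.smul_bdd (ω := fun z => if k ^ m < W z then (1 / m) * max (W z) (k ^ m) ^ (1 / m - 1) else 0)
      (Measurable.ite (measurableSet_lt measurable_const hWm) (hc.measurable.comp hWm) measurable_const).aestronglyMeasurable ?_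
    intro r
    obtain ⟨B, hB⟩ := hWb r
    obtain ⟨C, hC⟩ := (isCompact_Icc (a := -B) (b := B)).exists_bound_of_continuousOn hc.continuousOn
    refine ⟨C, hB.mono fun z hz hzr => ?_⟩
    have := hC _ (abs_le.1 (hz hzr))
    split_ifs
    · exact this
    · simpa using (norm_nonneg _).trans this
  · have : ¬ k ^ m < W z := by
      intro hlt
      simp only [hW] at hlt
      unfold excess at h0
      split_ifs at hlt h0 with ht
      · have := (Real.rpow_lt_rpow_iff hk.le (h.nonneg z) hm).1 hlt
        rw [max_eq_left (by linarith)] at h0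
        linarith
      · linarith
    simp only [if_neg this, zero_smul]
  · obtain ⟨ht, hku, -⟩ := excess_pos hpos
    have huz : 0 < u z := hk.trans hku
    have hWz : W z = u z ^ m := by simp only [hW, if_pos ht]
    have hlt : k ^ m < W z := by
      rw [hWz]; exact Real.rpow_lt_rpow hk.le hku hm
    simp only [if_pos hlt]
    rw [smul_smul, max_eq_left hlt.le, hWz, ← Real.rpow_mul huz.le]
    -- Above the level, `g = (1/m) u^(1-m) G`, so the factor `m u^(m-1)` recovers the flux.
    have : m * (1 / m - 1) = 1 - m := by field_simp
    rw [this, show m * u z ^ (m - 1) * (1 / m * u z ^ (1 - m)) = u z ^ (m - 1) * u z ^ (1 - m) by field_simp,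
      ← Real.rpow_add huz]
    simp

/-- The localized energy estimate for the excess above the level `k`. -/
theorem localized_energy (h : DriftDiffusion m u G v) {k T T' Λ d₁ d₂ : ℝ} (hk : 0 < k)
    (hT : T' < T) (hdiv : DivLE v Λ T)
    {g : Z n → E n} (hg2 : LocL2 g) (hfg : WeakGrad (excess u k) g)
    (hg : ∀ z, (excess u k z = 0 → g z = 0) ∧ (0 < excess u k z → G z = (m * u z ^ (m - 1)) • g z))
    (hu0 : ∀ᵐ z : Z n, z.1 ≤ 0 → u z ≤ k)
    (hd₁ : ∀ᵐ z : Z n, z.1 < T → 0 < excess u k z → d₁ ≤ m * u z ^ (m - 1) ∧ m * u z ^ (m - 1) ≤ d₂)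
    (hd0 : 0 ≤ d₁)
    {χ : E n → ℝ} {η : ℝ → ℝ} (hχ : ContDiff ℝ ((⊤ : ℕ∞) : WithTop ℕ∞) χ) (hχc : HasCompactSupport χ)
    (hχ0 : ∀ x, 0 ≤ χ x)
    (hη : ContDiff ℝ ((⊤ : ℕ∞) : WithTop ℕ∞) η) (hηc : HasCompactSupport η) (hη0 : ∀ t, 0 ≤ η t)
    (hηT : ∀ t, T' ≤ t → η t = 0) :
    d₁ / 2 * ∫ z : Z n, ‖g z‖ ^ 2 * (χ z.2 ^ 2 * η z.1)
      ≤ (∫ z : Z n, excess u k z ^ 2 / 2 * (χ z.2 ^ 2 * deriv η z.1))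
        + Λ * (∫ z : Z n, (excess u k z ^ 2 / 2 + k * excess u k z) * (χ z.2 ^ 2 * η z.1))
        + 2 * d₂ * (∫ z : Z n, excess u k z ^ 2 * (‖gradient χ z.2‖ ^ 2 * η z.1))
        + ∫ z : Z n, excess u k z ^ 2 * ‖v z‖ * (χ z.2 * ‖gradient χ z.2‖ * η z.1) := by
  set f := excess u k with hf
  have hfm : Measurable f := measurable_excess h.measurable
  have hfb : LocBdd f := locBdd_excess h.nonneg h.locBdd hk.le
  have hf0 : ∀ z, 0 ≤ f z := excess_nonneg
  have hχ2 : ContDiff ℝ ((⊤ : ℕ∞) : WithTop ℕ∞) (fun x => χ x ^ 2) := hχ.pow 2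
  have hχ2c : HasCompactSupport (fun x => χ x ^ 2) := by
    simp_rw [sq]; exact hχc.mul_left
  set ω : Z n → ℝ := fun z => χ z.2 ^ 2 * η z.1 with hω
  have hωt : IsTest ω := isTest_prod hχ2 hχ2c hη hηc
  have hω0 : ∀ z, 0 ≤ ω z := fun z => mul_nonneg (sq_nonneg _) (hη0 _)
  have hωT' : ∀ z, T' ≤ z.1 → ω z = 0 := fun z hz => by simp [hω, hηT _ hz]
  have hχd : Differentiable ℝ χ := hχ.differentiable (by simp)
  have hωg : ∀ z, spaceGrad ω z = (2 * χ z.2 * η z.1) • gradient χ z.2 := by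
    intro z
    rw [hω, spaceGrad_prod (hχ2.differentiable (by simp)), gradient_sq hχd, smul_smul]
    congr 1; ring
  have hωd : ∀ z, timeDeriv ω z = χ z.2 ^ 2 * deriv η z.1 := fun z =>
    timeDeriv_prod (χ := fun x => χ x ^ 2) z
  have hgχc : Continuous (gradient χ) :=
    (InnerProductSpace.toDual ℝ (E n)).symm.continuous.comp (hχ.continuous_fderiv (by simp))
  -- energy inequality
  have hE := h.evolution.energy h.measurable.aestronglyMeasurable h.locBdd h.locL2_total hfg
    hfm.aestronglyMeasurable hfb hg2 (k := k) (T := T) (by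
      -- For `t ≤ 0` the excess is zero by definition; it agrees with `(u - k)₊` there only because
      -- the initial datum does not exceed `k`.
      filter_upwards [hu0] with z hz _
      simp only [hf, excess]
      split_ifs with ht
      · rfl
      · rw [max_eq_right]; linarith [hz (not_lt.1 ht)]) hωt hω0 (fun z hz => hωT' z (by linarith))
  -- the divergence inequality for `q = f² / 2 + k f`
  have hq := hfg.comp hfm.aestronglyMeasurable hfb hg2 (F := fun s => s ^ 2 / 2 + k * s) (F' := fun s => s + k)
    (fun s => (((hasDerivAt_pow 2 s).div_const 2).fun_add ((hasDerivAt_id s).const_mul k)).congr_deriv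
      (by simp)) (by fun_prop)
  have hqb : LocBdd (fun z => f z ^ 2 / 2 + k * f z) := by
    intro r
    obtain ⟨B, hB⟩ := hfb r
    refine ⟨B ^ 2 / 2 + k * B, hB.mono fun z hz hzr => ?_⟩
    have := hz hzr
    rw [abs_of_nonneg (hf0 z)] at this
    have hf0z := hf0 z
    rw [abs_of_nonneg (by positivity)]
    have h2 := pow_le_pow_left₀ hf0z this 2
    have h3 := mul_le_mul_of_nonneg_left this hk.le
    linarith
  have hqm : Measurable (fun z => f z ^ 2 / 2 + k * f z) := by fun_prop
  have hq2 : LocL2 (fun z => f z ^ 2 / 2 + k * f z) := hqb.locL2 hqm.aestronglyMeasurable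
  have hqg : LocL2 (fun z => (f z + k) • g z) := hg2.smul_bdd (by fun_prop) (by
    intro r
    obtain ⟨B, hB⟩ := hfb r
    refine ⟨B + k, hB.mono fun z hz hzr => ?_⟩
    exact (abs_add_le _ _).trans (add_le_add (hz hzr) (abs_of_pos hk).le))
  have hcq := hq.mul_test hq2 hqg hωt
  have hD := hdiv.cpair h.locL2_drift hcq (ae_of_all _ fun z => mul_nonneg (by have := hf0 z; positivity) (hω0 z)) hT
    (fun z hz => by simp [hωT' z hz])
  have hcf := hfg.mul_test (hfb.locL2 hfm.aestronglyMeasurable) hg2 hωt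
  -- integrability
  obtain ⟨r, hr, hs⟩ := hωt.exists_radius
  have int_inner : ∀ {F P : Z n → E n}, LocL2 F → LocL2 P → (∀ z, z ∉ Metric.closedBall (0 : Z n) r → P z = 0) →
      Integrable (fun z => inner ℝ (F z) (P z)) volume := by
    intro F P hF hP hz
    have := integrable_inner_of_memLp (hF.memLp_indicator r) (hP.memLp_of_supp hz)
    refine this.congr (ae_of_all _ fun z => ?_)
    by_cases hzr : z ∈ Metric.closedBall (0 : Z n) r
    · simp [indicator_of_mem hzr]
    · simp [hz z hzr]
  have hP1 : LocL2 (fun z => ω z • g z + f z • spaceGrad ω z) :=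
    (hg2.smul_continuous hωt.continuous).add ((hfb.locL2 hfm.aestronglyMeasurable).smul_continuous_right hωt.continuous_spaceGrad)
  have hP2 : LocL2 (fun z => ω z • ((f z + k) • g z) + (f z ^ 2 / 2 + k * f z) • spaceGrad ω z) :=
    (hqg.smul_continuous hωt.continuous).add (hq2.smul_continuous_right hωt.continuous_spaceGrad)
  have hf2b : LocBdd (fun z => f z ^ 2) := by
    intro r
    obtain ⟨B, hB⟩ := hfb r
    refine ⟨B ^ 2, hB.mono fun z hz hzr => ?_⟩
    rw [abs_of_nonneg (sq_nonneg _)]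
    exact sq_le_sq' (abs_le.1 (hz hzr)).1 (abs_le.1 (hz hzr)).2
  have hf22 : LocL2 (fun z => f z ^ 2) := hf2b.locL2 (by fun_prop)
  have hcwn : Continuous (fun z : Z n => χ z.2 * ‖gradient χ z.2‖ * η z.1) := by
    have := hχ.continuous; have := hη.continuous
    fun_prop
  have hcwg : Continuous (fun z : Z n => ‖gradient χ z.2‖ ^ 2 * η z.1) := by
    have := hη.continuous
    fun_prop
  -- the supports of the weights
  have hsuppη : ∃ r', ∀ z : Z n, z ∉ Metric.closedBall (0 : Z n) r' → χ z.2 * ‖gradient χ z.2‖ * η z.1 = 0 ∧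
      ‖gradient χ z.2‖ ^ 2 * η z.1 = 0 := by
    obtain ⟨r', -, hr'⟩ := (isTest_prod hχ hχc hη hηc).exists_radius
    refine ⟨r', fun z hz => ?_⟩
    obtain ⟨a, b, -⟩ := hr' z hz
    rw [spaceGrad_prod hχd] at b
    constructor
    · rcases smul_eq_zero.1 b with b | b <;> simp [b]
    · rcases smul_eq_zero.1 b with b | b <;> simp [b]
  obtain ⟨r', hr'⟩ := hsuppη
  have i1 : Integrable (fun z => inner ℝ (G z) (ω z • g z + f z • spaceGrad ω z)) volume :=
    int_inner h.locL2_flux hP1 fun z hz => by simp [(hs z hz).1, (hs z hz).2.1]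
  have i2 : Integrable (fun z => inner ℝ (v z) (ω z • ((f z + k) • g z) + (f z ^ 2 / 2 + k * f z) • spaceGrad ω z)) volume :=
    int_inner h.locL2_drift hP2 fun z hz => by simp [(hs z hz).1, (hs z hz).2.1]
  have i3 : Integrable (fun z => f z ^ 2 * (‖gradient χ z.2‖ ^ 2 * η z.1)) volume :=
    hf22.locallyIntegrable.integrable_smul_right_of_hasCompactSupport hcwg
      (HasCompactSupport.intro (isCompact_closedBall _ _) fun z hz => (hr' z hz).2)
  have i4 : Integrable (fun z => f z ^ 2 * ‖v z‖ * (χ z.2 * ‖gradient χ z.2‖ * η z.1)) volume := by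
    have l1 : LocL2 (fun z => f z ^ 2 • v z) := h.locL2_drift.smul_bdd (by fun_prop) hf2b
    have l2 : LocallyIntegrable (fun z => f z ^ 2 * ‖v z‖) volume := by
      have : LocallyIntegrable (fun z => ‖f z ^ 2 • v z‖) volume := fun x => (l1.locallyIntegrable x).norm
      simpa [norm_smul] using this
    exact l2.integrable_smul_right_of_hasCompactSupport hcwn
      (HasCompactSupport.intro (isCompact_closedBall _ _) fun z hz => (hr' z hz).1)
  have i5 : Integrable (fun z => ‖g z‖ ^ 2 * ω z) volume := by
    have := int_inner hg2 (hg2.smul_continuous hωt.continuous) fun z hz => by simp [(hs z hz).1]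
    refine this.congr (ae_of_all _ fun z => ?_)
    simp only [inner_smul_right, real_inner_self_eq_norm_sq]; ring
  have i6 : Integrable (fun z => inner ℝ (v z) ((f z ^ 2 / 2) • spaceGrad ω z)) volume := by
    refine int_inner h.locL2_drift (LocL2.smul_continuous_right (f := fun z => f z ^ 2 / 2) ?_ hωt.continuous_spaceGrad)
      fun z hz => by simp [(hs z hz).2.1]
    have := hf22.smul_continuous (ω := fun _ => 1 / 2) continuous_const
    have e : (fun z => f z ^ 2 / 2) = fun z => (1 / 2 : ℝ) • f z ^ 2 := by
      funext z; simp; ring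
    rw [e]; exact this
  -- Where `g` does not vanish, `u = f + k`, so `u ∇f` is the gradient of `f² / 2 + k f`. The drift
  -- term is then the divergence inequality tested with `(f² / 2 + k f) ω`, plus a remainder that
  -- contains only the gradient of the weight.
  have split : ∀ z, inner ℝ (G z + u z • v z) (ω z • g z + f z • spaceGrad ω z) =
      inner ℝ (G z) (ω z • g z + f z • spaceGrad ω z) +
      (inner ℝ (v z) (ω z • ((f z + k) • g z) + (f z ^ 2 / 2 + k * f z) • spaceGrad ω z) +
        inner ℝ (v z) ((f z ^ 2 / 2) • spaceGrad ω z)) := by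
    intro z
    rw [inner_add_left, ← inner_add_right (v z)]
    congr 1
    rw [real_inner_smul_left, ← real_inner_smul_right]
    congr 1
    rcases (hf0 z).eq_or_lt with h0 | hpos
    · rw [(hg z).1 h0.symm, ← h0]; simp
    · have hu : u z = f z + k := by have := (excess_pos hpos).2.2; simp only [hf] at this ⊢; linarith
      rw [hu]; module
  have lower : ∀ᵐ z : Z n, d₁ / 2 * (‖g z‖ ^ 2 * ω z) - 2 * d₂ * (f z ^ 2 * (‖gradient χ z.2‖ ^ 2 * η z.1)) ≤
      inner ℝ (G z) (ω z • g z + f z • spaceGrad ω z) := by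
    filter_upwards [hd₁] with z hz
    by_cases hzT : T' ≤ z.1
    · simp [hωT' z hzT, hηT _ hzT, hωg]
    rcases (hf0 z).eq_or_lt with h0 | hpos
    · rw [(hg z).1 h0.symm, ← h0]; simp
    · obtain ⟨ha, hb⟩ := hz (by linarith [not_le.1 hzT]) hpos
      rw [(hg z).2 hpos, hωg]
      set d := m * u z ^ (m - 1)
      simp only [inner_add_right, real_inner_smul_left, real_inner_smul_right, real_inner_self_eq_norm_sq]
      have hcs := abs_real_inner_le_norm (g z) (gradient χ z.2)
      set I := inner ℝ (g z) (gradient χ z.2)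
      have hIb : - (‖g z‖ * ‖gradient χ z.2‖) ≤ I := (abs_le.1 hcs).1
      have hη0z := hη0 z.1
      have hχ0z := hχ0 z.2
      have hd0' : 0 ≤ d := hd0.trans ha
      have hfz := hf0 z
      set a := ‖g z‖
      set b := ‖gradient χ z.2‖
      -- Young's inequality in the form `(χ a - 2 f b)² ≥ 0` absorbs the cross term at the price of
      -- half of the dissipation.
      have key : d / 2 * (a ^ 2 * ω z) - 2 * d * (f z ^ 2 * (b ^ 2 * η z.1)) ≤
          d * (ω z * a ^ 2) + d * (f z * (2 * χ z.2 * η z.1 * I)) := by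
        have e1 : d * (f z * (2 * χ z.2 * η z.1 * (-(a * b)))) ≤ d * (f z * (2 * χ z.2 * η z.1 * I)) := by
          gcongr
        have e2 : 0 ≤ d / 2 * η z.1 * (χ z.2 * a - 2 * f z * b) ^ 2 := by positivity
        simp only [hω]
        nlinarith [e1, e2]
      have e3 : d₁ / 2 * (a ^ 2 * ω z) ≤ d / 2 * (a ^ 2 * ω z) := by
        have := hω0 z; gcongr
      have e4 : 2 * d * (f z ^ 2 * (b ^ 2 * η z.1)) ≤ 2 * d₂ * (f z ^ 2 * (b ^ 2 * η z.1)) := by gcongr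
      have e5 : d * (ω z * a ^ 2) + d * (f z * (2 * χ z.2 * η z.1 * I)) =
          ω z * (d * a ^ 2) + f z * (2 * χ z.2 * η z.1 * (d * I)) := by ring
      linarith
  have l1 := integral_mono_ae ((i5.const_mul (d₁ / 2)).sub (i3.const_mul (2 * d₂))) i1 lower
  have l1' : d₁ / 2 * (∫ z, ‖g z‖ ^ 2 * ω z) - 2 * d₂ * ∫ z : Z n, f z ^ 2 * (‖gradient χ z.2‖ ^ 2 * η z.1) ≤
      ∫ z, inner ℝ (G z) (ω z • g z + f z • spaceGrad ω z) := by
    refine le_trans (le_of_eq ?_) l1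
    rw [← integral_const_mul, ← integral_const_mul]
    exact (integral_sub (i5.const_mul (d₁ / 2)) (i3.const_mul (2 * d₂))).symm
  have l2 : - ∫ z, f z ^ 2 * ‖v z‖ * (χ z.2 * ‖gradient χ z.2‖ * η z.1) ≤
      ∫ z, inner ℝ (v z) ((f z ^ 2 / 2) • spaceGrad ω z) := by
    rw [← integral_neg]
    refine integral_mono_ae i4.neg i6 (ae_of_all _ fun z => ?_)
    simp only [hωg, inner_smul_right]
    have hcs := (abs_le.1 (abs_real_inner_le_norm (v z) (gradient χ z.2))).1
    have hη0z := hη0 z.1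
    have hχ0z := hχ0 z.2
    have : 0 ≤ f z ^ 2 / 2 * (2 * χ z.2 * η z.1) := by positivity
    nlinarith [mul_le_mul_of_nonneg_left hcs this]
  simp_rw [split] at hE
  have hsum := (integral_add i1 (i2.add i6)).trans (congrArg _ (integral_add i2 i6))
  have hE' := hsum.symm.le.trans hE
  clear hE
  simp_rw [hωd] at hE'
  linarith

end DriftDiffusion

/-! ### Removal of the spatial cutoff and decay of the energy above a level -/

/-- Spatial cutoff functions, equal to one on the ball of radius `N + 1`. -/
noncomputable def cutoff (n N : ℕ) (x : E n) : ℝ :=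
  (⟨1, 2, zero_lt_one, one_lt_two⟩ : ContDiffBump (0 : E n)) (((N : ℝ) + 1)⁻¹ • x)

theorem cutoff_contDiff (N : ℕ) : ContDiff ℝ ((⊤ : ℕ∞) : WithTop ℕ∞) (cutoff n N) :=
  (ContDiffBump.contDiff _).comp (contDiff_const_smul _)

theorem cutoff_nonneg (N : ℕ) (x : E n) : 0 ≤ cutoff n N x := ContDiffBump.nonneg _

theorem cutoff_le_one (N : ℕ) (x : E n) : cutoff n N x ≤ 1 := ContDiffBump.le_one _

theorem cutoff_eq_one {N : ℕ} {x : E n} (hx : ‖x‖ ≤ (N : ℝ) + 1) : cutoff n N x = 1 := by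
  refine ContDiffBump.one_of_mem_closedBall _ ?_
  rw [mem_closedBall_zero_iff, norm_smul, norm_inv, Real.norm_of_nonneg (by positivity)]
  rw [inv_mul_le_iff₀ (by positivity)]; simpa using hx

theorem cutoff_eq_zero {N : ℕ} {x : E n} (hx : 2 * ((N : ℝ) + 1) ≤ ‖x‖) : cutoff n N x = 0 := by
  refine ContDiffBump.zero_of_le_dist _ ?_
  rw [dist_zero_right, norm_smul, norm_inv, Real.norm_of_nonneg (by positivity)]
  rw [le_inv_mul_iff₀ (by positivity)]; simp only []; linarith

theorem cutoff_hasCompactSupport (N : ℕ) : HasCompactSupport (cutoff n N) := by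
  refine HasCompactSupport.intro (isCompact_closedBall 0 (2 * ((N : ℝ) + 1))) fun x hx => cutoff_eq_zero ?_
  rw [mem_closedBall_zero_iff, not_le] at hx
  exact hx.le

theorem tendsto_cutoff (x : E n) : Tendsto (fun N => cutoff n N x) atTop (𝓝 1) := by
  obtain ⟨N, hN⟩ := exists_nat_ge ‖x‖
  refine tendsto_const_nhds.congr' ?_
  filter_upwards [eventually_ge_atTop N] with M hM
  have : (N : ℝ) ≤ M := by exact_mod_cast hM
  exact (cutoff_eq_one (by linarith)).symm

theorem gradient_cutoff_eq_zero {N : ℕ} {x : E n} (hx : 2 * ((N : ℝ) + 1) < ‖x‖) :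
    gradient (cutoff n N) x = 0 := by
  have : cutoff n N =ᶠ[𝓝 x] fun _ => 0 := by
    filter_upwards [(isOpen_lt continuous_const continuous_norm).mem_nhds hx] with y hy
    exact cutoff_eq_zero (le_of_lt hy)
  unfold gradient
  rw [this.fderiv_eq]; simp

/-- Uniform bounds on the gradients of the cutoffs. -/
theorem exists_gradient_cutoff_bound (n : ℕ) : ∃ C : ℝ, 0 ≤ C ∧ ∀ (N : ℕ) (x : E n),
    ‖gradient (cutoff n N) x‖ ≤ C / ((N : ℝ) + 1) ∧ ‖gradient (cutoff n N) x‖ * (1 + ‖x‖) ≤ C := by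
  let b : ContDiffBump (0 : E n) := ⟨1, 2, zero_lt_one, one_lt_two⟩
  have hbc : ContDiff ℝ ((⊤ : ℕ∞) : WithTop ℕ∞) (b : E n → ℝ) := b.contDiff
  obtain ⟨C, hC⟩ := (b.hasCompactSupport.fderiv (𝕜 := ℝ)).exists_bound_of_continuous
    (hbc.continuous_fderiv (by simp))
  have hC0 : 0 ≤ C := (norm_nonneg _).trans (hC 0)
  have h1 : ∀ (N : ℕ) (x : E n), ‖gradient (cutoff n N) x‖ ≤ C / ((N : ℝ) + 1) := by
    intro N x
    have hd : HasFDerivAt (cutoff n N) ((fderiv ℝ b (((N : ℝ) + 1)⁻¹ • x)).comp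
        (((N : ℝ) + 1)⁻¹ • ContinuousLinearMap.id ℝ (E n))) x :=
      HasFDerivAt.comp x ((hbc.differentiable (by simp) _).hasFDerivAt)
        ((((N : ℝ) + 1)⁻¹ • ContinuousLinearMap.id ℝ (E n)).hasFDerivAt)
    unfold gradient
    rw [LinearIsometryEquiv.norm_map, hd.fderiv, ContinuousLinearMap.comp_smul, norm_smul, norm_inv,
      Real.norm_of_nonneg (by positivity), ContinuousLinearMap.comp_id, div_eq_inv_mul]
    exact mul_le_mul_of_nonneg_left (hC _) (by positivity)
  refine ⟨C * 3, by positivity, fun N x => ⟨(h1 N x).trans ?_, ?_⟩⟩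
  · gcongr; linarith
  · by_cases hx : 2 * ((N : ℝ) + 1) < ‖x‖
    · rw [gradient_cutoff_eq_zero hx]; simp; positivity
    · have hN : (0 : ℝ) < (N : ℝ) + 1 := by positivity
      calc _ ≤ C / ((N : ℝ) + 1) * (1 + ‖x‖) := by gcongr; exact h1 N x
        _ ≤ C / ((N : ℝ) + 1) * (3 * ((N : ℝ) + 1)) := by
            gcongr
            linarith [not_lt.1 hx, Nat.cast_nonneg (α := ℝ) N]
        _ = _ := by field_simp

theorem continuous_gradient_cutoff (N : ℕ) : Continuous (gradient (cutoff n N)) :=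
  (InnerProductSpace.toDual ℝ (E n)).symm.continuous.comp ((cutoff_contDiff N).continuous_fderiv (by simp))

/-- Dominated convergence for bounded weights supported in `{t < T}`. -/
theorem tendsto_integral_weight {F : Z n → ℝ} {T : ℝ} (hF : IntegrableOn F {z : Z n | z.1 < T} volume)
    {a : ℕ → Z n → ℝ} {a₀ : Z n → ℝ} {B : ℝ} (ha : ∀ N, Continuous (a N)) (hb : ∀ N z, |a N z| ≤ B)
    (h0 : ∀ N z, T ≤ z.1 → a N z = 0) (hlim : ∀ z, Tendsto (fun N => a N z) atTop (𝓝 (a₀ z))) :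
    Tendsto (fun N => ∫ z, F z * a N z) atTop (𝓝 (∫ z, F z * a₀ z)) := by
  have hS : MeasurableSet {z : Z n | z.1 < T} := measurableSet_lt measurable_fst measurable_const
  have hz : ∀ z : Z n, z ∉ {z : Z n | z.1 < T} → a₀ z = 0 := fun z hz =>
    tendsto_nhds_unique (hlim z) (by simp [h0 _ z (not_lt.1 hz)])
  have e1 : ∀ N, ∫ z, F z * a N z = ∫ z in {z : Z n | z.1 < T}, F z * a N z := fun N =>
    (setIntegral_eq_integral_of_forall_compl_eq_zero fun z hz => by simp [h0 N z (not_lt.1 hz)]).symm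
  have e2 : ∫ z, F z * a₀ z = ∫ z in {z : Z n | z.1 < T}, F z * a₀ z :=
    (setIntegral_eq_integral_of_forall_compl_eq_zero fun z hz' => by simp [hz z hz']).symm
  simp_rw [e1, e2]
  refine tendsto_integral_of_dominated_convergence (fun z => B * |F z|)
    (fun N => hF.1.mul (ha N).aestronglyMeasurable) (hF.abs.const_mul B) ?_ ?_
  · intro N
    refine ae_of_all _ fun z => ?_
    rw [norm_mul, mul_comm]
    exact mul_le_mul_of_nonneg_right (hb N z) (norm_nonneg _)
  · exact ae_of_all _ fun z => (hlim z).const_mul _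

namespace DriftDiffusion
variable {m : ℝ} {u : Z n → ℝ} {G v : Z n → E n}

/-- The localized estimate after inserting the Faber–Krahn inequality. -/
theorem localized_decay (h : DriftDiffusion m u G v) (hn : 2 ≤ n) {k T T' Λ d₁ d₂ c : ℝ} (hk : 0 < k)
    (hT : T' < T) (hdiv : DivLE v Λ T)
    {g : Z n → E n} (hg2 : LocL2 g) (hfg : WeakGrad (excess u k) g)
    (hg : ∀ z, (excess u k z = 0 → g z = 0) ∧ (0 < excess u k z → G z = (m * u z ^ (m - 1)) • g z))
    (hu0 : ∀ᵐ z : Z n, z.1 ≤ 0 → u z ≤ k)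
    (hd₁ : ∀ᵐ z : Z n, z.1 < T → 0 < excess u k z → d₁ ≤ m * u z ^ (m - 1) ∧ m * u z ^ (m - 1) ≤ d₂)
    (hd0 : 0 ≤ d₁) (hc : 0 < c) {s : ℝ≥0}
    (hs : ∀ᵐ t : ℝ, t < T → volume {x : E n | 0 < excess u k (t, x)} ≤ s)
    (hsc : sobolevConst n * (s : ℝ) ^ (1 / (n : ℝ)) ≤ c)
    {χ : E n → ℝ} {η : ℝ → ℝ} (hχ : ContDiff ℝ ((⊤ : ℕ∞) : WithTop ℕ∞) χ) (hχc : HasCompactSupport χ)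
    (hχ0 : ∀ x, 0 ≤ χ x)
    (hη : ContDiff ℝ ((⊤ : ℕ∞) : WithTop ℕ∞) η) (hηc : HasCompactSupport η) (hη0 : ∀ t, 0 ≤ η t)
    (hηT : ∀ t, T' ≤ t → η t = 0) :
    d₁ / (8 * c ^ 2) * ∫ z : Z n, excess u k z ^ 2 * (χ z.2 ^ 2 * η z.1)
      ≤ (∫ z : Z n, excess u k z ^ 2 / 2 * (χ z.2 ^ 2 * deriv η z.1))
        + Λ * (∫ z : Z n, (excess u k z ^ 2 / 2 + k * excess u k z) * (χ z.2 ^ 2 * η z.1))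
        + 2 * d₂ * (∫ z : Z n, excess u k z ^ 2 * (‖gradient χ z.2‖ ^ 2 * η z.1))
        + (∫ z : Z n, excess u k z ^ 2 * ‖v z‖ * (χ z.2 * ‖gradient χ z.2‖ * η z.1))
        + d₁ / (2 * c) * ∫ z : Z n, excess u k z ^ 2 * (χ z.2 * ‖gradient χ z.2‖ * η z.1) := by
  have hE := h.localized_energy hk hT hdiv hg2 hfg hg hu0 hd₁ hd0 hχ hχc hχ0 hη hηc hη0 hηT
  set f := excess u k with hf
  have hfm : Measurable f := measurable_excess h.measurable
  have hfb : LocBdd f := locBdd_excess h.nonneg h.locBdd hk.le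
  have hf0 : ∀ z, 0 ≤ f z := excess_nonneg
  have hχ2 : ContDiff ℝ ((⊤ : ℕ∞) : WithTop ℕ∞) (fun x => χ x ^ 2) := hχ.pow 2
  have hχ2c : HasCompactSupport (fun x => χ x ^ 2) := by
    simp_rw [sq]; exact hχc.mul_left
  set ω : Z n → ℝ := fun z => χ z.2 ^ 2 * η z.1 with hω
  have hωt : IsTest ω := isTest_prod hχ2 hχ2c hη hηc
  have hω0 : ∀ z, 0 ≤ ω z := fun z => mul_nonneg (sq_nonneg _) (hη0 _)
  have hωT' : ∀ z, T' ≤ z.1 → ω z = 0 := fun z hz => by simp [hω, hηT _ hz]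
  have hχd : Differentiable ℝ χ := hχ.differentiable (by simp)
  have hωg : ∀ z, spaceGrad ω z = (2 * χ z.2 * η z.1) • gradient χ z.2 := by
    intro z
    rw [hω, spaceGrad_prod (hχ2.differentiable (by simp)), gradient_sq hχd, smul_smul]
    congr 1; ring
  have hf2b : LocBdd (fun z => f z ^ 2) := by
    intro r
    obtain ⟨B, hB⟩ := hfb r
    refine ⟨B ^ 2, hB.mono fun z hz hzr => ?_⟩
    rw [abs_of_nonneg (sq_nonneg _)]
    exact sq_le_sq' (abs_le.1 (hz hzr)).1 (abs_le.1 (hz hzr)).2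
  have hf22 : LocL2 (fun z => f z ^ 2) := hf2b.locL2 (by fun_prop)
  have hfg2 : LocL2 (fun z => (2 * f z) • g z) := hg2.smul_bdd (by fun_prop) (by
    intro r
    obtain ⟨B, hB⟩ := hfb r
    refine ⟨2 * B, hB.mono fun z hz hzr => ?_⟩
    rw [abs_mul, abs_two]
    exact mul_le_mul_of_nonneg_left (hz hzr) zero_le_two)
  -- The Faber–Krahn inequality is of `L¹` type. It is applied to `f² ω`, whose gradient contains
  -- the product `f g` that Young's inequality can split.
  have hsq := hfg.comp hfm.aestronglyMeasurable hfb hg2 (F := fun s => s ^ 2) (F' := fun s => 2 * s)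
    (fun s => by simpa using hasDerivAt_pow 2 s) (by fun_prop)
  have hcp := hsq.mul_test hf22 hfg2 hωt
  have hS : MeasurableSet {z : Z n | z.1 < T ∧ 0 < f z} :=
    (measurableSet_lt measurable_fst measurable_const).inter (measurableSet_lt measurable_const hfm)
  have hFK := hcp.faberKrahn hn hS s (by
    filter_upwards [hs] with t ht
    by_cases htT : t < T
    · refine (measure_mono fun x hx => ?_).trans (ht htT)
      exact hx.2
    · simp [htT])
  have e1 : ∫ z in {z : Z n | z.1 < T ∧ 0 < f z}, |f z ^ 2 * ω z| = ∫ z, f z ^ 2 * ω z := by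
    rw [setIntegral_eq_integral_of_forall_compl_eq_zero]
    · refine integral_congr_ae (ae_of_all _ fun z => ?_)
      exact abs_of_nonneg (mul_nonneg (sq_nonneg _) (hω0 z))
    · intro z hz
      simp only [mem_ofPred_eq, not_and_or, not_lt] at hz
      rcases hz with hz | hz
      · rw [hωT' z (by linarith)]; simp
      · rw [le_antisymm hz (hf0 z)]; simp
  rw [e1] at hFK
  have i0 : Integrable (fun z => f z ^ 2 * ω z) volume := hωt.smul_test_integrable hf22.locallyIntegrable
  have i5 : Integrable (fun z => ‖g z‖ ^ 2 * ω z) volume := by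
    obtain ⟨r, hr, hs⟩ := hωt.exists_radius
    have := integrable_inner_of_memLp (hg2.memLp_indicator r)
      ((hg2.smul_continuous hωt.continuous).memLp_of_supp (r := r) fun z hz => by simp [(hs z hz).1])
    refine this.congr (ae_of_all _ fun z => ?_)
    by_cases hzr : z ∈ Metric.closedBall (0 : Z n) r
    · simp only [indicator_of_mem hzr, inner_smul_right, real_inner_self_eq_norm_sq]; ring
    · simp [(hs z hzr).1]
  have hcwn : Continuous (fun z : Z n => χ z.2 * ‖gradient χ z.2‖ * η z.1) := by
    have hgχc : Continuous (gradient χ) :=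
      (InnerProductSpace.toDual ℝ (E n)).symm.continuous.comp (hχ.continuous_fderiv (by simp))
    have := hχ.continuous; have := hη.continuous
    fun_prop
  have i6 : Integrable (fun z => f z ^ 2 * (χ z.2 * ‖gradient χ z.2‖ * η z.1)) volume := by
    obtain ⟨r', -, hr'⟩ := (isTest_prod hχ hχc hη hηc).exists_radius
    refine hf22.locallyIntegrable.integrable_smul_right_of_hasCompactSupport hcwn
      (HasCompactSupport.intro (isCompact_closedBall (0 : Z n) r') fun z hz => ?_)
    have := (hr' z hz).2.1
    rw [spaceGrad_prod hχd] at this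
    rcases smul_eq_zero.1 this with b | b <;> simp [b]
  -- From `(f - 2 c |g|)² ≥ 0`: the coefficient `1/2` in front of `f² ω` lets that term be absorbed
  -- on the left, which yields `A ≤ 4 c² D + 4 c R` below.
  have hpt : ∀ z, c * ‖ω z • ((2 * f z) • g z) + f z ^ 2 • spaceGrad ω z‖ ≤
      1 / 2 * (f z ^ 2 * ω z) + (2 * c ^ 2) * (‖g z‖ ^ 2 * ω z) + 2 * c * (f z ^ 2 * (χ z.2 * ‖gradient χ z.2‖ * η z.1)) := by
    intro z
    have h1 : ‖ω z • ((2 * f z) • g z) + f z ^ 2 • spaceGrad ω z‖ ≤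
        ω z * (2 * f z * ‖g z‖) + f z ^ 2 * (2 * χ z.2 * η z.1 * ‖gradient χ z.2‖) := by
      refine (norm_add_le _ _).trans (le_of_eq ?_)
      rw [hωg, norm_smul, norm_smul, norm_smul, norm_smul, Real.norm_of_nonneg (hω0 z),
        Real.norm_of_nonneg (by have := hf0 z; positivity), Real.norm_of_nonneg (sq_nonneg _),
        Real.norm_of_nonneg (by have := hχ0 z.2; have := hη0 z.1; positivity)]
    have h2 := mul_le_mul_of_nonneg_left h1 hc.le
    have h3 : 0 ≤ ω z * (f z - 2 * c * ‖g z‖) ^ 2 := mul_nonneg (hω0 z) (sq_nonneg _)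
    nlinarith [h2, h3]
  have hint : c * ∫ z, ‖ω z • ((2 * f z) • g z) + f z ^ 2 • spaceGrad ω z‖ ≤
      1 / 2 * (∫ z, f z ^ 2 * ω z) + (2 * c ^ 2) * (∫ z, ‖g z‖ ^ 2 * ω z) +
        2 * c * ∫ z : Z n, f z ^ 2 * (χ z.2 * ‖gradient χ z.2‖ * η z.1) := by
    rw [← integral_const_mul, ← integral_const_mul, ← integral_const_mul, ← integral_const_mul]
    refine (integral_mono (hcp.integrable_grad.norm.const_mul c)
      (((i0.const_mul _).add (i5.const_mul _)).add (i6.const_mul _)) hpt).trans (le_of_eq ?_)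
    exact (integral_add ((i0.const_mul _).add (i5.const_mul _)) (i6.const_mul _)).trans
      (congrArg (· + _) (integral_add (i0.const_mul _) (i5.const_mul _)))
  have hFK2 := hFK.trans (mul_le_mul_of_nonneg_right hsc (integral_nonneg fun z => norm_nonneg _))
  have h4 := hFK2.trans hint
  set A := ∫ z, f z ^ 2 * ω z
  set D := ∫ z, ‖g z‖ ^ 2 * ω z
  set R := ∫ z : Z n, f z ^ 2 * (χ z.2 * ‖gradient χ z.2‖ * η z.1)
  have h5 : d₁ / (8 * c ^ 2) * A ≤ d₁ / 2 * D + d₁ / (2 * c) * R := by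
    have h6 : A ≤ 4 * c ^ 2 * D + 4 * c * R := by linarith
    have h7 : 0 ≤ d₁ / (8 * c ^ 2) := by positivity
    refine (mul_le_mul_of_nonneg_left h6 h7).trans (le_of_eq ?_)
    field_simp
    ring
  linarith

/-- The decay estimate without cutoff in space. -/
theorem decay (h : DriftDiffusion m u G v) (hn : 2 ≤ n) (hm : 0 < m) {k T T' Λ d₁ d₂ c : ℝ} (hk : 0 < k)
    (hT : T' < T) (hdiv : DivLE v Λ T)
    (hu0 : ∀ᵐ z : Z n, z.1 ≤ 0 → u z ≤ k)
    (hd₁ : ∀ᵐ z : Z n, z.1 < T → 0 < excess u k z → d₁ ≤ m * u z ^ (m - 1) ∧ m * u z ^ (m - 1) ≤ d₂)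
    (hd0 : 0 ≤ d₁) (hc : 0 < c) {s : ℝ≥0}
    (hs : ∀ᵐ t : ℝ, t < T → volume {x : E n | 0 < excess u k (t, x)} ≤ s)
    (hsc : sobolevConst n * (s : ℝ) ^ (1 / (n : ℝ)) ≤ c)
    (i1 : IntegrableOn (excess u k) {z : Z n | z.1 < T} volume)
    (i2 : IntegrableOn (fun z => excess u k z ^ 2) {z : Z n | z.1 < T} volume)
    (i3 : IntegrableOn (fun z => excess u k z ^ 2 * ‖v z‖ / (1 + ‖z.2‖)) {z : Z n | z.1 < T} volume)
    {η : ℝ → ℝ}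
    (hη : ContDiff ℝ ((⊤ : ℕ∞) : WithTop ℕ∞) η) (hηc : HasCompactSupport η) (hη0 : ∀ t, 0 ≤ η t)
    (hηT : ∀ t, T' ≤ t → η t = 0) :
    d₁ / (8 * c ^ 2) * ∫ z : Z n, excess u k z ^ 2 * η z.1
      ≤ (∫ z : Z n, excess u k z ^ 2 / 2 * deriv η z.1)
        + Λ * (∫ z : Z n, (excess u k z ^ 2 / 2 + k * excess u k z) * η z.1) := by
  obtain ⟨g, hg2, hfg, hg⟩ := h.exists_excess_grad hm hk
  -- The estimate is used along expanding cutoffs. The weights `χ²` tend to one and every term with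
  -- a gradient of the cutoff tends to zero.
  have hN := fun N => h.localized_decay hn hk hT hdiv hg2 hfg hg hu0 hd₁ hd0 hc hs hsc
    (cutoff_contDiff N) (cutoff_hasCompactSupport N) (cutoff_nonneg N) hη hηc hη0 hηT
  obtain ⟨C, hC0, hC⟩ := exists_gradient_cutoff_bound n
  obtain ⟨B, hB⟩ := hηc.exists_bound_of_continuous hη.continuous
  obtain ⟨B', hB'⟩ := hηc.deriv.exists_bound_of_continuous (hη.continuous_deriv (by simp))
  have hB0 : 0 ≤ B := (norm_nonneg _).trans (hB 0)
  have hB'0 : 0 ≤ B' := (norm_nonneg _).trans (hB' 0)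
  have hηd : ∀ t, T ≤ t → deriv η t = 0 := by
    intro t ht
    have : η =ᶠ[𝓝 t] fun _ => 0 := by
      filter_upwards [Ioi_mem_nhds (hT.trans_le ht)] with r hr using hηT r (le_of_lt hr)
    rw [this.deriv_eq]; simp
  have hηT2 : ∀ t, T ≤ t → η t = 0 := fun t ht => hηT t (hT.le.trans ht)
  have hgc := fun N => continuous_gradient_cutoff (n := n) N
  have hcc := fun N => (cutoff_contDiff (n := n) N).continuous
  have hηcont := hη.continuous
  have hdcont : Continuous (deriv η) := hη.continuous_deriv (by simp)
  have hsq1 : ∀ N (x : E n), cutoff n N x ^ 2 ≤ 1 := fun N x =>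
    pow_le_one₀ (cutoff_nonneg N x) (cutoff_le_one N x)
  have hgrad0 : ∀ x : E n, Tendsto (fun N => ‖gradient (cutoff n N) x‖) atTop (𝓝 0) := by
    intro x
    have h1 : Tendsto (fun N : ℕ => C / ((N : ℝ) + 1)) atTop (𝓝 0) := by
      have := (tendsto_one_div_add_atTop_nhds_zero_nat (𝕜 := ℝ)).const_mul C
      simpa [div_eq_mul_inv] using this
    exact squeeze_zero (fun _ => norm_nonneg _) (fun N => (hC N x).1) h1
  have hgC : ∀ N (x : E n), ‖gradient (cutoff n N) x‖ ≤ C := by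
    intro N x
    refine (le_mul_of_one_le_right (norm_nonneg _) ?_).trans (hC N x).2
    linarith [norm_nonneg x]
  have t1 := tendsto_integral_weight i2 (a := fun N z => cutoff n N z.2 ^ 2 * η z.1) (a₀ := fun z => η z.1) (B := B)
    (fun N => by have := hcc N; fun_prop) (fun N z => by
      rw [abs_mul, abs_of_nonneg (sq_nonneg _)]
      exact (mul_le_of_le_one_left (abs_nonneg _) (hsq1 N _)).trans (hB _))
    (fun N z hz => by simp [hηT2 _ hz]) (fun z => by simpa using ((tendsto_cutoff z.2).pow 2).mul_const (η z.1))
  have i2' : IntegrableOn (fun z => excess u k z ^ 2 / 2) {z : Z n | z.1 < T} volume := i2.div_const 2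
  have t2 := tendsto_integral_weight i2' (a := fun N z => cutoff n N z.2 ^ 2 * deriv η z.1)
    (a₀ := fun z => deriv η z.1) (B := B')
    (fun N => by have := hcc N; fun_prop) (fun N z => by
      rw [abs_mul, abs_of_nonneg (sq_nonneg _)]
      exact (mul_le_of_le_one_left (abs_nonneg _) (hsq1 N _)).trans (hB' _))
    (fun N z hz => by simp [hηd _ hz]) (fun z => by simpa using ((tendsto_cutoff z.2).pow 2).mul_const (deriv η z.1))
  have i4 : IntegrableOn (fun z => excess u k z ^ 2 / 2 + k * excess u k z) {z : Z n | z.1 < T} volume :=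
    i2'.add (i1.const_mul k)
  have t3 := tendsto_integral_weight i4 (a := fun N z => cutoff n N z.2 ^ 2 * η z.1) (a₀ := fun z => η z.1) (B := B)
    (fun N => by have := hcc N; fun_prop) (fun N z => by
      rw [abs_mul, abs_of_nonneg (sq_nonneg _)]
      exact (mul_le_of_le_one_left (abs_nonneg _) (hsq1 N _)).trans (hB _))
    (fun N z hz => by simp [hηT2 _ hz]) (fun z => by simpa using ((tendsto_cutoff z.2).pow 2).mul_const (η z.1))
  have t4 := tendsto_integral_weight i2 (a := fun N z => ‖gradient (cutoff n N) z.2‖ ^ 2 * η z.1)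
    (a₀ := fun _ => 0) (B := C ^ 2 * B)
    (fun N => by have := hgc N; fun_prop) (fun N z => by
      rw [abs_mul, abs_of_nonneg (sq_nonneg _)]
      exact mul_le_mul (pow_le_pow_left₀ (norm_nonneg _) (hgC _ _) 2) (hB _) (abs_nonneg _) (sq_nonneg _))
    (fun N z hz => by simp [hηT2 _ hz]) (fun z => by simpa using ((hgrad0 z.2).pow 2).mul_const (η z.1))
  have t5 := tendsto_integral_weight i2 (a := fun N z => cutoff n N z.2 * ‖gradient (cutoff n N) z.2‖ * η z.1)
    (a₀ := fun _ => 0) (B := C * B)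
    (fun N => by have := hgc N; have := hcc N; fun_prop) (fun N z => by
      rw [abs_mul, abs_mul, abs_of_nonneg (norm_nonneg _), abs_of_nonneg (cutoff_nonneg _ _)]
      refine mul_le_mul ?_ (hB _) (abs_nonneg _) hC0
      exact (mul_le_of_le_one_left (norm_nonneg _) (cutoff_le_one _ _)).trans (hgC _ _))
    (fun N z hz => by simp [hηT2 _ hz])
    (fun z => by simpa using ((tendsto_cutoff z.2).mul (hgrad0 z.2)).mul_const (η z.1))
  -- The delicate term: the growth of the drift is paid for by `1 + |x|`, since `|∇χ_N| (1 + |x|)`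
  -- stays bounded and tends to zero pointwise.
  have t6 := tendsto_integral_weight i3
    (a := fun N z => cutoff n N z.2 * (‖gradient (cutoff n N) z.2‖ * (1 + ‖z.2‖)) * η z.1)
    (a₀ := fun _ => 0) (B := C * B)
    (fun N => by have := hgc N; have := hcc N; fun_prop) (fun N z => by
      rw [abs_mul, abs_mul, abs_of_nonneg (by positivity : 0 ≤ ‖gradient (cutoff n N) z.2‖ * (1 + ‖z.2‖)),
        abs_of_nonneg (cutoff_nonneg _ _)]
      refine mul_le_mul ?_ (hB _) (abs_nonneg _) hC0
      exact (mul_le_of_le_one_left (by positivity) (cutoff_le_one _ _)).trans (hC _ _).2)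
    (fun N z hz => by simp [hηT2 _ hz])
    (fun z => by simpa using ((tendsto_cutoff z.2).mul ((hgrad0 z.2).mul_const (1 + ‖z.2‖))).mul_const (η z.1))
  have e6 : ∀ N, ∫ z : Z n, excess u k z ^ 2 * ‖v z‖ / (1 + ‖z.2‖) * (cutoff n N z.2 * (‖gradient (cutoff n N) z.2‖ * (1 + ‖z.2‖)) * η z.1)
      = ∫ z : Z n, excess u k z ^ 2 * ‖v z‖ * (cutoff n N z.2 * ‖gradient (cutoff n N) z.2‖ * η z.1) := by
    intro N
    refine integral_congr_ae (ae_of_all _ fun z => ?_)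
    have : 1 + ‖z.2‖ ≠ 0 := by positivity
    field_simp
  simp_rw [e6] at t6
  simp only [mul_zero, integral_zero] at t4 t5 t6
  have tR := (((t2.add (t3.const_mul Λ)).add (t4.const_mul (2 * d₂))).add t6).add (t5.const_mul (d₁ / (2 * c)))
  have := le_of_tendsto_of_tendsto' (t1.const_mul (d₁ / (8 * c ^ 2))) tR hN
  simpa using this

/-- Bound on the `L²` norm of the excess above a level, uniformly in time. -/
theorem level_bound (h : DriftDiffusion m u G v) (hn : 2 ≤ n) (hm : 0 < m) {k T Λ d₁ d₂ c Q : ℝ} (hk : 0 < k)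
    (hdiv : DivLE v Λ T) (hΛ : 0 ≤ Λ) (hQ0 : 0 ≤ Q)
    (hu0 : ∀ᵐ z : Z n, z.1 ≤ 0 → u z ≤ k)
    (hd₁ : ∀ᵐ z : Z n, z.1 < T → 0 < excess u k z → d₁ ≤ m * u z ^ (m - 1) ∧ m * u z ^ (m - 1) ≤ d₂)
    (hd0 : 0 < d₁) (hc : 0 < c) {s : ℝ≥0}
    (hs : ∀ᵐ t : ℝ, t < T → volume {x : E n | 0 < excess u k (t, x)} ≤ s)
    (hsc : sobolevConst n * (s : ℝ) ^ (1 / (n : ℝ)) ≤ c)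
    (i1 : IntegrableOn (excess u k) {z : Z n | z.1 < T} volume)
    (i2 : IntegrableOn (fun z => excess u k z ^ 2) {z : Z n | z.1 < T} volume)
    (i3 : IntegrableOn (fun z => excess u k z ^ 2 * ‖v z‖ / (1 + ‖z.2‖)) {z : Z n | z.1 < T} volume)
    (hQ : ∀ᵐ t : ℝ, t < T → ∫ x, (excess u k (t, x) ^ 2 / 2 + k * excess u k (t, x)) ≤ Q) :
    ∀ᵐ t : ℝ, t < T → ∫ x, excess u k (t, x) ^ 2 ≤ 8 * c ^ 2 * Λ * Q / d₁ := by
  -- The estimate reads `y' ≤ -(d₁ / (4 c²)) y + 2 Λ Q`; `B` is the equilibrium of this inequality,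
  -- whence a bound without dependence on time.
  set B := 8 * c ^ 2 * Λ * Q / d₁ with hB
  have hB0 : 0 ≤ B := by positivity
  -- `decay` requires weights that vanish from some `T' < T` on; the full interval is exhausted by
  -- countably many such `T'`.
  suffices H : ∀ T', T' < T → ∀ᵐ t : ℝ, t < T' → ∫ x, excess u k (t, x) ^ 2 ≤ B by
    have : ∀ᵐ t : ℝ, ∀ j : ℕ, t < T - 1 / ((j : ℝ) + 1) → ∫ x, excess u k (t, x) ^ 2 ≤ B :=
      ae_all_iff.2 fun j => H _ (by
        have : (0:ℝ) < 1 / ((j : ℝ) + 1) := by positivity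
        linarith)
    filter_upwards [this] with t ht htT
    obtain ⟨j, hj⟩ := exists_nat_one_div_lt (sub_pos.2 htT)
    exact ht j (by linarith)
  intro T' hT
  have hS : MeasurableSet {z : Z n | z.1 < T} := measurableSet_lt measurable_fst measurable_const
  have fub : ∀ (F : Z n → ℝ), IntegrableOn F {z : Z n | z.1 < T} volume →
      (Integrable (fun t : ℝ => if t < T then ∫ x, F (t, x) else 0) volume) ∧
      ∀ η : ℝ → ℝ, Continuous η → (∃ C, ∀ t, ‖η t‖ ≤ C) → (∀ t, T ≤ t → η t = 0) →
        ∫ z : Z n, F z * η z.1 = ∫ t, (if t < T then ∫ x, F (t, x) else 0) * η t := by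
    intro F hF
    have hI := (integrable_indicator_iff hS).2 hF
    rw [Measure.volume_eq_prod] at hI
    have e : ∀ t x, {z : Z n | z.1 < T}.indicator F (t, x) = if t < T then F (t, x) else 0 := fun t x => by
      simp [indicator_apply]
    have e' : ∀ t, ∫ x, {z : Z n | z.1 < T}.indicator F (t, x) = if t < T then ∫ x, F (t, x) else 0 := fun t => by
      simp_rw [e]; split_ifs <;> simp
    refine ⟨?_, fun η hη hηb hηT => ?_⟩
    · have := hI.integral_prod_left
      simp_rw [e'] at this
      exact this
    · have hI2 : Integrable (fun z : Z n => {z : Z n | z.1 < T}.indicator F z * η z.1) ((volume : Measure ℝ).prod volume) := by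
        obtain ⟨C, hC⟩ := hηb
        exact hI.mul_bdd (c := C) (hη.comp continuous_fst).aestronglyMeasurable (ae_of_all _ fun z => hC _)
      have e2 : ∫ z : Z n, F z * η z.1 = ∫ z : Z n, {z : Z n | z.1 < T}.indicator F z * η z.1 := by
        refine integral_congr_ae (ae_of_all _ fun z => ?_)
        by_cases hz : z.1 < T
        · simp [hz]
        · simp [hηT _ (not_lt.1 hz)]
      rw [e2, Measure.volume_eq_prod, integral_prod _ hI2]
      refine integral_congr_ae (ae_of_all _ fun t => ?_)
      simp only []
      rw [integral_mul_const, e']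
  obtain ⟨y1, y2⟩ := fub _ i2
  set y : ℝ → ℝ := fun t => if t < T then ∫ x, excess u k (t, x) ^ 2 else 0 with hy
  have i4 : IntegrableOn (fun z => excess u k z ^ 2 / 2 + k * excess u k z) {z : Z n | z.1 < T} volume :=
    (i2.div_const 2).add (i1.const_mul k)
  obtain ⟨q1, q2⟩ := fub _ i4
  have hloc : LocallyIntegrable (fun t => y t - B) volume :=
    y1.locallyIntegrable.sub (continuous_const.locallyIntegrable)
  have key := ae_nonpos_of_distributional_ode (z := fun t => y t - B) (μ := d₁ / (4 * c ^ 2)) (T := T') hloc ?_ ?_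
  · filter_upwards [key] with t ht htT
    have := ht htT
    simp only [hy, if_pos (htT.trans hT)] at this
    linarith
  · intro η hη hηc hη0 hηT
    have hD := h.decay hn hm hk hT hdiv hu0 hd₁ hd0.le hc hs hsc i1 i2 i3 hη hηc hη0 hηT
    have hηT2 : ∀ t, T ≤ t → η t = 0 := fun t ht => hηT t (hT.le.trans ht)
    have hηd : ∀ t, T ≤ t → deriv η t = 0 := by
      intro t ht
      have : η =ᶠ[𝓝 t] fun _ => 0 := by
        filter_upwards [Ioi_mem_nhds (hT.trans_le ht)] with r hr using hηT r (le_of_lt hr)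
      rw [this.deriv_eq]; simp
    have hdc : Continuous (deriv η) := hη.continuous_deriv (by simp)
    have hbη := hηc.exists_bound_of_continuous hη.continuous
    have hbd := hηc.deriv.exists_bound_of_continuous hdc
    have e1 : ∀ z : Z n, excess u k z ^ 2 / 2 * deriv η z.1 = 1 / 2 * (excess u k z ^ 2 * deriv η z.1) := fun z => by ring
    simp_rw [e1] at hD
    rw [integral_const_mul, y2 η hη.continuous hbη hηT2, y2 (deriv η) hdc hbd hηd, q2 η hη.continuous hbη hηT2] at hD
    have iη : Integrable η volume := hη.continuous.integrable_of_hasCompactSupport hηc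
    have idη : Integrable (deriv η) volume := hdc.integrable_of_hasCompactSupport hηc.deriv
    have iy1 : Integrable (fun t => y t * η t) volume := by
      obtain ⟨C, hC⟩ := hbη
      exact y1.mul_bdd (c := C) hη.continuous.aestronglyMeasurable (ae_of_all _ hC)
    have iy2 : Integrable (fun t => y t * deriv η t) volume := by
      obtain ⟨C, hC⟩ := hbd
      exact y1.mul_bdd (c := C) hdc.aestronglyMeasurable (ae_of_all _ hC)
    have iq : Integrable (fun t => (if t < T then ∫ x, (excess u k (t, x) ^ 2 / 2 + k * excess u k (t, x)) else 0) * η t) volume := by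
      obtain ⟨C, hC⟩ := hbη
      exact q1.mul_bdd (c := C) hη.continuous.aestronglyMeasurable (ae_of_all _ hC)
    have hq : ∫ t, (if t < T then ∫ x, (excess u k (t, x) ^ 2 / 2 + k * excess u k (t, x)) else 0) * η t ≤ Q * ∫ t, η t := by
      rw [← integral_const_mul]
      refine integral_mono_ae iq (iη.const_mul Q) ?_
      filter_upwards [hQ] with t ht
      split_ifs with htT
      · exact mul_le_mul_of_nonneg_right (ht htT) (hη0 t)
      · simp [mul_nonneg hQ0 (hη0 t)]
    have hder0 : ∫ t, deriv η t = 0 := by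
      refine integral_eq_zero_of_hasDerivAt_of_integrable (f := η)
        (fun t => (hη.differentiable (by simp) t).hasDerivAt) idη iη
    simp_rw [sub_mul]
    rw [integral_sub iy1 (iη.const_mul B), integral_sub iy2 (idη.const_mul B), integral_const_mul, integral_const_mul,
      hder0]
    have hq' := mul_le_mul_of_nonneg_left hq hΛ
    have e2 : d₁ / (4 * c ^ 2) * (B * ∫ t, η t) = 2 * (Λ * (Q * ∫ t, η t)) := by
      rw [hB]; field_simp; ring
    have e3 : d₁ / (4 * c ^ 2) * ∫ t, y t * η t = 2 * (d₁ / (8 * c ^ 2) * ∫ t, y t * η t) := by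
      field_simp; ring
    rw [mul_sub, e2, e3]
    linarith
  -- For negative times the excess vanishes, so `y - B = -B ≤ 0`: the initial condition of the
  -- differential inequality.
  · refine ae_of_all _ fun t ht => ?_
    have : y t = 0 := by
      simp only [hy, excess, if_neg (not_lt.2 ht.le)]
      simp
    rw [this]; linarith

end DriftDiffusion

/-! ### The De Giorgi iteration -/

/-- Used with `p = m - 1`, which has either sign; minimum and maximum treat slow and fast diffusion
at once. -/
theorem rpow_mem_Icc_min_max {a b w p : ℝ} (ha : 0 < a) (haw : a ≤ w) (hwb : w ≤ b) :
    min (b ^ p) (a ^ p) ≤ w ^ p ∧ w ^ p ≤ max (b ^ p) (a ^ p) := by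
  have hw := ha.trans_le haw
  rcases le_total 0 p with hp | hp
  · exact ⟨(min_le_right _ _).trans (Real.rpow_le_rpow ha.le haw hp),
      (Real.rpow_le_rpow hw.le hwb hp).trans (le_max_left _ _)⟩
  · exact ⟨(min_le_left _ _).trans (Real.rpow_le_rpow_of_nonpos hw hwb hp),
      (Real.rpow_le_rpow_of_nonpos ha haw hp).trans (le_max_right _ _)⟩

section excess
variable {u : Z n → ℝ} {k δ : ℝ}

theorem excess_antitone {k k' : ℝ} (h : k ≤ k') (z : Z n) : excess u k' z ≤ excess u k z := by
  unfold excess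
  split_ifs
  · exact max_le_max (by linarith) le_rfl
  · exact le_rfl

/-- Between two levels the excess gains a power. -/
theorem excess_le_sq_div (hδ : 0 < δ) (z : Z n) : excess u (k + δ) z ≤ excess u k z ^ 2 / δ := by
  rcases (excess_nonneg (u := u) (k := k + δ) z).eq_or_lt with h | h
  · rw [← h]; positivity
  · obtain ⟨ht, hk, e⟩ := excess_pos h
    have e2 : excess u k z = u z - k := by
      unfold excess; rw [if_pos ht, max_eq_left (by linarith)]
    rw [e, e2, le_div_iff₀ hδ]
    nlinarith

/-- With Chebyshev, this bounds the measure of the set above the higher level by the energy at the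
lower one. -/
theorem le_excess_sq_of_excess_pos (hδ : 0 < δ) {z : Z n} (h : 0 < excess u (k + δ) z) :
    δ ^ 2 ≤ excess u k z ^ 2 := by
  obtain ⟨ht, hk, e⟩ := excess_pos h
  have e2 : excess u k z = u z - k := by
    unfold excess; rw [if_pos ht, max_eq_left (by linarith)]
  rw [e2]
  exact pow_le_pow_left₀ hδ.le (by linarith) 2

end excess

/-- `u ≤ K`, mass at most `M` and a controlled drift tail on the time interval `(0, T)`. -/
structure BoundedUpTo (u : Z n → ℝ) (v : Z n → E n) (T K M : ℝ) : Prop where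
  le : ∀ᵐ z : Z n, z.1 < T → u z ≤ K
  mass : ∀ᵐ t : ℝ, 0 < t → t < T → ∫⁻ x, ENNReal.ofReal (u (t, x)) ≤ ENNReal.ofReal M
  drift : IntegrableOn (fun z => u z * ‖v z‖ / (1 + ‖z.2‖)) {z : Z n | 0 < z.1 ∧ z.1 < T} volume

namespace BoundedUpTo
variable {u : Z n → ℝ} {v : Z n → E n} {T K M k : ℝ}

theorem measurableSet_slab (T : ℝ) : MeasurableSet {z : Z n | 0 < z.1 ∧ z.1 < T} :=
  (measurableSet_lt measurable_const measurable_fst).inter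
    (measurableSet_lt measurable_fst measurable_const)

theorem integrableOn (h : BoundedUpTo u v T K M) (hu : Measurable u) (hu0 : ∀ z, 0 ≤ u z) :
    IntegrableOn u {z : Z n | 0 < z.1 ∧ z.1 < T} volume := by
  refine ⟨hu.aestronglyMeasurable, ?_⟩
  rw [hasFiniteIntegral_iff_ofReal (ae_of_all _ hu0), ← lintegral_indicator (measurableSet_slab T)]
  rw [Measure.volume_eq_prod, lintegral_prod _ ((hu.ennreal_ofReal.indicator (measurableSet_slab T)).aemeasurable)]
  have hle : ∀ᵐ t : ℝ, ∫⁻ x, {z : Z n | 0 < z.1 ∧ z.1 < T}.indicator (fun z => ENNReal.ofReal (u z)) (t, x) ≤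
      (Ioo 0 T).indicator (fun _ => ENNReal.ofReal M) t := by
    filter_upwards [h.mass] with t ht
    by_cases htT : t ∈ Ioo 0 T
    · rw [indicator_of_mem htT]
      exact (lintegral_mono fun x => indicator_le_self _ _ _).trans (ht htT.1 htT.2)
    · have : ∀ x : E n, ((t, x) : Z n) ∉ {z : Z n | 0 < z.1 ∧ z.1 < T} := fun x hx => htT hx
      simp [indicator_of_notMem (this _)]
  refine (lintegral_mono_ae hle).trans_lt ?_
  rw [lintegral_indicator measurableSet_Ioo, lintegral_const]
  simp [ENNReal.mul_lt_top]

/-- The set `{t < T}` contains an infinite past, where the density need not be integrable; the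
functions of interest vanish there, so a bound on the slab is enough. -/
theorem integrableOn_of_le {F g : Z n → ℝ} {c : ℝ}
    (hg : IntegrableOn g {z : Z n | 0 < z.1 ∧ z.1 < T} volume) (hF : AEStronglyMeasurable F volume)
    (hF0 : ∀ z, z.1 ≤ 0 → F z = 0) (hle : ∀ᵐ z, 0 < z.1 → z.1 < T → |F z| ≤ c * g z) :
    IntegrableOn F {z : Z n | z.1 < T} volume := by
  have h1 : IntegrableOn F {z : Z n | 0 < z.1 ∧ z.1 < T} volume := by
    refine (hg.const_mul c).mono' hF.restrict ?_
    rw [ae_restrict_iff' (measurableSet_slab T)]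
    filter_upwards [hle] with z hz hzm
    exact hz hzm.1 hzm.2
  refine h1.of_forall_sdiff_eq_zero (measurableSet_lt measurable_fst measurable_const) fun z hz => ?_
  refine hF0 z (not_lt.1 fun hp => hz.2 ⟨hp, hz.1⟩)

/-- Slicewise integrability of the square of the excess. -/
theorem slice (h : BoundedUpTo u v T K M) (hu : Measurable u) (hu0 : ∀ z, 0 ≤ u z) (hK : 0 ≤ K) (hM : 0 ≤ M) :
    ∀ᵐ t : ℝ, t < T → ∀ k : ℝ, 0 ≤ k → Integrable (fun x => excess u k (t, x) ^ 2) ∧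
      ∫ x, excess u k (t, x) ^ 2 ≤ K * M := by
  have h1 := h.le
  rw [Measure.volume_eq_prod] at h1
  filter_upwards [Measure.ae_ae_of_ae_prod h1, h.mass] with t h1 h2 htT k hk
  have hm : ∀ k, Measurable fun x => excess u k (t, x) := fun k => (measurable_excess hu).comp measurable_prodMk_left
  rcases le_or_gt t 0 with ht | ht
  · have : ∀ x : E n, excess u k (t, x) = 0 := fun x => if_neg (not_lt.2 ht)
    simp only [this]
    simpa using mul_nonneg hK hM
  have hum : Measurable fun x => u (t, x) := hu.comp measurable_prodMk_left
  have hi : Integrable (fun x => u (t, x)) := by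
    refine ⟨hum.aestronglyMeasurable, ?_⟩
    rw [hasFiniteIntegral_iff_ofReal (ae_of_all _ fun x => hu0 _)]
    exact (h2 ht htT).trans_lt ENNReal.ofReal_lt_top
  have hle : ∀ᵐ x : E n, excess u k (t, x) ^ 2 ≤ K * u (t, x) := by
    filter_upwards [h1] with x hx
    have a := excess_le hu0 hk (t, x)
    have b := excess_nonneg (u := u) (k := k) (t, x)
    have c := hx htT
    have d := hu0 (t, x)
    rw [sq]
    exact mul_le_mul (a.trans c) a b hK
  have hi2 : Integrable (fun x => excess u k (t, x) ^ 2) := by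
    refine (hi.const_mul K).mono' ((hm k).pow_const 2).aestronglyMeasurable ?_
    filter_upwards [hle] with x hx
    rwa [Real.norm_of_nonneg (sq_nonneg _)]
  refine ⟨hi2, (integral_mono_ae hi2 (hi.const_mul K) hle).trans ?_⟩
  rw [integral_const_mul]
  refine mul_le_mul_of_nonneg_left ?_ hK
  rw [integral_eq_lintegral_of_nonneg_ae (ae_of_all _ fun x => hu0 _) hum.aestronglyMeasurable]
  exact ENNReal.toReal_le_of_le_ofReal hM (h2 ht htT)

end BoundedUpTo

namespace DriftDiffusion
variable {m : ℝ} {u : Z n → ℝ} {G v : Z n → E n}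

/-- One step of the De Giorgi iteration. -/
theorem level_step (h : DriftDiffusion m u G v) (hn : 2 ≤ n) (hm : 0 < m) {T Λ K M k δ Y d : ℝ}
    (hK : 0 < K) (hM : 0 ≤ M) (hΛ : 0 ≤ Λ) (hdiv : DivLE v Λ T) (hb : BoundedUpTo u v T K M)
    (hu0 : ∀ᵐ z : Z n, z.1 ≤ 0 → u z ≤ K / 4)
    (hd : d = m * min (K ^ (m - 1)) ((K / 4) ^ (m - 1)))
    (hk : K / 4 ≤ k) (hδ : 0 < δ) (hkδ : k + δ ≤ K / 2) (hY : 0 < Y)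
    (hle : ∀ᵐ t : ℝ, t < T → ∫ x, excess u k (t, x) ^ 2 ≤ Y) :
    ∀ᵐ t : ℝ, t < T → ∫ x, excess u (k + δ) (t, x) ^ 2 ≤
      8 * ((sobolevConst n + 1) * (Y / δ ^ 2) ^ (1 / (n : ℝ))) ^ 2 * Λ * (K * Y / δ) / d := by
  have hk4 : 0 < K / 4 := by positivity
  have hk0 : 0 < k + δ := by linarith
  have hs0 : 0 < Y / δ ^ 2 := by positivity
  have hum := h.measurable
  have hsl := hb.slice hum h.nonneg hK.le hM
  have hm' : Measurable (excess u (k + δ)) := measurable_excess hum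
  have hfle : ∀ z, excess u (k + δ) z ≤ u z := fun z => excess_le h.nonneg hk0.le z
  have hf0 : ∀ z, 0 ≤ excess u (k + δ) z := excess_nonneg
  have hf00 : ∀ z : Z n, z.1 ≤ 0 → excess u (k + δ) z = 0 := fun z hz => if_neg (not_lt.2 hz)
  have hsq : ∀ᵐ z : Z n, 0 < z.1 → z.1 < T → excess u (k + δ) z ^ 2 ≤ K * u z := by
    filter_upwards [hb.le] with z hz _ hT
    rw [sq]
    exact mul_le_mul ((hfle z).trans (hz hT)) (hfle z) (hf0 z) hK.le
  have hvm : AEStronglyMeasurable v volume := h.locL2_drift.locallyIntegrable.aestronglyMeasurable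
  have hmin : 0 < min (K ^ (m - 1)) ((K / 4) ^ (m - 1)) := lt_min (by positivity) (by positivity)
  -- The measure bound `s` is Chebyshev at level `k`, and `Q` comes from the gain of a power between
  -- the levels. The summand `1` added to the Sobolev constant keeps `c` positive.
  refine h.level_bound hn hm hk0 hdiv hΛ (Q := K * Y / δ) (s := (Y / δ ^ 2).toNNReal)
    (d₂ := m * max (K ^ (m - 1)) ((K / 4) ^ (m - 1))) (by positivity) ?_ ?_ (by rw [hd]; positivity) (by positivity) ?_ ?_ ?_ ?_ ?_ ?_
  · filter_upwards [hu0] with z hz ht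
    linarith [hz ht]
  · filter_upwards [hb.le] with z hz hT hp
    obtain ⟨ht, hku, -⟩ := excess_pos hp
    obtain ⟨a, b⟩ := rpow_mem_Icc_min_max (p := m - 1) hk4 (by linarith : K / 4 ≤ u z) (hz hT)
    rw [hd]
    exact ⟨by gcongr, by gcongr⟩
  · filter_upwards [hle, hsl] with t ht hst htT
    obtain ⟨hi, -⟩ := hst htT k (by linarith)
    have := mul_meas_ge_le_integral_of_nonneg (ae_of_all _ fun x => sq_nonneg _) hi (δ ^ 2)
    have hreal : volume.real {x : E n | δ ^ 2 ≤ excess u k (t, x) ^ 2} ≤ Y / δ ^ 2 := by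
      rw [le_div_iff₀ (by positivity), mul_comm]
      exact this.trans (ht htT)
    have hfin : volume {x : E n | δ ^ 2 ≤ excess u k (t, x) ^ 2} ≠ ⊤ :=
      (hi.measure_ge_lt_top (by positivity)).ne
    refine (measure_mono (fun x hx => le_excess_sq_of_excess_pos hδ hx)).trans ?_
    change volume {x : E n | δ ^ 2 ≤ excess u k (t, x) ^ 2} ≤ ENNReal.ofReal _
    rw [← ENNReal.ofReal_toReal hfin]
    exact ENNReal.ofReal_le_ofReal hreal
  · rw [Real.coe_toNNReal _ hs0.le]
    gcongr
    linarith
  · refine BoundedUpTo.integrableOn_of_le (c := 1) (hb.integrableOn hum h.nonneg) hm'.aestronglyMeasurable hf00 (ae_of_all _ fun z _ _ => ?_)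
    rw [abs_of_nonneg (hf0 z), one_mul]; exact hfle z
  · refine BoundedUpTo.integrableOn_of_le (c := K) (hb.integrableOn hum h.nonneg) (hm'.pow_const 2).aestronglyMeasurable
      (fun z hz => by simp [hf00 z hz]) ?_
    filter_upwards [hsq] with z hz ht hT
    rw [abs_of_nonneg (sq_nonneg _)]; exact hz ht hT
  · refine BoundedUpTo.integrableOn_of_le (c := K) hb.drift ?_ (fun z hz => by simp [hf00 z hz]) ?_
    · have : AEMeasurable (fun z => excess u (k + δ) z ^ 2 * ‖v z‖ / (1 + ‖z.2‖)) (volume : Measure (Z n)) :=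
        ((hm'.pow_const 2).aemeasurable.mul hvm.norm.aemeasurable).div
          ((measurable_const.add measurable_snd.norm).aemeasurable)
      exact this.aestronglyMeasurable
    filter_upwards [hsq] with z hz ht hT
    rw [abs_of_nonneg (by positivity), mul_div_assoc, mul_div_assoc, ← mul_assoc]
    gcongr
    exact hz ht hT
  · filter_upwards [hle, hsl] with t ht hst htT
    obtain ⟨hi, -⟩ := hst htT k (by linarith)
    refine (integral_mono_of_nonneg (ae_of_all _ fun x => by have := hf0 (t, x); positivity) (hi.const_mul (K / δ)) (ae_of_all _ fun x => ?_)).trans ?_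
    -- The linear term uses `k + δ ≤ K / 2`, the quadratic one `δ ≤ K`; each contributes `K / (2 δ)`
    -- times the squared excess at level `k`.
    · change excess u (k + δ) (t, x) ^ 2 / 2 + (k + δ) * excess u (k + δ) (t, x) ≤ K / δ * excess u k (t, x) ^ 2
      have a := excess_le_sq_div (u := u) (k := k) hδ (t, x)
      have b := excess_antitone (u := u) (show k ≤ k + δ by linarith) (t, x)
      have c := pow_le_pow_left₀ (hf0 (t, x)) b 2
      have e := mul_le_mul_of_nonneg_left a hk0.le
      set F := excess u k (t, x) ^ 2
      have hF : 0 ≤ F := sq_nonneg _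
      have e1 : (k + δ) * (F / δ) ≤ K / 2 * (F / δ) := by gcongr
      have e2 : F / 2 ≤ K / 2 * (F / δ) := by
        have : F = δ * (F / δ) := by field_simp
        have h3 : 0 ≤ F / δ := by positivity
        nlinarith
      have e3 : K / δ * F = K * (F / δ) := by ring
      linarith
    · rw [integral_const_mul, div_mul_eq_mul_div]
      have := ht htT
      gcongr

/-- **De Giorgi iteration**: a bound on `u` improves by a factor two under a smallness condition. -/
theorem halve_bound (h : DriftDiffusion m u G v) (hn : 2 ≤ n) (hm : 0 < m) {T Λ K M : ℝ}
    (hK : 0 < K) (hM : 0 < M) (hΛ : 0 ≤ Λ) (hdiv : DivLE v Λ T) (hb : BoundedUpTo u v T K M)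
    (hu0 : ∀ᵐ z : Z n, z.1 ≤ 0 → u z ≤ K / 4)
    (hsmall : 4096 * ((sobolevConst n : ℝ) + 1) ^ 2 * Λ * (M / K) ^ (2 / (n : ℝ)) ≤
      m * min (K ^ (m - 1)) ((K / 4) ^ (m - 1)) * 8 ^ (-((n : ℝ) / 2))) :
    ∀ᵐ z : Z n, z.1 < T → u z ≤ K / 2 := by
  set d := m * min (K ^ (m - 1)) ((K / 4) ^ (m - 1)) with hd
  have hd0 : 0 < d := mul_pos hm (lt_min (by positivity) (by positivity))
  have hn0 : (0 : ℝ) < n := by exact_mod_cast (by omega : 0 < n)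
  have hn2 : (2 : ℝ) ≤ n := by exact_mod_cast hn
  -- The ratio of the energies is chosen with `q^(2/n) = 1/8`, which compensates the growth `4^j` of
  -- the Chebyshev bound and `2^j` of `K / δ`.
  set q : ℝ := 8 ^ (-((n : ℝ) / 2)) with hq
  have hq0 : 0 < q := by positivity
  have hq1 : q < 1 := Real.rpow_lt_one_of_one_lt_of_neg (by norm_num) (by linarith)
  have hqp : q ^ (2 / (n : ℝ)) = 1 / 8 := by
    rw [hq, ← Real.rpow_mul (by norm_num)]
    have : -((n : ℝ) / 2) * (2 / n) = -1 := by field_simp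
    rw [this, Real.rpow_neg_one]; norm_num
  -- Levels rising from `K / 4` to `K / 2`, with increments `(K / 8) 2^(-j)`.
  set kk : ℕ → ℝ := fun j => K / 2 - K / 4 * (1 / 2) ^ j with hkk
  set S : ℝ := (sobolevConst n : ℝ) + 1 with hS
  have hS0 : 0 < S := by positivity
  have hp1 : (2 : ℝ) / n ≤ 1 := by rw [div_le_one hn0]; exact hn2
  have hhalf : ∀ j : ℕ, ((1 : ℝ) / 2) ^ j ≤ 1 := fun j => pow_le_one₀ (by norm_num) (by norm_num)
  have main : ∀ j : ℕ, ∀ᵐ t : ℝ, t < T → ∫ x, excess u (kk j) (t, x) ^ 2 ≤ K * M * q ^ j := by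
    intro j
    induction j with
    | zero =>
      filter_upwards [hb.slice h.measurable h.nonneg hK.le hM.le] with t ht htT
      simpa using (ht htT (kk 0) (by simp only [hkk]; linarith)).2
    | succ j ih =>
      set δ : ℝ := K / 8 * (1 / 2) ^ j with hδ
      have hδ0 : 0 < δ := by positivity
      have e : kk (j + 1) = kk j + δ := by simp only [hkk, hδ]; ring
      have hstep := h.level_step hn hm hK hM.le hΛ hdiv hb hu0 hd (k := kk j) (δ := δ) (Y := K * M * q ^ j)
        (by simp only [hkk]; nlinarith [hhalf j]) hδ0
        (by rw [← e]; simp only [hkk]; have : 0 ≤ K / 4 * (1 / 2) ^ (j + 1) := by positivity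
            linarith) (by positivity) ih
      rw [← e] at hstep
      filter_upwards [hstep] with t ht htT
      refine (ht htT).trans ?_
      set Y := K * M * q ^ j with hY
      have hY0 : 0 < Y := by positivity
      have p1 : ((Y / δ ^ 2) ^ (1 / (n : ℝ))) ^ 2 = (Y / δ ^ 2) ^ (2 / (n : ℝ)) := by
        rw [← Real.rpow_natCast, ← Real.rpow_mul (by positivity)]
        congr 1; push_cast; ring
      have p2 : Y / δ ^ 2 = (64 * 4 ^ j) * ((M / K) * q ^ j) := by
        have : ((1 : ℝ) / 2) ^ j * (1 / 2) ^ j * 4 ^ j = 1 := by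
          rw [← mul_pow, ← mul_pow]; norm_num
        simp only [hY, hδ]
        field_simp
        norm_num
        linear_combination (-64) * this
      have p3 : (Y / δ ^ 2) ^ (2 / (n : ℝ)) ≤ (64 * 4 ^ j) * ((M / K) ^ (2 / (n : ℝ)) * (1 / 8) ^ j) := by
        rw [p2, Real.mul_rpow (by positivity) (by positivity),
          Real.mul_rpow (x := M / K) (y := q ^ j) (by positivity) (by positivity)]
        -- The base is at least one and `2 / n ≤ 1`.
        have a1 : ((64 : ℝ) * 4 ^ j) ^ (2 / (n : ℝ)) ≤ 64 * 4 ^ j := by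
          have : (1 : ℝ) ≤ 64 * 4 ^ j := by
            have := one_le_pow₀ (M₀ := ℝ) (a := 4) (n := j) (by norm_num)
            linarith
          exact (Real.rpow_le_rpow_of_exponent_le this hp1).trans_eq (Real.rpow_one _)
        have a2 : (q ^ j) ^ (2 / (n : ℝ)) = (1 / 8) ^ j := by
          rw [← Real.rpow_natCast, ← Real.rpow_mul hq0.le, mul_comm, Real.rpow_mul hq0.le, hqp, Real.rpow_natCast]
        rw [a2]
        gcongr
      have p4 : K * Y / δ = 8 * 2 ^ j * Y := by
        have : ((1 : ℝ) / 2) ^ j * 2 ^ j = 1 := by rw [← mul_pow]; norm_num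
        simp only [hδ]
        field_simp
        linear_combination -this
      rw [div_le_iff₀ hd0, mul_pow, p1, p4]
      -- The powers of `j` cancel, `4 * (1/8) * 2 = 1`, and `8 * 64 * 8 = 4096`; the smallness
      -- hypothesis then supplies the factor `q` for the next step.
      calc 8 * (S ^ 2 * (Y / δ ^ 2) ^ (2 / (n : ℝ))) * Λ * (8 * 2 ^ j * Y)
          ≤ 8 * (S ^ 2 * ((64 * 4 ^ j) * ((M / K) ^ (2 / (n : ℝ)) * (1 / 8) ^ j))) * Λ * (8 * 2 ^ j * Y) := by gcongr
        _ = (4096 * S ^ 2 * Λ * (M / K) ^ (2 / (n : ℝ))) * Y * (4 * (1 / 8) * 2) ^ j := by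
            rw [mul_pow, mul_pow]; ring
        _ = (4096 * S ^ 2 * Λ * (M / K) ^ (2 / (n : ℝ))) * Y := by norm_num
        _ ≤ d * q * Y := by gcongr
        _ = K * M * q ^ (j + 1) * d := by simp only [hY]; ring
  -- All levels lie below `K / 2`, so the energy above `K / 2` is bounded by every term of a
  -- sequence tending to zero.
  have hzero : ∀ᵐ t : ℝ, t < T → ∀ᵐ x : E n, excess u (K / 2) (t, x) = 0 := by
    filter_upwards [ae_all_iff.2 main, hb.slice h.measurable h.nonneg hK.le hM.le] with t ht hs htT
    obtain ⟨hi, -⟩ := hs htT (K / 2) (by positivity)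
    have hle : ∀ j : ℕ, ∫ x, excess u (K / 2) (t, x) ^ 2 ≤ K * M * q ^ j := by
      intro j
      refine (integral_mono hi (hs htT (kk j) ?_).1 fun x => ?_).trans (ht j htT)
      · simp only [hkk]; nlinarith [hhalf j]
      · refine pow_le_pow_left₀ (excess_nonneg _) (excess_antitone ?_ _) 2
        simp only [hkk]; have : 0 ≤ K / 4 * (1 / 2) ^ j := by positivity
        linarith
    have hlim : Tendsto (fun j : ℕ => K * M * q ^ j) atTop (𝓝 0) := by
      simpa using (tendsto_pow_atTop_nhds_zero_of_lt_one hq0.le hq1).const_mul (K * M)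
    have h0 := ge_of_tendsto' hlim hle
    have := (integral_eq_zero_iff_of_nonneg (fun x => sq_nonneg _) hi).1
      (le_antisymm h0 (integral_nonneg fun x => sq_nonneg _))
    filter_upwards [this] with x hx
    simpa using hx
  have hset : MeasurableSet {z : Z n | z.1 < T → excess u (K / 2) z = 0} := by
    have : {z : Z n | z.1 < T → excess u (K / 2) z = 0} = {z : Z n | z.1 < T}ᶜ ∪ {z | excess u (K / 2) z = 0} := by
      ext z; simp [imp_iff_not_or]
    rw [this]
    exact (measurableSet_lt measurable_fst measurable_const).compl.union
      (measurable_excess h.measurable (measurableSet_singleton 0))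
  have hz : ∀ᵐ z : Z n, z.1 < T → excess u (K / 2) z = 0 := by
    rw [Measure.volume_eq_prod, Measure.ae_prod_iff_ae_ae hset]
    filter_upwards [hzero] with t ht
    by_cases htT : t < T
    · filter_upwards [ht htT] with x hx _ using hx
    · exact ae_of_all _ fun x hx => absurd hx htT
  filter_upwards [hz, hu0] with z hz h0 hT
  rcases le_or_gt z.1 0 with ht | ht
  · linarith [h0 ht]
  · have := hz hT
    unfold excess at this
    rw [if_pos ht] at this
    have := le_max_left (u z - K / 2) 0
    linarith

end DriftDiffusion

/-! ### The attraction kernel: Riesz potentials and divergence -/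

/-- The attraction kernel `∇U`, as an explicit function. -/
noncomputable def kern (A : ℝ) (x : E n) : E n := ‖x‖ ^ (A - 2) • x

section kern
variable {A : ℝ}

theorem gradient_potential_eq {x : E n} (hx : x ≠ 0) : gradient (potential A) x = kern A x :=
  (hasGradientAt_potential A hx).gradient

theorem norm_kern_of_ne {x : E n} (hx : x ≠ 0) : ‖kern A x‖ = ‖x‖ ^ (A - 1) := by
  have : 0 < ‖x‖ := norm_pos_iff.2 hx
  unfold kern
  rw [norm_smul, Real.norm_of_nonneg (by positivity), ← Real.rpow_add_one this.ne']
  ring_nf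

theorem norm_kern_le (x : E n) : ‖kern A x‖ ≤ ‖x‖ ^ (A - 1) := by
  rcases eq_or_ne x 0 with rfl | hx
  · simp [kern]; positivity
  · exact (norm_kern_of_ne hx).le

theorem measurable_kern : Measurable (kern A : E n → E n) :=
  (measurable_norm.pow_const _).smul measurable_id

theorem gradient_potential_sub_ae (hn : 1 ≤ n) (x : E n) :
    (fun y => gradient (potential A) (x - y)) =ᵐ[volume] fun y => kern A (x - y) := by
  have : Nontrivial (E n) := Module.nontrivial_of_finrank_pos (R := ℝ) (by simp; omega)
  have h : ∀ᵐ y : E n, y ≠ x := by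
    simp [ae_iff]
  filter_upwards [h] with y hy
  exact gradient_potential_eq (sub_ne_zero.2 hy.symm)

end kern

theorem locallyIntegrable_norm_rpow (hn : 1 ≤ n) {p : ℝ} (hp : -(n : ℝ) < p) :
    LocallyIntegrable (fun x : E n => ‖x‖ ^ p) volume := by
  refine locallyIntegrable_of_norm_le_rpow (by simpa using hn) (C := 1) (α := -p) (by simp; linarith) (ae_of_all _ fun x => ?_)
    (measurable_norm.pow_const p).aestronglyMeasurable
  rw [Real.norm_of_nonneg (by positivity)]
  simp

theorem setIntegral_ball_norm_rpow {p r : ℝ} (hr : 0 < r) :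
    ∫ x in Metric.ball (0 : E n) r, ‖x‖ ^ p = r ^ ((n : ℝ) + p) * ∫ x in Metric.ball (0 : E n) 1, ‖x‖ ^ p := by
  have h := Measure.setIntegral_comp_smul_of_pos (volume : Measure (E n)) (fun x => ‖x‖ ^ p) (Metric.ball 0 1) hr
  rw [smul_unitBall_of_pos hr] at h
  have h2 : ∀ x : E n, ‖r • x‖ ^ p = r ^ p * ‖x‖ ^ p := fun x => by
    rw [norm_smul, Real.norm_of_nonneg hr.le, Real.mul_rpow hr.le (norm_nonneg _)]
  simp_rw [h2] at h
  rw [integral_const_mul] at h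
  have h3 : (0 : ℝ) < r ^ n := by positivity
  rw [Real.rpow_add hr, Real.rpow_natCast, mul_assoc, h]
  simp
  field_simp

/-- Bounded densities of finite mass have bounded Riesz potentials. -/
theorem exists_riesz_bound (hn : 1 ≤ n) {p : ℝ} (hp : -(n : ℝ) < p) (hp0 : p ≤ 0) :
    ∃ c : ℝ, 0 ≤ c ∧ ∀ (w : E n → ℝ≥0∞) (K M : ℝ), 0 < K → 0 ≤ M → (∀ᵐ y, w y ≤ ENNReal.ofReal K) →
      ∫⁻ y, w y ≤ ENNReal.ofReal M → ∀ x : E n,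
      ∫⁻ y, ENNReal.ofReal (‖x - y‖ ^ p) * w y ≤ ENNReal.ofReal ((c + M) * K ^ (-p / n)) := by
  have hn0 : (0 : ℝ) < n := by exact_mod_cast hn
  set c : ℝ := ∫ x in Metric.ball (0 : E n) 1, ‖x‖ ^ p with hc
  have hc0 : 0 ≤ c := integral_nonneg fun x => by positivity
  refine ⟨c, hc0, fun w K M hK hM hwK hwM x => ?_⟩
  -- The radius balances the two parts: near the singularity `w ≤ K` gives `K r^(n+p) c = c
  -- K^(-p/n)`, and far from it `|x - y|^p ≤ r^p` gives `M r^p = M K^(-p/n)`.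
  set r : ℝ := K ^ (-1 / (n : ℝ)) with hr
  have hr0 : 0 < r := by positivity
  have hf : Measurable fun y : E n => ENNReal.ofReal (‖y‖ ^ p) := (measurable_norm.pow_const p).ennreal_ofReal
  have hball : ∫⁻ y in Metric.ball (0 : E n) r, ENNReal.ofReal (‖y‖ ^ p) = ENNReal.ofReal (r ^ ((n : ℝ) + p) * c) := by
    rw [hc, ← setIntegral_ball_norm_rpow hr0, ofReal_integral_eq_lintegral_ofReal]
    · exact ((locallyIntegrable_norm_rpow hn hp).integrableOn_isCompact (isCompact_closedBall 0 r)).mono_set Metric.ball_subset_closedBall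
    · exact ae_of_all _ fun y => by positivity
  set F : E n → ℝ≥0∞ := (Metric.ball (0 : E n) r).indicator (fun y => ENNReal.ofReal (‖y‖ ^ p)) with hF
  have hFm : Measurable F := hf.indicator measurableSet_ball
  have hle : ∀ᵐ y, ENNReal.ofReal (‖x - y‖ ^ p) * w y ≤ ENNReal.ofReal K * F (x - y) + ENNReal.ofReal (r ^ p) * w y := by
    filter_upwards [hwK] with y hy
    by_cases hxy : x - y ∈ Metric.ball (0 : E n) r
    · rw [hF, indicator_of_mem hxy, mul_comm]
      exact le_add_right (by gcongr)
    · refine le_add_left (mul_le_mul' (ENNReal.ofReal_le_ofReal ?_) le_rfl)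
      rw [Metric.mem_ball, dist_zero_right, not_lt] at hxy
      exact Real.rpow_le_rpow_of_nonpos hr0 hxy hp0
  refine (lintegral_mono_ae hle).trans ?_
  rw [lintegral_add_left (by fun_prop), lintegral_const_mul _ (by fun_prop), lintegral_const_mul' _ _ ENNReal.ofReal_ne_top,
    lintegral_sub_left_eq_self, lintegral_indicator measurableSet_ball, hball]
  have e1 : K * (r ^ ((n : ℝ) + p) * c) = c * K ^ (-p / n) := by
    rw [hr, ← Real.rpow_mul hK.le]
    have : -1 / (n : ℝ) * (n + p) = -p / n - 1 := by field_simp; ring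
    rw [this, Real.rpow_sub_one hK.ne']; field_simp
  have e2 : r ^ p = K ^ (-p / n) := by
    rw [hr, ← Real.rpow_mul hK.le]; congr 1; ring
  have hKp : 0 ≤ K ^ (-p / n) := by positivity
  rw [← ENNReal.ofReal_mul hK.le, e1, e2, add_mul, ENNReal.ofReal_add (by positivity) (by positivity), mul_comm M,
    ENNReal.ofReal_mul (p := K ^ (-p / n)) hKp]
  gcongr

/-- The kernel has divergence `(n + A - 2) |x| ^ (A - 2)`, in the weak sense. -/
theorem integral_inner_kern_gradient (hn : 1 ≤ n) {A : ℝ} (hA : 2 - (n : ℝ) < A) {χ : E n → ℝ}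
    (hχ : ContDiff ℝ ((⊤ : ℕ∞) : WithTop ℕ∞) χ) (hχc : HasCompactSupport χ) :
    Integrable (fun x => inner ℝ (kern A x) (gradient χ x)) ∧
    - ∫ x, inner ℝ (kern A x) (gradient χ x) = (n + A - 2) * ∫ x, ‖x‖ ^ (A - 2) * χ x := by
  have hli := locallyIntegrable_norm_rpow (n := n) hn (p := A - 2) (by linarith)
  have hχd : Differentiable ℝ χ := hχ.differentiable (by simp)
  obtain ⟨R, hR0, hR⟩ : ∃ R : ℝ, 0 < R ∧ ∀ x : E n, R ≤ ‖x‖ → x ∉ tsupport χ := by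
    obtain ⟨R, hR⟩ := hχc.isCompact.isBounded.subset_closedBall (0 : E n)
    refine ⟨max (R + 1) 1, by positivity, fun x hx hm => ?_⟩
    have := hR hm
    rw [Metric.mem_closedBall, dist_zero_right] at this
    have := le_max_left (R + 1) 1
    linarith
  have hχ0 : ∀ x : E n, R ≤ ‖x‖ → χ x = 0 := fun x hx => image_eq_zero_of_notMem_tsupport (hR x hx)
  have hd0 : ∀ x : E n, R ≤ ‖x‖ → fderiv ℝ χ x = 0 := fun x hx =>
    fderiv_of_notMem_tsupport (𝕜 := ℝ) (hR x hx)
  have hdc : Continuous (fderiv ℝ χ) := hχ.continuous_fderiv (by simp)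
  obtain ⟨C, hC⟩ := (hχc.fderiv (𝕜 := ℝ)).exists_bound_of_continuous hdc
  have hC0 : 0 ≤ C := (norm_nonneg _).trans (hC 0)
  have hm : Measurable fun x : E n => ‖x‖ ^ (A - 2) := measurable_norm.pow_const _
  -- The identity is the derivative at `s = 1` of the scaling relation `∫ |x|^(A-2) χ(s x) dx =
  -- s^(-(n+A-2)) ∫ |x|^(A-2) χ(x) dx`. The singularity at the origin then needs no integration by
  -- parts.
  set F : ℝ → E n → ℝ := fun s x => ‖x‖ ^ (A - 2) * χ (s • x) with hF
  set F' : ℝ → E n → ℝ := fun s x => ‖x‖ ^ (A - 2) * fderiv ℝ χ (s • x) x with hF'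
  have hint : Integrable (fun x => ‖x‖ ^ (A - 2) * χ x) :=
    hli.integrable_smul_right_of_hasCompactSupport hχ.continuous hχc
  -- For `s > 1/2` the functions `χ (s x)` are all supported in the ball of radius `2 R`.
  have hbound : Integrable ((Metric.closedBall (0 : E n) (2 * R)).indicator (fun x => ‖x‖ ^ (A - 2) * (C * (2 * R)))) :=
    (integrable_indicator_iff Metric.isClosed_closedBall.measurableSet).2
      ((hli.integrableOn_isCompact (isCompact_closedBall 0 (2 * R))).mul_const _)
  obtain ⟨hi, hder⟩ := hasDerivAt_integral_of_dominated_loc_of_deriv_le (μ := (volume : Measure (E n))) (𝕜 := ℝ)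
    (F := F) (F' := F') (x₀ := 1) (s := Ioi (1 / 2)) (bound := (Metric.closedBall (0 : E n) (2 * R)).indicator (fun x => ‖x‖ ^ (A - 2) * (C * (2 * R))))
    (Ioi_mem_nhds (by norm_num))
    (Eventually.of_forall fun s => (hm.mul (hχ.continuous.comp (continuous_const_smul s)).measurable).aestronglyMeasurable)
    (by simpa [hF] using hint)
    (hm.mul (by
      have : Continuous fun x : E n => fderiv ℝ χ ((1 : ℝ) • x) x := (hdc.comp (continuous_const_smul 1)).clm_apply continuous_id
      exact this.measurable)).aestronglyMeasurable
    (ae_of_all _ fun x s hs => by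
      rw [mem_Ioi] at hs
      by_cases hx : x ∈ Metric.closedBall (0 : E n) (2 * R)
      · rw [indicator_of_mem hx]
        rw [Metric.mem_closedBall, dist_zero_right] at hx
        simp only [hF']
        rw [norm_mul, Real.norm_of_nonneg (by positivity)]
        gcongr
        exact ((fderiv ℝ χ (s • x)).le_opNorm x).trans (by gcongr; exact hC _)
      · rw [indicator_of_notMem hx]
        rw [Metric.mem_closedBall, dist_zero_right, not_le] at hx
        simp only [hF']
        rw [hd0 (s • x) (by rw [norm_smul, Real.norm_of_nonneg (by linarith)]; nlinarith)]
        simp)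
    hbound
    (ae_of_all _ fun x s _ => by
      have h1 : HasDerivAt (fun s : ℝ => s • x) x s := by simpa using (hasDerivAt_id s).smul_const x
      exact ((hχd (s • x)).hasFDerivAt.comp_hasDerivAt s h1).const_mul _)
  have hscale : ∀ s : ℝ, 0 < s → ∫ x, F s x = s ^ (-((n : ℝ) + A - 2)) * ∫ x, ‖x‖ ^ (A - 2) * χ x := by
    intro s hs
    have h := Measure.integral_comp_smul_of_nonneg (volume : Measure (E n)) (fun x => ‖x‖ ^ (A - 2) * χ x) s (hR := hs.le)
    have h2 : ∀ x : E n, ‖s • x‖ ^ (A - 2) * χ (s • x) = s ^ (A - 2) * F s x := fun x => by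
      rw [norm_smul, Real.norm_of_nonneg hs.le, Real.mul_rpow hs.le (norm_nonneg _)]
      simp only [hF]; ring
    simp_rw [h2] at h
    rw [integral_const_mul] at h
    have h3 : (0 : ℝ) < s ^ (A - 2) := by positivity
    have h4 : s ^ (-((n : ℝ) + A - 2)) = (s ^ (A - 2))⁻¹ * (s ^ n)⁻¹ := by
      rw [← Real.rpow_natCast, ← Real.rpow_neg hs.le, ← Real.rpow_neg hs.le, ← Real.rpow_add hs]
      congr 1; ring
    rw [h4, mul_assoc, eq_inv_mul_iff_mul_eq₀ h3.ne', h]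
    simp
  have hder2 : HasDerivAt (fun s => ∫ x, F s x) (-((n : ℝ) + A - 2) * ∫ x, ‖x‖ ^ (A - 2) * χ x) 1 := by
    have h := ((Real.hasDerivAt_rpow_const (x := 1) (p := -((n : ℝ) + A - 2)) (Or.inl one_ne_zero)).mul_const
      (∫ x : E n, ‖x‖ ^ (A - 2) * χ x))
    rw [Real.one_rpow, mul_one] at h
    refine h.congr_of_eventuallyEq ?_
    filter_upwards [Ioi_mem_nhds (show (0 : ℝ) < 1 by norm_num)] with s hs
    exact hscale s hs
  have he : ∀ x, F' 1 x = inner ℝ (kern A x) (gradient χ x) := by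
    intro x
    simp only [hF', one_smul, kern, gradient]
    rw [real_inner_smul_left, real_inner_comm, InnerProductSpace.toDual_symm_apply]
  simp_rw [he] at hder
  refine ⟨hi.congr (ae_of_all _ he), ?_⟩
  have := hder.unique hder2
  linarith

theorem enorm_inner_le (a b : E n) : ‖(inner ℝ a b : ℝ)‖ₑ ≤ ‖a‖ₑ * ‖b‖ₑ := by
  rw [← ofReal_norm, ← ofReal_norm, ← ofReal_norm, ← ENNReal.ofReal_mul (norm_nonneg _)]
  exact ENNReal.ofReal_le_ofReal (norm_inner_le_norm _ _)

theorem enorm_smul_kern_le {A a : ℝ} (ha : 0 ≤ a) (x : E n) :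
    ‖a • kern A x‖ₑ ≤ ENNReal.ofReal (‖x‖ ^ (A - 1)) * ENNReal.ofReal a := by
  rw [enorm_smul, mul_comm, Real.enorm_eq_ofReal ha, ← ofReal_norm]
  gcongr
  exact norm_kern_le x

/-- The convolution of a bounded density of finite mass with the kernel has bounded divergence. -/
theorem exists_conv_kern_div_le (hn : 1 ≤ n) {A : ℝ} (hA : 2 - (n : ℝ) < A) (hA2 : A ≤ 2) :
    ∃ c : ℝ, 0 ≤ c ∧ ∀ (w : E n → ℝ) (K M : ℝ), 0 < K → 0 ≤ M → Measurable w → (∀ y, 0 ≤ w y) → (∀ᵐ y, w y ≤ K) →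
      ∫⁻ y, ENNReal.ofReal (w y) ≤ ENNReal.ofReal M →
      (∀ R : ℝ, ∫⁻ x in Metric.closedBall 0 R, ∫⁻ y, ‖w y • kern A (x - y)‖ₑ < ⊤) →
      ∀ χ : E n → ℝ, ContDiff ℝ ((⊤ : ℕ∞) : WithTop ℕ∞) χ → HasCompactSupport χ → (∀ x, 0 ≤ χ x) →
        - ∫ x, inner ℝ (∫ y, w y • kern A (x - y)) (gradient χ x) ≤
          (n + A - 2) * ((c + M) * K ^ ((2 - A) / n)) * ∫ x, χ x := by
  obtain ⟨c, hc0, hc⟩ := exists_riesz_bound (n := n) hn (p := A - 2) (by linarith) (by linarith)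
  refine ⟨c, hc0, fun w K M hK hM hw hw0 hwK hwM hloc χ hχ hχc hχ0 => ?_⟩
  have hχd : Differentiable ℝ χ := hχ.differentiable (by simp)
  have hgc : Continuous (gradient χ) :=
    (InnerProductSpace.toDual ℝ (E n)).symm.continuous.comp (hχ.continuous_fderiv (by simp))
  obtain ⟨R, hR⟩ := hχc.isCompact.isBounded.subset_closedBall (0 : E n)
  have hg0 : ∀ x : E n, x ∉ Metric.closedBall (0 : E n) R → gradient χ x = 0 := fun x hx => by
    unfold gradient
    rw [fderiv_of_notMem_tsupport (𝕜 := ℝ) fun h => hx (hR h)]; simp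
  obtain ⟨C, hC⟩ := (isCompact_closedBall (0 : E n) R).exists_bound_of_continuousOn hgc.continuousOn
  have hkm : Measurable fun z : E n × E n => w z.2 • kern A (z.1 - z.2) :=
    (hw.comp measurable_snd).smul (measurable_kern.comp (measurable_fst.sub measurable_snd))
  have hVm : Measurable fun x : E n => ∫⁻ y, ‖w y • kern A (x - y)‖ₑ := by
    have : Measurable fun z : E n × E n => ‖w z.2 • kern A (z.1 - z.2)‖ₑ := hkm.enorm
    exact this.lintegral_prod_right'
  set L : ℝ := (c + M) * K ^ ((2 - A) / n) with hL
  have hL0 : 0 ≤ L := by positivity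
  set Φ : E n × E n → ℝ := fun z => inner ℝ (w z.2 • kern A (z.1 - z.2)) (gradient χ z.1) with hΦ
  have hΦm : Measurable Φ := hkm.inner (hgc.measurable.comp measurable_fst)
  have hΦi : Integrable Φ (volume.prod volume) := by
    refine ⟨hΦm.aestronglyMeasurable, ?_⟩
    rw [hasFiniteIntegral_iff_enorm, lintegral_prod _ hΦm.enorm.aemeasurable]
    have : ∀ x : E n, ∫⁻ y, ‖Φ (x, y)‖ₑ ≤
        (Metric.closedBall (0 : E n) R).indicator (fun x => ENNReal.ofReal C * ∫⁻ y, ‖w y • kern A (x - y)‖ₑ) x := by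
      intro x
      by_cases hx : x ∈ Metric.closedBall (0 : E n) R
      · rw [indicator_of_mem hx, ← lintegral_const_mul' _ _ ENNReal.ofReal_ne_top]
        refine lintegral_mono fun y => ?_
        simp only [hΦ]
        rw [mul_comm]
        refine (enorm_inner_le _ _).trans ?_
        gcongr
        rw [← ofReal_norm]
        exact ENNReal.ofReal_le_ofReal (hC x hx)
      · have : ∀ y, Φ (x, y) = 0 := fun y => by simp only [hΦ, hg0 x hx, inner_zero_right]
        simp [this]
    refine (lintegral_mono this).trans_lt ?_
    rw [lintegral_indicator Metric.isClosed_closedBall.measurableSet, lintegral_const_mul' _ _ ENNReal.ofReal_ne_top]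
    exact ENNReal.mul_lt_top ENNReal.ofReal_lt_top (hloc R)
  have hfin : ∀ᵐ x, x ∈ Metric.closedBall (0 : E n) R → ∫⁻ y, ‖w y • kern A (x - y)‖ₑ < ⊤ := by
    rw [← ae_restrict_iff' Metric.isClosed_closedBall.measurableSet]
    exact ae_lt_top hVm (hloc R).ne
  have e1 : ∫ x, inner ℝ (∫ y, w y • kern A (x - y)) (gradient χ x) = ∫ x, ∫ y, Φ (x, y) := by
    refine integral_congr_ae ?_
    filter_upwards [hfin] with x hx
    by_cases hxR : x ∈ Metric.closedBall (0 : E n) R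
    · have hi : Integrable fun y => w y • kern A (x - y) :=
        ⟨(hkm.comp measurable_prodMk_left).aestronglyMeasurable, hx hxR⟩
      rw [real_inner_comm, ← integral_inner hi]
      exact integral_congr_ae (ae_of_all _ fun y => real_inner_comm _ _)
    · have : ∀ y, Φ (x, y) = 0 := fun y => by simp only [hΦ, hg0 x hxR, inner_zero_right]
      rw [hg0 x hxR]
      simp [this]
  have hpm : Measurable fun z : E n × E n => ‖z.1 - z.2‖ ^ (A - 2) :=
    (measurable_fst.sub measurable_snd).norm.pow_const _
  -- The scalar counterpart of `Φ`. Its integrability comes from the Riesz bound, that of `Φ` from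
  -- the assumed local integrability of the field; both are needed to exchange the integrals.
  set Ψ : E n × E n → ℝ := fun z => χ z.1 * (‖z.1 - z.2‖ ^ (A - 2) * w z.2) with hΨ
  have hΨm : Measurable Ψ := (hχ.continuous.measurable.comp measurable_fst).mul (hpm.mul (hw.comp measurable_snd))
  have hΨ0 : ∀ z, 0 ≤ Ψ z := fun z => mul_nonneg (hχ0 _) (mul_nonneg (by positivity) (hw0 _))
  have hriesz : ∀ x : E n, ∫⁻ y, ENNReal.ofReal (‖x - y‖ ^ (A - 2) * w y) ≤ ENNReal.ofReal L := by
    intro x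
    have := hc (fun y => ENNReal.ofReal (w y)) K M hK hM (hwK.mono fun y hy => ENNReal.ofReal_le_ofReal hy) hwM x
    rw [neg_sub] at this
    refine le_trans (le_of_eq (lintegral_congr fun y => ?_)) this
    rw [ENNReal.ofReal_mul (by positivity)]
  have hΨx : ∀ x : E n, ∫⁻ y, ENNReal.ofReal (Ψ (x, y)) ≤ ENNReal.ofReal L * ENNReal.ofReal (χ x) := by
    intro x
    simp only [hΨ]
    simp_rw [ENNReal.ofReal_mul (hχ0 x)]
    rw [lintegral_const_mul' _ _ ENNReal.ofReal_ne_top, mul_comm]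
    gcongr
    exact hriesz x
  have hχi : Integrable χ := hχ.continuous.integrable_of_hasCompactSupport hχc
  have hΨi : Integrable Ψ (volume.prod volume) := by
    refine ⟨hΨm.aestronglyMeasurable, ?_⟩
    rw [hasFiniteIntegral_iff_ofReal (ae_of_all _ hΨ0), lintegral_prod _ hΨm.ennreal_ofReal.aemeasurable]
    refine (lintegral_mono hΨx).trans_lt ?_
    rw [lintegral_const_mul' _ _ ENNReal.ofReal_ne_top, ← ofReal_integral_eq_lintegral_ofReal hχi (ae_of_all _ hχ0)]
    exact ENNReal.mul_lt_top ENNReal.ofReal_lt_top ENNReal.ofReal_lt_top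
  -- For fixed `y` this is the divergence identity of the kernel, tested with the translate of `χ`
  -- by `y`.
  have e2 : ∀ y : E n, - ∫ x, Φ (x, y) = (n + A - 2) * ∫ x, Ψ (x, y) := by
    intro y
    have h1 : ∫ x, Φ (x, y) = w y * ∫ x, inner ℝ (kern A x) (gradient (fun x => χ (x + y)) x) := by
      have hg : ∀ x, gradient (fun x => χ (x + y)) x = gradient χ (x + y) := fun x => by
        unfold gradient; rw [fderiv_comp_add_right]
      simp_rw [hg]
      have := integral_add_right_eq_self (μ := (volume : Measure (E n)))
        (fun x => inner ℝ (kern A (x - y)) (gradient χ x)) y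
      simp only [add_sub_cancel_right] at this
      rw [this, ← integral_const_mul]
      refine integral_congr_ae (ae_of_all _ fun x => ?_)
      simp only [hΦ, real_inner_smul_left]
    have h2 : ∫ x, Ψ (x, y) = w y * ∫ x, ‖x‖ ^ (A - 2) * χ (x + y) := by
      have := integral_add_right_eq_self (μ := (volume : Measure (E n)))
        (fun x => ‖x - y‖ ^ (A - 2) * χ x) y
      simp only [add_sub_cancel_right] at this
      rw [this, ← integral_const_mul]
      refine integral_congr_ae (ae_of_all _ fun x => ?_)
      simp only [hΨ]; ring
    have h3 := (integral_inner_kern_gradient hn hA (χ := fun x => χ (x + y)) (hχ.comp (contDiff_id.add contDiff_const))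
      (hχc.comp_homeomorph (Homeomorph.addRight y))).2
    rw [h1, h2, ← mul_neg, h3]; ring
  have e3 : - ∫ x, ∫ y, Φ (x, y) = (n + A - 2) * ∫ x, ∫ y, Ψ (x, y) := by
    rw [integral_integral_swap (f := fun x y => Φ (x, y)) hΦi, integral_integral_swap (f := fun x y => Ψ (x, y)) hΨi, ← integral_neg, ← integral_const_mul]
    exact integral_congr_ae (ae_of_all _ e2)
  rw [e1, e3, mul_assoc]
  refine mul_le_mul_of_nonneg_left ?_ (by linarith)
  rw [← integral_const_mul]
  refine integral_mono hΨi.integral_prod_left (hχi.const_mul L) fun x => ?_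
  simp only []
  rw [integral_eq_lintegral_of_nonneg_ae (ae_of_all _ fun y => hΨ0 _) (hΨm.comp measurable_prodMk_left).aestronglyMeasurable]
  refine ENNReal.toReal_le_of_le_ofReal (mul_nonneg hL0 (hχ0 x)) ?_
  rw [ENNReal.ofReal_mul hL0]
  exact hΨx x

/-! ### The drift: growth in space and divergence -/

/-- The drift generated by the density `u` for positive times. -/
noncomputable def drift (A : ℝ) (u : Z n → ℝ) (z : Z n) : E n :=
  if 0 < z.1 then ∫ y, u (z.1, y) • kern A (z.2 - y) else 0

/-- The absolute integral behind `drift`. -/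
noncomputable def absDrift (A : ℝ) (u : Z n → ℝ) (z : Z n) : ℝ≥0∞ :=
  ∫⁻ y, ‖u (z.1, y) • kern A (z.2 - y)‖ₑ

section drift
variable {A : ℝ} {u : Z n → ℝ}

theorem measurable_drift_integrand (hu : Measurable u) :
    Measurable fun p : Z n × E n => u (p.1.1, p.2) • kern A (p.1.2 - p.2) := by
  have h1 : Measurable fun p : Z n × E n => u (p.1.1, p.2) :=
    hu.comp ((measurable_fst.comp measurable_fst).prodMk measurable_snd)
  exact h1.smul (measurable_kern.comp ((measurable_snd.comp measurable_fst).sub measurable_snd))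

theorem measurable_absDrift (hu : Measurable u) : Measurable (absDrift A u) := by
  have := (measurable_drift_integrand (A := A) hu).enorm
  exact this.lintegral_prod_right'

theorem stronglyMeasurable_drift (hu : Measurable u) : StronglyMeasurable (drift A u) := by
  have := (measurable_drift_integrand (A := A) hu).stronglyMeasurable.integral_prod_right' (ν := (volume : Measure (E n)))
  exact StronglyMeasurable.ite (measurableSet_lt measurable_const measurable_fst) this stronglyMeasurable_const

theorem enorm_drift_le (z : Z n) : ‖drift A u z‖ₑ ≤ absDrift A u z := by
  unfold drift
  split_ifs
  · exact enorm_integral_le_lintegral_enorm _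
  · simp

theorem drift_of_nonpos {z : Z n} (h : z.1 ≤ 0) : drift A u z = 0 := if_neg (not_lt.2 h)

theorem measurableSet_cylinder (T R : ℝ) : MeasurableSet (cylinder n T R) :=
  measurableSet_Ioo.prod measurableSet_ball

theorem closedBall_inter_subset_cylinder (r : ℝ) {z : Z n} (hz : z ∈ Metric.closedBall (0 : Z n) r) (ht : 0 < z.1) :
    z ∈ cylinder n (r + 1) (r + 1) := by
  rw [Metric.mem_closedBall, dist_zero_right] at hz
  have h1 := (norm_fst_le z).trans hz
  have h2 := (norm_snd_le z).trans hz
  rw [Real.norm_of_nonneg ht.le] at h1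
  refine ⟨⟨ht, by linarith⟩, ?_⟩
  rw [Metric.mem_ball, dist_zero_right]; linarith

/-- Fields vanishing for nonpositive times and square integrable on cylinders. -/
theorem locL2_of_cylinder {F : Z n → E n} (hm : AEStronglyMeasurable F volume) (h0 : ∀ z, z.1 ≤ 0 → F z = 0)
    (h : ∀ T R : ℝ, 0 < T → 0 < R → ∫⁻ z in cylinder n T R, ‖F z‖ₑ ^ 2 < ⊤) : LocL2 F := by
  intro r
  refine ⟨hm.restrict, ?_⟩
  rw [eLpNorm_lt_top_iff_lintegral_rpow_enorm_lt_top two_ne_zero ENNReal.ofNat_ne_top]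
  simp only [ENNReal.toReal_ofNat, ENNReal.rpow_ofNat]
  refine lt_of_le_of_lt ?_ (h (|r| + 1) (|r| + 1) (by positivity) (by positivity))
  rw [← lintegral_indicator Metric.isClosed_closedBall.measurableSet, ← lintegral_indicator (measurableSet_cylinder _ _)]
  refine lintegral_mono fun z => ?_
  by_cases hz : z ∈ Metric.closedBall (0 : Z n) r
  · rw [indicator_of_mem hz]
    rcases le_or_gt z.1 0 with ht | ht
    · simp [h0 z ht]
    · rw [indicator_of_mem (closedBall_inter_subset_cylinder _ (Metric.closedBall_subset_closedBall (le_abs_self r) hz) ht)]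
  · simp [indicator_of_notMem hz]

theorem locL2_drift (hu : Measurable u)
    (hV : ∀ T R : ℝ, 0 < T → 0 < R → ∫⁻ z in cylinder n T R, absDrift A u z ^ 2 < ⊤) : LocL2 (drift A u) := by
  refine locL2_of_cylinder (stronglyMeasurable_drift hu).aestronglyMeasurable (fun z => drift_of_nonpos) fun T R hT hR => ?_
  exact (lintegral_mono fun z => by gcongr; exact enorm_drift_le z).trans_lt (hV T R hT hR)

theorem lintegral_cylinder_lt_top {T R : ℝ} {F : Z n → ℝ≥0∞}
    (hV : ∫⁻ z in cylinder n T R, F z ^ 2 < ⊤) : ∫⁻ z in cylinder n T R, F z < ⊤ := by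
  have hfin : volume (cylinder n T R) < ⊤ := by
    unfold cylinder
    rw [Measure.volume_eq_prod, Measure.prod_prod]
    exact ENNReal.mul_lt_top measure_Ioo_lt_top Metric.isBounded_ball.measure_lt_top
  have : ∀ z, F z ≤ 1 + F z ^ 2 := fun z => by
    rcases le_total (F z) 1 with h | h
    · exact h.trans le_self_add
    · rw [sq]; exact (le_mul_of_one_le_left' h).trans le_add_self
  refine (lintegral_mono this).trans_lt ?_
  rw [lintegral_add_left measurable_const]
  simp [hfin, hV]

theorem lintegral_cylinder (T R : ℝ) {F : Z n → ℝ≥0∞} (hF : Measurable F) :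
    ∫⁻ z in cylinder n T R, F z = ∫⁻ t in Ioo 0 T, ∫⁻ x in Metric.ball (0 : E n) R, F (t, x) := by
  unfold cylinder
  rw [Measure.volume_eq_prod, ← Measure.prod_restrict, lintegral_prod _ hF.aemeasurable]

/-- The drift grows at most linearly in space, with a time-integrable rate. -/
theorem exists_absDrift_rate (hn : 1 ≤ n) (hA : 2 - (n : ℝ) < A) (hA2 : A ≤ 2) (hu : Measurable u) (hu0 : ∀ z, 0 ≤ u z)
    {T K M : ℝ} (hT : 0 < T) (hK : 0 < K) (hM : 0 ≤ M)
    (hKM : ∀ᵐ t : ℝ, 0 < t → t < T → (∀ᵐ x : E n, u (t, x) ≤ K) ∧ ∫⁻ x, ENNReal.ofReal (u (t, x)) ≤ ENNReal.ofReal M)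
    (hV : ∀ T R : ℝ, 0 < T → 0 < R → ∫⁻ z in cylinder n T R, absDrift A u z ^ 2 < ⊤) :
    ∃ a : ℝ → ℝ≥0∞, ∫⁻ t in Ioo 0 T, a t < ⊤ ∧
      ∀ᵐ t : ℝ, 0 < t → t < T → ∀ x, absDrift A u (t, x) ≤ ENNReal.ofReal (1 + ‖x‖) * a t := by
  -- For `A ≤ 1` the kernel is dominated by a Riesz kernel of exponent `A - 1 ≤ 0` and the drift is
  -- bounded. For `A > 1` it grows like `|x|^(A-1)`, and the moment of order `A - 1` of the density
  -- must be controlled.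
  rcases le_or_gt A 1 with hA1 | hA1
  · obtain ⟨c, hc0, hc⟩ := exists_riesz_bound (n := n) hn (p := A - 1) (by linarith) (by linarith)
    refine ⟨fun _ => ENNReal.ofReal ((c + M) * K ^ (-(A - 1) / n)), by simp [ENNReal.mul_lt_top], ?_⟩
    filter_upwards [hKM] with t ht h0 hT x
    obtain ⟨h1, h2⟩ := ht h0 hT
    have := hc (fun y => ENNReal.ofReal (u (t, y))) K M hK hM (h1.mono fun y hy => ENNReal.ofReal_le_ofReal hy) h2 x
    refine ((lintegral_mono fun y => enorm_smul_kern_le (hu0 _) _).trans this).trans ?_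
    refine le_mul_of_one_le_left' ?_
    rw [ENNReal.one_le_ofReal]; linarith [norm_nonneg x]
  · have hp0 : 0 < A - 1 := by linarith
    have hp1 : A - 1 ≤ 1 := by linarith
    set b : ℝ → ℝ≥0∞ := fun t => ∫⁻ y : E n, ENNReal.ofReal (‖y‖ ^ (A - 1)) * ENNReal.ofReal (u (t, y)) with hb
    have hs : ∀ x y : E n, ‖x - y‖ ^ (A - 1) ≤ ‖x‖ ^ (A - 1) + ‖y‖ ^ (A - 1) := fun x y =>
      (Real.rpow_le_rpow (norm_nonneg _) (norm_sub_le _ _) hp0.le).trans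
        (Real.rpow_add_le_add_rpow (norm_nonneg _) (norm_nonneg _) hp0.le hp1)
    have hx1 : ∀ x : E n, ‖x‖ ^ (A - 1) ≤ 1 + ‖x‖ := fun x => by
      rcases le_total ‖x‖ 1 with h | h
      · linarith [Real.rpow_le_one (norm_nonneg x) h hp0.le, norm_nonneg x]
      · have := Real.rpow_le_rpow_of_exponent_le h hp1
        rw [Real.rpow_one] at this; linarith
    have hum : ∀ t, Measurable fun y : E n => ENNReal.ofReal (u (t, y)) := fun t => (hu.comp measurable_prodMk_left).ennreal_ofReal
    have hpm : Measurable fun y : E n => ‖y‖ ^ (A - 1) := measurable_norm.pow_const _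
    refine ⟨fun t => ENNReal.ofReal M + b t, ?_, ?_⟩
    · rw [lintegral_add_left measurable_const]
      refine ENNReal.add_lt_top.2 ⟨by simp [ENNReal.mul_lt_top], ?_⟩
      -- No moment is assumed. For `|x| ≤ 1` one has `|y|^(A-1) ≤ 1 + |x - y|^(A-1)`, so the moment
      -- is read off from the mass and the absolute drift integral on the unit ball, which is
      -- integrable in time by the definition of a solution.
      have hle : ∀ᵐ t : ℝ, t ∈ Ioo 0 T → b t * volume (Metric.ball (0 : E n) 1) ≤
          ∫⁻ x in Metric.ball (0 : E n) 1, (ENNReal.ofReal M + absDrift A u (t, x)) := by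
        filter_upwards [hKM] with t ht htT
        obtain ⟨-, h2⟩ := ht htT.1 htT.2
        rw [← setLIntegral_const]
        refine setLIntegral_mono' measurableSet_ball fun x hx => ?_
        rw [Metric.mem_ball, dist_zero_right] at hx
        have : ∀ y : E n, ENNReal.ofReal (‖y‖ ^ (A - 1)) * ENNReal.ofReal (u (t, y)) ≤
            ENNReal.ofReal (u (t, y)) + ‖u (t, y) • kern A (x - y)‖ₑ := by
          intro y
          have e : ‖u (t, y) • kern A (x - y)‖ₑ = ENNReal.ofReal (‖x - y‖ ^ (A - 1)) * ENNReal.ofReal (u (t, y)) := by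
            rcases eq_or_ne x y with rfl | hxy
            · simp [kern, Real.zero_rpow hp0.ne']
            · rw [enorm_smul, mul_comm, Real.enorm_eq_ofReal (hu0 _), ← ofReal_norm, norm_kern_of_ne (sub_ne_zero.2 hxy)]
          rw [e, ← one_add_mul]
          gcongr
          rw [← ENNReal.ofReal_one, ← ENNReal.ofReal_add zero_le_one (by positivity)]
          refine ENNReal.ofReal_le_ofReal ?_
          have h1 := hs x (x - y)
          rw [sub_sub_cancel] at h1
          have h2 := Real.rpow_le_one (norm_nonneg x) hx.le hp0.le
          linarith
        refine (lintegral_mono this).trans ?_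
        rw [lintegral_add_left (hum t)]
        exact add_le_add h2 le_rfl
      have hint : ∫⁻ t in Ioo 0 T, b t * volume (Metric.ball (0 : E n) 1) < ⊤ := by
        refine (setLIntegral_mono_ae' measurableSet_Ioo hle).trans_lt ?_
        rw [← lintegral_cylinder T 1 ((measurable_absDrift hu).const_add _)]
        rw [lintegral_add_left measurable_const]
        refine ENNReal.add_lt_top.2 ⟨?_, lintegral_cylinder_lt_top (hV T 1 hT one_pos)⟩
        have := lintegral_cylinder_lt_top (n := n) (T := T) (R := 1) (F := fun _ => ENNReal.ofReal M) (by
          unfold cylinder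
          rw [setLIntegral_const, Measure.volume_eq_prod, Measure.prod_prod]
          exact ENNReal.mul_lt_top (by simp) (ENNReal.mul_lt_top measure_Ioo_lt_top Metric.isBounded_ball.measure_lt_top))
        exact this
      rw [lintegral_mul_const' _ _ Metric.isBounded_ball.measure_lt_top.ne] at hint
      exact ENNReal.lt_top_of_mul_ne_top_left hint.ne (Metric.measure_ball_pos _ _ one_pos).ne'
    · filter_upwards [hKM] with t ht h0 hT x
      obtain ⟨-, h2⟩ := ht h0 hT
      have h1 : 1 ≤ ENNReal.ofReal (1 + ‖x‖) := by rw [ENNReal.one_le_ofReal]; linarith [norm_nonneg x]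
      calc absDrift A u (t, x) ≤ ∫⁻ y, (ENNReal.ofReal (1 + ‖x‖) * ENNReal.ofReal (u (t, y)) +
            ENNReal.ofReal (‖y‖ ^ (A - 1)) * ENNReal.ofReal (u (t, y))) := by
            refine lintegral_mono fun y => (enorm_smul_kern_le (hu0 _) _).trans ?_
            rw [← add_mul, ← ENNReal.ofReal_add (by positivity) (by positivity)]
            gcongr
            exact (hs x y).trans (by gcongr; exact hx1 x)
        _ = ENNReal.ofReal (1 + ‖x‖) * (∫⁻ y, ENNReal.ofReal (u (t, y))) + b t := by
            rw [lintegral_add_left ((hum t).const_mul _), lintegral_const_mul _ (hum t)]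
        _ ≤ ENNReal.ofReal (1 + ‖x‖) * ENNReal.ofReal M + ENNReal.ofReal (1 + ‖x‖) * b t := by
            gcongr
            exact le_mul_of_one_le_left' h1
        _ = _ := by rw [mul_add]

/-- The linear growth of the drift cancels against `1 + |x|`; what remains is the mass times a rate
that is integrable in time. -/
theorem integrableOn_drift (hn : 1 ≤ n) (hA : 2 - (n : ℝ) < A) (hA2 : A ≤ 2) (hu : Measurable u) (hu0 : ∀ z, 0 ≤ u z)
    {T K M : ℝ} (hT : 0 < T) (hK : 0 < K) (hM : 0 ≤ M)
    (hKM : ∀ᵐ t : ℝ, 0 < t → t < T → (∀ᵐ x : E n, u (t, x) ≤ K) ∧ ∫⁻ x, ENNReal.ofReal (u (t, x)) ≤ ENNReal.ofReal M)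
    (hV : ∀ T R : ℝ, 0 < T → 0 < R → ∫⁻ z in cylinder n T R, absDrift A u z ^ 2 < ⊤) :
    IntegrableOn (fun z => u z * ‖drift A u z‖ / (1 + ‖z.2‖)) {z : Z n | 0 < z.1 ∧ z.1 < T} volume := by
  obtain ⟨a, ha, hle⟩ := exists_absDrift_rate hn hA hA2 hu hu0 hT hK hM hKM hV
  have hm : Measurable fun z => u z * ‖drift A u z‖ / (1 + ‖z.2‖) :=
    (hu.mul (stronglyMeasurable_drift hu).measurable.norm).div (measurable_const.add measurable_snd.norm)
  refine ⟨hm.aestronglyMeasurable, ?_⟩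
  rw [hasFiniteIntegral_iff_ofReal (ae_of_all _ fun z => by have := hu0 z; positivity),
    ← lintegral_indicator (BoundedUpTo.measurableSet_slab T), Measure.volume_eq_prod,
    lintegral_prod _ ((hm.ennreal_ofReal.indicator (BoundedUpTo.measurableSet_slab T)).aemeasurable)]
  have key : ∀ᵐ t : ℝ, ∫⁻ x, {z : Z n | 0 < z.1 ∧ z.1 < T}.indicator (fun z => ENNReal.ofReal (u z * ‖drift A u z‖ / (1 + ‖z.2‖))) (t, x) ≤
      (Ioo 0 T).indicator (fun t => ENNReal.ofReal M * a t) t := by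
    filter_upwards [hle, hKM] with t ht hm
    by_cases htT : t ∈ Ioo 0 T
    · rw [indicator_of_mem htT]
      have hp : ∀ x : E n, {z : Z n | 0 < z.1 ∧ z.1 < T}.indicator (fun z => ENNReal.ofReal (u z * ‖drift A u z‖ / (1 + ‖z.2‖))) (t, x) ≤
          a t * ENNReal.ofReal (u (t, x)) := by
        intro x
        refine (indicator_le_self _ _ _).trans ?_
        have hx : 0 < 1 + ‖x‖ := by positivity
        change ENNReal.ofReal (u (t, x) * ‖drift A u (t, x)‖ / (1 + ‖x‖)) ≤ _
        rw [mul_div_assoc, ENNReal.ofReal_mul (hu0 _), mul_comm, ENNReal.ofReal_div_of_pos hx, ofReal_norm]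
        gcongr
        refine ENNReal.div_le_of_le_mul' ?_
        exact (enorm_drift_le _).trans (ht htT.1 htT.2 x)
      refine (lintegral_mono hp).trans ?_
      rw [lintegral_const_mul _ (show Measurable fun x => ENNReal.ofReal (u (t, x)) from
        (hu.comp measurable_prodMk_left).ennreal_ofReal), mul_comm]
      gcongr
      exact (hm htT.1 htT.2).2
    · have : ∀ x : E n, ((t, x) : Z n) ∉ {z : Z n | 0 < z.1 ∧ z.1 < T} := fun x hx => htT hx
      simp [indicator_of_notMem (this _)]
  refine (lintegral_mono_ae key).trans_lt ?_
  rw [lintegral_indicator measurableSet_Ioo, lintegral_const_mul' _ _ ENNReal.ofReal_ne_top]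
  exact ENNReal.mul_lt_top ENNReal.ofReal_lt_top ha

/-- The one-sided divergence bound for the drift. -/
theorem exists_divLE_drift (hn : 1 ≤ n) (hA : 2 - (n : ℝ) < A) (hA2 : A ≤ 2) :
    ∃ c : ℝ, 0 ≤ c ∧ ∀ (u : Z n → ℝ) (T K M : ℝ), Measurable u → (∀ z, 0 ≤ u z) → 0 < T → 0 < K → 0 ≤ M →
      (∀ᵐ t : ℝ, 0 < t → t < T → (∀ᵐ x : E n, u (t, x) ≤ K) ∧ ∫⁻ x, ENNReal.ofReal (u (t, x)) ≤ ENNReal.ofReal M) →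
      (∀ T R : ℝ, 0 < T → 0 < R → ∫⁻ z in cylinder n T R, absDrift A u z ^ 2 < ⊤) →
      DivLE (drift A u) ((n + A - 2) * ((c + M) * K ^ ((2 - A) / n))) T := by
  obtain ⟨c, hc0, hc⟩ := exists_conv_kern_div_le (n := n) hn hA hA2
  refine ⟨c, hc0, fun u T K M hu hu0 hT hK hM hKM hV ζ hζ hζ0 hζT => ?_⟩
  set Λ := (n + A - 2) * ((c + M) * K ^ ((2 - A) / n)) with hΛ
  have hΛ0 : 0 ≤ Λ := mul_nonneg (by linarith) (by positivity)
  obtain ⟨r, hr, hs⟩ := hζ.exists_radius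
  have hvl := locL2_drift hu hV
  have hi : Integrable (fun z => inner ℝ (drift A u z) (spaceGrad ζ z)) volume := by
    have := integrable_inner_of_memLp (hvl.memLp_indicator r) (hζ.memLp_spaceGrad 2)
    refine this.congr (ae_of_all _ fun z => ?_)
    by_cases hzr : z ∈ Metric.closedBall (0 : Z n) r
    · simp [indicator_of_mem hzr]
    · simp [(hs z hzr).2.1]
  have hζi : Integrable ζ volume := hζ.continuous.integrable_of_hasCompactSupport hζ.2
  -- Almost every time slice has an absolutely convergent drift integral on all balls
  -- simultaneously, so the spatial divergence bound applies slice by slice.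
  have hloc : ∀ᵐ t : ℝ, 0 < t → t < T → ∀ N : ℕ, ∫⁻ x in Metric.ball (0 : E n) (N + 1), absDrift A u (t, x) < ⊤ := by
    have : ∀ N : ℕ, ∀ᵐ t : ℝ, t ∈ Ioo 0 T → ∫⁻ x in Metric.ball (0 : E n) (N + 1), absDrift A u (t, x) < ⊤ := by
      intro N
      rw [← ae_restrict_iff' measurableSet_Ioo]
      have h1 := lintegral_cylinder_lt_top (hV T (N + 1) hT (by positivity))
      rw [lintegral_cylinder _ _ (measurable_absDrift hu)] at h1
      exact ae_lt_top (measurable_absDrift hu).lintegral_prod_right' h1.ne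
    filter_upwards [ae_all_iff.2 this] with t ht h0 hT N using ht N ⟨h0, hT⟩
  rw [Measure.volume_eq_prod] at hi hζi ⊢
  rw [integral_prod _ hi, integral_prod _ hζi, ← integral_neg, ← integral_const_mul]
  refine integral_mono_ae hi.integral_prod_left.neg (hζi.integral_prod_left.const_mul Λ) ?_
  filter_upwards [hloc, hKM] with t ht hm
  have hnn : 0 ≤ Λ * ∫ x, ζ (t, x) := mul_nonneg hΛ0 (integral_nonneg fun x => hζ0 _)
  rcases le_or_gt t 0 with h0 | h0
  · have : ∀ x : E n, drift A u (t, x) = 0 := fun x => drift_of_nonpos h0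
    simpa [this] using hnn
  rcases le_or_gt T t with hTt | hTt
  · have : ∀ x : E n, spaceGrad ζ (t, x) = 0 := fun x => by
      have : (fun y => ζ (t, y)) = fun _ => 0 := funext fun y => hζT _ hTt
      simp [spaceGrad, this, gradient]
    simpa [this] using hnn
  obtain ⟨h1, h2⟩ := hm h0 hTt
  have := hc (fun y => u (t, y)) K M hK hM (hu.comp measurable_prodMk_left) (fun y => hu0 _) h1 h2 (fun R => by
    obtain ⟨N, hN⟩ := exists_nat_ge R
    refine lt_of_le_of_lt (lintegral_mono_set ?_) (ht h0 hTt N)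
    exact Metric.closedBall_subset_ball (by linarith)) (fun x => ζ (t, x)) (hζ.1.comp (contDiff_const.prodMk contDiff_id))
    (by
      refine HasCompactSupport.intro (isCompact_closedBall (0 : E n) r) fun x hx => (hs (t, x) fun hz => hx ?_).1
      rw [Metric.mem_closedBall, dist_zero_right] at hz ⊢
      exact (norm_snd_le (t, x)).trans hz) (fun x => hζ0 _)
  simpa [drift, h0, spaceGrad] using this

end drift

/-! ### From weak solutions to flows on all of space-time -/

theorem mem_spaceTime {z : Z n} : z ∈ spaceTime n ↔ 0 < z.1 := by simp [spaceTime]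

theorem measurableSet_spaceTime : MeasurableSet (spaceTime n) := measurableSet_Ioi.prod MeasurableSet.univ

theorem cylinder_subset_spaceTime (T R : ℝ) : cylinder n T R ⊆ spaceTime n := fun _ hz => mem_spaceTime.2 hz.1.1

theorem ae_of_ae_fst {P : ℝ → Prop} (h : ∀ᵐ t : ℝ, P t) : ∀ᵐ z : Z n, P z.1 := by
  rw [Measure.volume_eq_prod]
  exact Measure.quasiMeasurePreserving_fst.ae h

theorem ae_of_ae_snd {P : E n → Prop} (h : ∀ᵐ x : E n, P x) : ∀ᵐ z : Z n, P z.2 := by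
  rw [Measure.volume_eq_prod]
  exact Measure.quasiMeasurePreserving_snd.ae h

theorem ae_spaceTime_slices {P : Z n → Prop} (h : ∀ᵐ z, z ∈ spaceTime n → P z) :
    ∀ᵐ t : ℝ, 0 < t → ∀ᵐ x : E n, P (t, x) := by
  rw [Measure.volume_eq_prod] at h
  filter_upwards [Measure.ae_ae_of_ae_prod h] with t ht h0
  filter_upwards [ht] with x hx using hx (mem_spaceTime.2 h0)

theorem ae_of_ae_slices {P : Z n → Prop} (hP : MeasurableSet {z | P z}) {S : Set ℝ} (hS : MeasurableSet S)
    (h : ∀ᵐ t : ℝ, t ∈ S → ∀ᵐ x : E n, P (t, x)) : ∀ᵐ z : Z n, z.1 ∈ S → P z := by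
  have hm : MeasurableSet {z : Z n | z.1 ∈ S → P z} := by
    have : {z : Z n | z.1 ∈ S → P z} = (Prod.fst ⁻¹' S)ᶜ ∪ {z | P z} := by
      ext z; simp [imp_iff_not_or]
    rw [this]
    exact (measurable_fst hS).compl.union hP
  rw [Measure.volume_eq_prod, Measure.ae_prod_iff_ae_ae hm]
  filter_upwards [h] with t ht
  by_cases hS : t ∈ S
  · filter_upwards [ht hS] with x hx _ using hx
  · exact ae_of_all _ fun x hx => absurd hx hS

theorem aestronglyMeasurable_spaceTime {F : Z n → E n}
    (h : ∀ T R : ℝ, 0 < T → 0 < R → AEStronglyMeasurable F (volume.restrict (cylinder n T R))) :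
    AEStronglyMeasurable F (volume.restrict (spaceTime n)) := by
  have : spaceTime n = ⋃ N : ℕ, cylinder n ((N : ℝ) + 1) ((N : ℝ) + 1) := by
    ext z
    simp only [mem_iUnion]
    refine ⟨fun hz => ?_, fun ⟨N, hN⟩ => cylinder_subset_spaceTime _ _ hN⟩
    obtain ⟨N, hN⟩ := exists_nat_ge (max z.1 ‖z.2‖)
    refine ⟨N, ⟨mem_spaceTime.1 hz, ?_⟩, ?_⟩
    · linarith [le_max_left z.1 ‖z.2‖]
    · rw [Metric.mem_ball, dist_zero_right]; linarith [le_max_right z.1 ‖z.2‖]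
  rw [this, aestronglyMeasurable_iUnion_iff]
  exact fun N => h _ _ (by positivity) (by positivity)

/-- A nonnegative density on all of space-time that solves the aggregation-diffusion equation for
positive times and is extended by its initial datum to the past. -/
structure AttractiveFlow (A m M₀ K₀ : ℝ) (u : Z n → ℝ) (G : Z n → E n) : Prop where
  toDriftDiffusion : DriftDiffusion m u G (drift A u)
  init_le : ∀ᵐ z : Z n, z.1 ≤ 0 → u z ≤ K₀
  init_mass : ∀ t : ℝ, t ≤ 0 → ∫⁻ x, ENNReal.ofReal (u (t, x)) ≤ ENNReal.ofReal M₀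
  bdd : ∀ T : ℝ, 0 < T → ∃ K : ℝ, 0 < K ∧ ∀ᵐ t : ℝ, 0 < t → t < T →
    (∀ᵐ x : E n, u (t, x) ≤ K) ∧ ∫⁻ x, ENNReal.ofReal (u (t, x)) ≤ ENNReal.ofReal K
  absDrift_sq : ∀ T R : ℝ, 0 < T → 0 < R → ∫⁻ z in cylinder n T R, absDrift A u z ^ 2 < ⊤

theorem integral_eq_spaceTime_add {F : Z n → ℝ} (hF : Integrable F volume) :
    ∫ z, F z = (∫ z in spaceTime n, F z) + ∫ x : E n, ∫ t in Iic (0 : ℝ), F (t, x) := by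
  rw [← integral_add_compl measurableSet_spaceTime hF]
  congr 1
  have : (spaceTime n)ᶜ = Iic (0 : ℝ) ×ˢ (univ : Set (E n)) := by
    ext z; simp [spaceTime]
  rw [this]
  have h2 : Integrable F ((volume.restrict (Iic (0 : ℝ))).prod (volume : Measure (E n))) := by
    have := hF.integrableOn (s := Iic (0 : ℝ) ×ˢ (univ : Set (E n)))
    rwa [IntegrableOn, Measure.volume_eq_prod, ← Measure.prod_restrict, Measure.restrict_univ] at this
  rw [Measure.volume_eq_prod, ← Measure.prod_restrict, Measure.restrict_univ]
  rw [integral_prod_symm _ h2]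

/-- This is how the initial condition is absorbed: a density frozen at its initial value in the past
contributes exactly the initial term of the weak formulation. -/
theorem IsTest.integral_past_timeDeriv {φ : Z n → ℝ} (h : IsTest φ) (x : E n) :
    ∫ t in Iic (0 : ℝ), timeDeriv φ (t, x) = φ (0, x) := by
  obtain ⟨r, hr, hs⟩ := h.exists_radius
  have hc : ContDiff ℝ 1 (fun t : ℝ => φ (t, x)) :=
    (h.1.comp (contDiff_id.prodMk contDiff_const)).of_le (by exact_mod_cast le_top)
  have hsupp : HasCompactSupport (fun t : ℝ => φ (t, x)) := by
    refine HasCompactSupport.intro (isCompact_closedBall (0 : ℝ) r) fun t ht => (hs (t, x) fun hz => ht ?_).1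
    rw [Metric.mem_closedBall, dist_zero_right] at hz ⊢
    exact (norm_fst_le (t, x)).trans hz
  exact hsupp.integral_Iic_deriv_eq hc 0

/-- Every global weak solution is represented by an `AttractiveFlow`. -/
theorem IsGlobalWeakSolution.exists_flow (hn : 1 ≤ n) {A m : ℝ} {ρ₀ : E n → ℝ} {ρ : ℝ → E n → ℝ}
    (h : IsGlobalWeakSolution A m ρ₀ ρ) (h0 : 0 ≤ᵐ[volume] ρ₀) (h1 : MemLp ρ₀ 1 volume) {M₀ K₀ : ℝ≥0}
    (hM : eLpNorm ρ₀ 1 volume ≤ M₀) (hK : eLpNorm ρ₀ ⊤ volume ≤ K₀) :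
    ∃ (u : Z n → ℝ) (G : Z n → E n), AttractiveFlow A m M₀ K₀ u G ∧
      ∀ᵐ t : ℝ, 0 < t → (fun x => u (t, x)) =ᵐ[volume] ρ t := by
  classical
  obtain ⟨G, ⟨hG2, hGw⟩, hweak⟩ := h.weak_form
  set r := h.measurable.mk with hr
  have hrm : Measurable r := h.measurable.stronglyMeasurable_mk.measurable
  have hrρ : ∀ᵐ z : Z n, z ∈ spaceTime n → ρ z.1 z.2 = r z := (ae_restrict_iff' measurableSet_spaceTime).1 h.measurable.ae_eq_mk
  set r₀ := h1.1.mk with hr₀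
  have hr₀m : Measurable r₀ := h1.1.stronglyMeasurable_mk.measurable
  have hr₀ρ : ρ₀ =ᵐ[volume] r₀ := h1.1.ae_eq_mk
  -- Measurable representatives, cut at zero so that measurability and positivity hold everywhere
  -- and not only almost everywhere; the initial datum is continued to the past.
  set u : Z n → ℝ := fun z => if 0 < z.1 then max (r z) 0 else max (r₀ z.2) 0 with hu
  have hum : Measurable u := Measurable.ite (measurableSet_lt measurable_const measurable_fst)
    (hrm.max measurable_const) ((hr₀m.comp measurable_snd).max measurable_const)
  have hu0 : ∀ z, 0 ≤ u z := fun z => by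
    simp only [hu]; split_ifs <;> exact le_max_right _ _
  have hposr : ∀ z : Z n, 0 < z.1 → u z = max (r z) 0 := fun z hz => if_pos hz
  have hslice : ∀ᵐ t : ℝ, 0 < t → (fun x => u (t, x)) =ᵐ[volume] ρ t := by
    filter_upwards [ae_spaceTime_slices hrρ, (ae_restrict_iff' measurableSet_Ioi).1 h.nonneg] with t ht hp h0
    filter_upwards [ht h0, hp h0] with x hx hpx
    simp only [hu, if_pos h0]
    change ρ t x = r (t, x) at hx
    rw [← hx, max_eq_left (show (0 : ℝ) ≤ ρ t x from hpx)]
  have hrpos : ∀ᵐ z : Z n, 0 < z.1 → 0 ≤ r z := by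
    refine ae_of_ae_slices (S := Ioi 0) (measurableSet_le measurable_const hrm) measurableSet_Ioi ?_
    filter_upwards [ae_spaceTime_slices hrρ, (ae_restrict_iff' measurableSet_Ioi).1 h.nonneg] with t ht hp h0
    filter_upwards [ht h0, hp h0] with x hx hpx
    change ρ t x = r (t, x) at hx
    rw [← hx]; exact hpx
  have huρ : ∀ᵐ z : Z n, z ∈ spaceTime n → u z = ρ z.1 z.2 := by
    filter_upwards [hrρ, hrpos] with z hz hp hzs
    have := mem_spaceTime.1 hzs
    rw [hposr z this, max_eq_left (hp this), hz hzs]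
  have hu₀ : ∀ t : ℝ, t ≤ 0 → (fun x => u (t, x)) =ᵐ[volume] ρ₀ := by
    intro t ht
    filter_upwards [hr₀ρ, h0] with x hx hx0
    simp only [hu, if_neg (not_lt.2 ht)]
    rw [← hx, max_eq_left (show (0 : ℝ) ≤ ρ₀ x from hx0)]
  have hbdd : ∀ T : ℝ, 0 < T → ∃ K : ℝ, 0 < K ∧ ∀ᵐ t : ℝ, 0 < t → t < T →
      (∀ᵐ x : E n, u (t, x) ≤ K) ∧ ∫⁻ x, ENNReal.ofReal (u (t, x)) ≤ ENNReal.ofReal K := by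
    intro T hT
    obtain ⟨K, hK⟩ := h.locBounded T hT
    refine ⟨K + 1, by positivity, ?_⟩
    have hKle : (K : ℝ≥0∞) ≤ ENNReal.ofReal (K + 1) := by
      rw [← ENNReal.ofReal_coe_nnreal]; exact ENNReal.ofReal_le_ofReal (by linarith)
    filter_upwards [hslice, (ae_restrict_iff' measurableSet_Ioo).1 hK] with t ht hKt h0 hT
    obtain ⟨k1, k2⟩ := hKt ⟨h0, hT⟩
    constructor
    · rw [eLpNorm_exponent_top] at k2
      filter_upwards [ht h0, ae_le_eLpNormEssSup (f := ρ t) (μ := volume)] with x hx hle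
      have h2 := hle.trans (k2.trans hKle)
      rw [← hx, Real.enorm_eq_ofReal (hu0 _)] at h2
      exact (ENNReal.ofReal_le_ofReal_iff (by positivity)).1 h2
    · rw [eLpNorm_one_eq_lintegral_enorm] at k1
      refine le_trans (le_of_eq ?_) (k1.trans hKle)
      refine lintegral_congr_ae ?_
      filter_upwards [ht h0] with x hx
      rw [← hx, Real.enorm_eq_ofReal (hu0 _)]
  have habs : ∀ᵐ z : Z n, 0 < z.1 → absDrift A u z = ∫⁻ y, ‖ρ z.1 y • gradient (potential A) (z.2 - y)‖ₑ := by
    filter_upwards [ae_of_ae_fst (n := n) hslice] with z hz h0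
    refine lintegral_congr_ae ?_
    filter_upwards [hz h0, gradient_potential_sub_ae (A := A) hn z.2] with y hy hk
    rw [hy, hk]
  have hvel : ∀ᵐ z : Z n, 0 < z.1 → drift A u z = velocity A ρ z.1 z.2 := by
    filter_upwards [ae_of_ae_fst (n := n) hslice] with z hz h0
    unfold drift velocity
    rw [if_pos h0]
    refine integral_congr_ae ?_
    filter_upwards [hz h0, gradient_potential_sub_ae (A := A) hn z.2] with y hy hk
    rw [hy, hk]
  have hV : ∀ T R : ℝ, 0 < T → 0 < R → ∫⁻ z in cylinder n T R, absDrift A u z ^ 2 < ⊤ := by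
    intro T R hT hR
    refine lt_of_eq_of_lt (setLIntegral_congr_fun_ae (measurableSet_cylinder T R) ?_) (h.velocity_locL2 T R hT hR)
    filter_upwards [habs] with z hz hzc
    rw [hz hzc.1.1]
  have hinit : ∀ᵐ z : Z n, z.1 ≤ 0 → u z ≤ K₀ := by
    rw [eLpNorm_exponent_top] at hK
    have : ∀ᵐ x : E n, max (r₀ x) 0 ≤ K₀ := by
      filter_upwards [hr₀ρ, ae_le_eLpNormEssSup (f := ρ₀) (μ := volume)] with x hx hle
      have h2 := hle.trans hK
      rw [hx, ← ofReal_norm, ← ENNReal.ofReal_coe_nnreal, ENNReal.ofReal_le_ofReal_iff (by positivity)] at h2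
      exact max_le ((Real.le_norm_self _).trans h2) (by positivity)
    filter_upwards [ae_of_ae_snd this] with z hz h0
    simp only [hu, if_neg (not_lt.2 h0)]; exact hz
  have hlb : LocBdd u := by
    intro R
    obtain ⟨K, hK0, hKb⟩ := hbdd (|R| + 1) (by positivity)
    have hz : ∀ᵐ z : Z n, z.1 ∈ Ioo 0 (|R| + 1) → u z ≤ K :=
      ae_of_ae_slices (measurableSet_le hum measurable_const) measurableSet_Ioo (hKb.mono fun t ht hm => (ht hm.1 hm.2).1)
    refine ⟨max K K₀, ?_⟩
    filter_upwards [hz, hinit] with z hz hi hzR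
    rw [abs_of_nonneg (hu0 z)]
    rcases le_or_gt z.1 0 with ht | ht
    · exact (hi ht).trans (le_max_right _ _)
    · refine (hz ⟨ht, ?_⟩).trans (le_max_left _ _)
      rw [Metric.mem_closedBall, dist_zero_right] at hzR
      have := (norm_fst_le z).trans hzR
      rw [Real.norm_of_nonneg ht.le] at this
      linarith [le_abs_self R]
  have hGm : AEStronglyMeasurable G (volume.restrict (spaceTime n)) :=
    aestronglyMeasurable_spaceTime fun T R hT hR => (hG2 T R hT hR).1
  -- The flux is given only for positive times and is set to zero before, which matches the
  -- extension of `u^m` by zero. No spatial regularity of the initial datum is therefore needed.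
  have hG'2 : LocL2 ((spaceTime n).indicator G) := by
    refine locL2_of_cylinder ((aestronglyMeasurable_indicator_iff measurableSet_spaceTime).2 hGm)
      (fun z hz => indicator_of_notMem (fun hm => not_lt.2 hz (mem_spaceTime.1 hm)) _) fun T R hT hR => ?_
    have := (hG2 T R hT hR).2
    rw [eLpNorm_lt_top_iff_lintegral_rpow_enorm_lt_top two_ne_zero ENNReal.ofNat_ne_top] at this
    simp only [ENNReal.toReal_ofNat, ENNReal.rpow_ofNat] at this
    refine lt_of_eq_of_lt (setLIntegral_congr_fun (measurableSet_cylinder T R) fun z hz => ?_) this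
    simp only [indicator_of_mem (cylinder_subset_spaceTime T R hz)]
  have hul2 : LocL2 u := hlb.locL2 hum.aestronglyMeasurable
  have hvl2 := locL2_drift (A := A) hum hV
  have hJ : LocL2 (fun z => (spaceTime n).indicator G z + u z • drift A u z) :=
    hG'2.add (hvl2.smul_bdd hum.aestronglyMeasurable hlb)
  refine ⟨u, (spaceTime n).indicator G, ⟨⟨hum, hu0, hlb, hG'2, hvl2, ?_, ?_⟩, hinit, ?_, hbdd, hV⟩, hslice⟩
  · intro φ hφ
    have h2 := hGw φ hφ
    have e1 : ∫ z : Z n, (if 0 < z.1 then u z ^ m else 0) • spaceGrad φ z = ∫ z in spaceTime n, (ρ z.1 z.2 ^ m) • spaceGrad φ z := by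
      rw [← integral_indicator measurableSet_spaceTime]
      refine integral_congr_ae ?_
      filter_upwards [huρ] with z hz
      by_cases hzs : z ∈ spaceTime n
      · rw [indicator_of_mem hzs, if_pos (mem_spaceTime.1 hzs), hz hzs]
      · rw [indicator_of_notMem hzs, if_neg (fun hh => hzs (mem_spaceTime.2 hh)), zero_smul]
    rw [e1, h2, ← integral_indicator measurableSet_spaceTime]
    congr 1
    refine integral_congr_ae (ae_of_all _ fun z => ?_)
    by_cases hzs : z ∈ spaceTime n <;> simp [hzs]
  · intro φ hφ
    obtain ⟨R, hR, hs⟩ := hφ.exists_radius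
    have i1 : Integrable (fun z => u z * timeDeriv φ z) volume :=
      hul2.locallyIntegrable.integrable_smul_right_of_hasCompactSupport hφ.continuous_timeDeriv hφ.hasCompactSupport_timeDeriv
    have i2 : Integrable (fun z => inner ℝ ((spaceTime n).indicator G z + u z • drift A u z) (spaceGrad φ z)) volume := by
      refine (integrable_inner_of_memLp (hJ.memLp_indicator R) (hφ.memLp_spaceGrad 2)).congr (ae_of_all _ fun z => ?_)
      by_cases hzr : z ∈ Metric.closedBall (0 : Z n) R
      · simp [indicator_of_mem hzr]
      · simp [(hs z hzr).2.1]
    -- Positive times reproduce the integral of the weak formulation; the past, where flux and drift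
    -- vanish, reproduces the term with the initial datum.
    refine (integral_eq_spaceTime_add (i1.sub i2)).trans (Eq.trans ?_ (hweak φ hφ))
    refine congrArg₂ (· + ·) ?_ ?_
    · refine setIntegral_congr_ae measurableSet_spaceTime ?_
      filter_upwards [huρ, hvel] with z hz hv hzs
      simp only [Pi.sub_apply]
      rw [indicator_of_mem hzs, hv (mem_spaceTime.1 hzs), hz hzs]
    · refine integral_congr_ae ?_
      filter_upwards [hu₀ 0 le_rfl] with x hx
      have : ∀ t ∈ Iic (0 : ℝ), u (t, x) * timeDeriv φ (t, x) -
          inner ℝ ((spaceTime n).indicator G (t, x) + u (t, x) • drift A u (t, x)) (spaceGrad φ (t, x)) = ρ₀ x * timeDeriv φ (t, x) := by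
        intro t ht
        have h3 : u (t, x) = ρ₀ x := by
          rw [← hx]; simp only [hu, if_neg (not_lt.2 (mem_Iic.1 ht)), lt_self_iff_false, if_false]
        rw [indicator_of_notMem (fun hm => not_lt.2 (mem_Iic.1 ht) (mem_spaceTime.1 hm)), drift_of_nonpos (mem_Iic.1 ht), h3]
        simp
      refine (setIntegral_congr_fun measurableSet_Iic this).trans ?_
      rw [integral_const_mul, hφ.integral_past_timeDeriv]
  · intro t ht
    rw [eLpNorm_one_eq_lintegral_enorm] at hM
    rw [ENNReal.ofReal_coe_nnreal]
    refine le_trans (le_of_eq ?_) hM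
    refine lintegral_congr_ae ?_
    filter_upwards [hu₀ t ht] with x hx
    rw [← hx, Real.enorm_eq_ofReal (hu0 _)]

/-! ### Conservation of mass -/

/-- Bounds for the second derivatives of the cutoffs. -/
theorem exists_gradient_fderiv_cutoff_bound (n : ℕ) (e : E n) : ∃ D : ℝ, 0 ≤ D ∧ ∀ (N : ℕ) (x : E n),
    ‖gradient (fun y => fderiv ℝ (cutoff n N) y e) x‖ ≤ D / ((N : ℝ) + 1) ^ 2 := by
  let b : ContDiffBump (0 : E n) := ⟨1, 2, zero_lt_one, one_lt_two⟩
  have hbc : ContDiff ℝ ((⊤ : ℕ∞) : WithTop ℕ∞) (b : E n → ℝ) := b.contDiff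
  set g : E n → ℝ := fun y => fderiv ℝ b y e with hg
  have hgc : ContDiff ℝ ((⊤ : ℕ∞) : WithTop ℕ∞) g := (hbc.fderiv_right (by simp)).clm_apply contDiff_const
  have hgs : HasCompactSupport g := b.hasCompactSupport.fderiv_apply ℝ e
  obtain ⟨D, hD⟩ := (hgs.fderiv (𝕜 := ℝ)).exists_bound_of_continuous (hgc.continuous_fderiv (by simp))
  have hD0 : 0 ≤ D := (norm_nonneg _).trans (hD 0)
  refine ⟨D, hD0, fun N x => ?_⟩
  have hlin := fun x : E n => (((N : ℝ) + 1)⁻¹ • ContinuousLinearMap.id ℝ (E n)).hasFDerivAt (x := x)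
  have h1 : (fun y => fderiv ℝ (cutoff n N) y e) = fun y => ((N : ℝ) + 1)⁻¹ * g (((N : ℝ) + 1)⁻¹ • y) := by
    funext y
    have hd : HasFDerivAt (cutoff n N) ((fderiv ℝ b (((N : ℝ) + 1)⁻¹ • y)).comp
        (((N : ℝ) + 1)⁻¹ • ContinuousLinearMap.id ℝ (E n))) y :=
      HasFDerivAt.comp y ((hbc.differentiable (by simp) _).hasFDerivAt) (hlin y)
    rw [hd.fderiv]; simp [hg]
  have hd : HasFDerivAt (fun y => ((N : ℝ) + 1)⁻¹ * g (((N : ℝ) + 1)⁻¹ • y)) (((N : ℝ) + 1)⁻¹ • ((fderiv ℝ g (((N : ℝ) + 1)⁻¹ • x)).comp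
      (((N : ℝ) + 1)⁻¹ • ContinuousLinearMap.id ℝ (E n)))) x :=
    (HasFDerivAt.comp x ((hgc.differentiable (by simp) _).hasFDerivAt) (hlin x)).const_mul _
  rw [h1]
  unfold gradient
  rw [LinearIsometryEquiv.norm_map, hd.fderiv, ContinuousLinearMap.comp_smul, ContinuousLinearMap.comp_id, norm_smul, norm_smul,
    norm_inv, Real.norm_of_nonneg (by positivity), ← mul_assoc, ← mul_inv, ← sq, div_eq_inv_mul]
  exact mul_le_mul_of_nonneg_left (hD _) (by positivity)

theorem gradient_fderiv_cutoff_eq_zero {N : ℕ} {x : E n} (e : E n) (hx : 2 * ((N : ℝ) + 1) < ‖x‖) :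
    gradient (fun y => fderiv ℝ (cutoff n N) y e) x = 0 := by
  have : (fun y => fderiv ℝ (cutoff n N) y e) =ᶠ[𝓝 x] fun _ => 0 := by
    filter_upwards [(isOpen_lt continuous_const continuous_norm).mem_nhds hx] with y hy
    have := gradient_cutoff_eq_zero hy
    unfold gradient at this
    rw [LinearIsometryEquiv.map_eq_zero_iff] at this
    rw [this]; simp
  unfold gradient
  rw [this.fderiv_eq]; simp

theorem exists_support_radius {η : ℝ → ℝ} (h : HasCompactSupport η) :
    ∃ r : ℝ, 0 < r ∧ ∀ t, r < |t| → η t = 0 ∧ deriv η t = 0 := by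
  obtain ⟨R, hR⟩ := h.isCompact.isBounded.subset_closedBall (0 : ℝ)
  refine ⟨|R| + 1, by positivity, fun t ht => ?_⟩
  have : t ∉ tsupport η := fun hm => by
    have := hR hm
    rw [Metric.mem_closedBall, dist_zero_right, Real.norm_eq_abs] at this
    linarith [le_abs_self R]
  exact ⟨image_eq_zero_of_notMem_tsupport this, image_eq_zero_of_notMem_tsupport fun hm => this (tsupport_deriv_subset hm)⟩

/-- Splitting a power of the density into a constant and a linear part, with optimal scaling. -/
theorem exists_rpow_split {m K ν : ℝ} (hm : 0 < m) (hK : 0 < K) (hm2 : ν * (1 - m) < 2) :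
    ∃ C p : ℝ, 0 ≤ C ∧ p < 2 ∧ ∀ L : ℝ, 1 ≤ L → ∃ α β : ℝ, 0 ≤ α ∧ 0 ≤ β ∧ α * L ^ ν ≤ C * L ^ p ∧ β ≤ C * L ^ p ∧
      ∀ w : ℝ, 0 ≤ w → w ≤ K → w ^ m ≤ α + β * w := by
  rcases le_or_gt 1 m with h1 | h1
  · refine ⟨K ^ (m - 1), 0, by positivity, by norm_num, fun L hL => ⟨0, K ^ (m - 1), le_rfl, by positivity, ?_, by simp, fun w hw hwK => ?_⟩⟩
    · simp; positivity
    · rcases hw.eq_or_lt with rfl | hw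
      · rw [Real.zero_rpow hm.ne']; simp
      · rw [zero_add, show m = (m - 1) + 1 by ring, Real.rpow_add_one hw.ne']
        simp only [add_sub_cancel_right]
        gcongr
  · refine ⟨1, ν * (1 - m), zero_le_one, hm2, fun L hL => ?_⟩
    have hL0 : 0 < L := by linarith
    -- For `m < 1`, below the threshold `w^m ≤ l^m`, above it `w^m ≤ l^(m-1) w`. With `l = L^(-ν)`
    -- both `l^m L^ν` and `l^(m-1)` equal `L^(ν (1-m))`.
    set l : ℝ := L ^ (-ν) with hl
    have hl0 : 0 < l := by positivity
    refine ⟨l ^ m, l ^ (m - 1), by positivity, by positivity, ?_, ?_, fun w hw hwK => ?_⟩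
    · rw [hl, ← Real.rpow_mul hL0.le, ← Real.rpow_add hL0, one_mul]
      exact le_of_eq (by congr 1; ring)
    · rw [hl, ← Real.rpow_mul hL0.le, one_mul]
      exact le_of_eq (by congr 1; ring)
    · rcases le_or_gt w l with hwl | hwl
      · have := Real.rpow_le_rpow hw hwl hm.le
        have : 0 ≤ l ^ (m - 1) * w := by positivity
        linarith
      · have hw0 := hl0.trans hwl
        have h2 : w ^ m = w ^ (m - 1) * w := by rw [← Real.rpow_add_one hw0.ne']; congr 1; ring
        have h3 := Real.rpow_le_rpow_of_nonpos hl0 hwl.le (by linarith : m - 1 ≤ 0)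
        have : 0 ≤ l ^ m := by positivity
        rw [h2]
        nlinarith

namespace AttractiveFlow
variable {A m M₀ K₀ : ℝ} {u : Z n → ℝ} {G : Z n → E n}

theorem measurableSet_window (r : ℝ) : MeasurableSet {z : Z n | |z.1| ≤ r} :=
  measurableSet_le (by fun_prop) measurable_const

/-- The density is integrable over bounded time intervals, and bounded there. -/
theorem integrableOn_window (h : AttractiveFlow A m M₀ K₀ u G) (r : ℝ) :
    IntegrableOn u {z : Z n | |z.1| ≤ r} volume := by
  have hu := h.toDriftDiffusion.measurable
  obtain ⟨K, hK, hb⟩ := h.bdd (|r| + 1) (by positivity)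
  refine ⟨hu.aestronglyMeasurable, ?_⟩
  rw [hasFiniteIntegral_iff_ofReal (ae_of_all _ h.toDriftDiffusion.nonneg), ← lintegral_indicator (measurableSet_window r),
    Measure.volume_eq_prod, lintegral_prod _ ((hu.ennreal_ofReal.indicator (measurableSet_window r)).aemeasurable)]
  have hle : ∀ᵐ t : ℝ, ∫⁻ x, {z : Z n | |z.1| ≤ r}.indicator (fun z => ENNReal.ofReal (u z)) (t, x) ≤
      (Icc (-r) r).indicator (fun _ => ENNReal.ofReal M₀ + ENNReal.ofReal K) t := by
    filter_upwards [hb] with t ht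
    by_cases htr : |t| ≤ r
    · rw [indicator_of_mem (show t ∈ Icc (-r) r from abs_le.1 htr)]
      refine (lintegral_mono fun x => indicator_le_self _ _ _).trans ?_
      rcases le_or_gt t 0 with h0 | h0
      · exact (h.init_mass t h0).trans le_self_add
      · refine (ht h0 ?_).2.trans le_add_self
        linarith [le_abs_self t, le_abs_self r]
    · have : ∀ x : E n, ((t, x) : Z n) ∉ {z : Z n | |z.1| ≤ r} := fun x hx => htr hx
      simp [indicator_of_notMem (this _)]
  refine (lintegral_mono_ae hle).trans_lt ?_
  rw [lintegral_indicator measurableSet_Icc, lintegral_const]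
  simp [ENNReal.mul_lt_top]

theorem exists_window_bound (h : AttractiveFlow A m M₀ K₀ u G) (r : ℝ) :
    ∃ K : ℝ, 0 < K ∧ ∀ᵐ z : Z n, 0 < z.1 → |z.1| ≤ r → u z ≤ K := by
  obtain ⟨K, hK, hb⟩ := h.bdd (|r| + 1) (by positivity)
  refine ⟨K, hK, ?_⟩
  have := ae_of_ae_slices (P := fun z : Z n => u z ≤ K) (measurableSet_le h.toDriftDiffusion.measurable measurable_const)
    (measurableSet_Ioo (a := 0) (b := |r| + 1)) (hb.mono fun t ht hm => (ht hm.1 hm.2).1)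
  filter_upwards [this] with z hz h0 hr
  exact hz ⟨h0, by linarith [le_abs_self z.1, le_abs_self r]⟩

/-- The diffusive flux through large spheres vanishes. -/
theorem tendsto_flux (h : AttractiveFlow A m M₀ K₀ u G) (hm : 0 < m) (hm2 : n * (1 - m) < 2) {η : ℝ → ℝ}
    (hη : ContDiff ℝ ((⊤ : ℕ∞) : WithTop ℕ∞) η) (hηc : HasCompactSupport η) (e : E n) :
    Tendsto (fun N : ℕ => ∫ z : Z n, (fderiv ℝ (cutoff n N) z.2 e * η z.1) • G z) atTop (𝓝 0) := by
  obtain ⟨r, hr, hη0⟩ := exists_support_radius hηc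
  obtain ⟨B, hB⟩ := hηc.exists_bound_of_continuous hη.continuous
  have hB0 : 0 ≤ B := (norm_nonneg _).trans (hB 0)
  obtain ⟨D, hD0, hD⟩ := exists_gradient_fderiv_cutoff_bound n e
  obtain ⟨K, hK, hKb⟩ := h.exists_window_bound r
  obtain ⟨C, p, hC0, hp, hsplit⟩ := exists_rpow_split (ν := n) hm hK hm2
  have hiu := h.integrableOn_window r
  have hu0 := h.toDriftDiffusion.nonneg
  set I : ℝ := ∫ z in {z : Z n | |z.1| ≤ r}, u z with hI
  have hI0 : 0 ≤ I := integral_nonneg hu0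
  set V : ℝ := volume.real (Metric.closedBall (0 : E n) 1) with hV
  have hV0 : 0 ≤ V := measureReal_nonneg
  have key : ∀ N : ℕ, ‖∫ z : Z n, (fderiv ℝ (cutoff n N) z.2 e * η z.1) • G z‖ ≤
      B * D * (2 * r * V * 2 ^ n + I) * C * ((N : ℝ) + 1) ^ (p - 2) := by
    intro N
    set L : ℝ := (N : ℝ) + 1 with hL
    have hL1 : 1 ≤ L := by simp [hL]
    have hL0 : 0 < L := by linarith
    obtain ⟨α, β, hα, hβ, hα2, hβ2, hw⟩ := hsplit L hL1
    have hχ : ContDiff ℝ ((⊤ : ℕ∞) : WithTop ℕ∞) (fun y => fderiv ℝ (cutoff n N) y e) :=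
      ((cutoff_contDiff N).fderiv_right (by simp)).clm_apply contDiff_const
    have hφ := isTest_prod hχ ((cutoff_hasCompactSupport N).fderiv_apply ℝ e) hη hηc
    -- Another integration by parts moves the gradient from `u^m` to the cutoff, whose second
    -- derivatives are of order `L^(-2)`.
    have hwg := h.toDriftDiffusion.weakGrad _ hφ
    rw [← norm_neg, ← hwg]
    set S : Set (Z n) := Icc (-r) r ×ˢ Metric.closedBall (0 : E n) (2 * L) with hS
    have hSm : MeasurableSet S := measurableSet_Icc.prod Metric.isClosed_closedBall.measurableSet
    have hSfin : volume S < ⊤ := by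
      rw [hS, Measure.volume_eq_prod, Measure.prod_prod]
      exact ENNReal.mul_lt_top measure_Icc_lt_top (isCompact_closedBall _ _).measure_lt_top
    have hSv : volume.real S = 2 * r * (V * (2 * L) ^ n) := by
      rw [hS, Measure.volume_eq_prod, measureReal_prod_prod, Real.volume_real_Icc_of_le (by linarith),
        Measure.addHaar_real_closedBall' _ _ (by positivity)]
      simp only [finrank_euclideanSpace, Fintype.card_fin, hV]; ring
    have hwm := measurableSet_window (n := n) r
    -- The constant part of `u^m` is integrated over a ball of volume of order `L^n`, the linear
    -- part against the mass. Both are of order `L^p` with `p < 2`, against the factor `L^(-2)`.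
    have hgi : Integrable (fun z => B * (D / L ^ 2) * (α * S.indicator (fun _ => (1 : ℝ)) z + β * {z : Z n | |z.1| ≤ r}.indicator u z)) volume := by
      refine Integrable.const_mul (Integrable.add (Integrable.const_mul ?_ _) (Integrable.const_mul ?_ _)) _
      · exact (integrable_indicator_iff hSm).2 (integrableOn_const hSfin.ne)
      · exact (integrable_indicator_iff hwm).2 hiu
    refine (norm_integral_le_of_norm_le hgi ?_).trans ?_
    · filter_upwards [hKb] with z hz
      rw [spaceGrad_prod (hχ.differentiable (by simp)), smul_smul, norm_smul]
      have hnn : 0 ≤ B * (D / L ^ 2) * (α * S.indicator (fun _ => (1 : ℝ)) z + β * {z : Z n | |z.1| ≤ r}.indicator u z) := by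
        have a1 : 0 ≤ S.indicator (fun _ => (1 : ℝ)) z := indicator_nonneg (fun _ _ => zero_le_one) _
        have a2 : 0 ≤ {z : Z n | |z.1| ≤ r}.indicator u z := indicator_nonneg (fun _ _ => hu0 _) _
        positivity
      by_cases ht : |z.1| ≤ r
      · by_cases hx : 2 * L < ‖z.2‖
        · rw [gradient_fderiv_cutoff_eq_zero e hx]; simpa using hnn
        · have hzS : z ∈ S := ⟨abs_le.1 ht, by rw [Metric.mem_closedBall, dist_zero_right]; linarith⟩
          have hzw : z ∈ {z : Z n | |z.1| ≤ r} := ht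
          rw [indicator_of_mem hzS, indicator_of_mem hzw, mul_one]
          rw [norm_mul]
          by_cases h0 : 0 < z.1
          · rw [if_pos h0, Real.norm_of_nonneg (Real.rpow_nonneg (hu0 z) m)]
            have a1 := hw (u z) (hu0 z) (hz h0 ht)
            have a2 := hB z.1
            have a3 := hD N z.2
            have a4 : 0 ≤ u z := hu0 z
            calc u z ^ m * ‖η z.1‖ * ‖gradient (fun y => fderiv ℝ (cutoff n N) y e) z.2‖
                ≤ (α + β * u z) * B * (D / L ^ 2) := by gcongr
              _ = _ := by ring
          · rw [if_neg h0]
            have a4 : 0 ≤ u z := hu0 z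
            simp; positivity
      · rw [(hη0 z.1 (not_le.1 ht)).1]; simpa using hnn
    · rw [integral_const_mul, integral_add (Integrable.const_mul ((integrable_indicator_iff hSm).2 (integrableOn_const hSfin.ne)) _)
        (Integrable.const_mul ((integrable_indicator_iff hwm).2 hiu) _), integral_const_mul, integral_const_mul,
        integral_indicator hwm, integral_indicator hSm, setIntegral_const, hSv, ← hI]
      have e1 : L ^ (p - 2) = L ^ p / L ^ 2 := by
        rw [Real.rpow_sub hL0, Real.rpow_two]
      have e2 : α * (2 * r * (V * (2 * L) ^ n)) = 2 * r * V * 2 ^ n * (α * L ^ (n : ℝ)) := by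
        rw [Real.rpow_natCast, mul_pow]; ring
      rw [smul_eq_mul, mul_one, e1, e2]
      calc B * (D / L ^ 2) * (2 * r * V * 2 ^ n * (α * L ^ (n : ℝ)) + β * I)
          ≤ B * (D / L ^ 2) * (2 * r * V * 2 ^ n * (C * L ^ p) + (C * L ^ p) * I) := by gcongr
        _ = _ := by ring
  have hlim : Tendsto (fun N : ℕ => B * D * (2 * r * V * 2 ^ n + I) * C * ((N : ℝ) + 1) ^ (p - 2)) atTop (𝓝 0) := by
    have h1 : Tendsto (fun N : ℕ => ((N : ℝ) + 1) ^ (-(2 - p))) atTop (𝓝 0) :=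
      (tendsto_rpow_neg_atTop (by linarith)).comp (tendsto_atTop_add_const_right _ _ tendsto_natCast_atTop_atTop)
    simpa [neg_sub] using h1.const_mul (B * D * (2 * r * V * 2 ^ n + I) * C)
  exact squeeze_zero_norm key hlim

/-- The gradient of the cutoff is expanded in an orthonormal basis, and each component is covered by
`tendsto_flux`. -/
theorem tendsto_flux_inner (h : AttractiveFlow A m M₀ K₀ u G) (hm : 0 < m) (hm2 : n * (1 - m) < 2) {η : ℝ → ℝ}
    (hη : ContDiff ℝ ((⊤ : ℕ∞) : WithTop ℕ∞) η) (hηc : HasCompactSupport η) :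
    Tendsto (fun N : ℕ => ∫ z : Z n, inner ℝ (G z) (η z.1 • gradient (cutoff n N) z.2)) atTop (𝓝 0) := by
  have hG := h.toDriftDiffusion.locL2_flux.locallyIntegrable
  let e : Fin n → E n := fun i => EuclideanSpace.basisFun (Fin n) ℝ i
  have hi : ∀ (N : ℕ) (i : Fin n), Integrable (fun z : Z n => (fderiv ℝ (cutoff n N) z.2 (e i) * η z.1) • G z) volume := by
    intro N i
    have hχ : ContDiff ℝ ((⊤ : ℕ∞) : WithTop ℕ∞) (fun y => fderiv ℝ (cutoff n N) y (e i)) :=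
      ((cutoff_contDiff N).fderiv_right (by simp)).clm_apply contDiff_const
    have hφ := isTest_prod hχ ((cutoff_hasCompactSupport N).fderiv_apply ℝ (e i)) hη hηc
    exact hG.integrable_smul_left_of_hasCompactSupport hφ.continuous hφ.2
  have hsum : ∀ N : ℕ, ∫ z : Z n, inner ℝ (G z) (η z.1 • gradient (cutoff n N) z.2) =
      ∑ i, inner ℝ (e i) (∫ z : Z n, (fderiv ℝ (cutoff n N) z.2 (e i) * η z.1) • G z) := by
    intro N
    simp_rw [← integral_inner (hi N _)]
    rw [← integral_finsetSum _ fun i _ => (hi N i).const_inner (e i)]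
    refine integral_congr_ae (ae_of_all _ fun z => ?_)
    simp only []
    rw [← OrthonormalBasis.sum_inner_mul_inner (EuclideanSpace.basisFun (Fin n) ℝ)]
    refine Finset.sum_congr rfl fun i _ => ?_
    have : fderiv ℝ (cutoff n N) z.2 (e i) = inner ℝ (e i) (gradient (cutoff n N) z.2) := by
      unfold gradient
      rw [real_inner_comm, InnerProductSpace.toDual_symm_apply]
    rw [real_inner_smul_right, real_inner_smul_right, this, real_inner_comm]
    ring
  simp_rw [hsum]
  have := tendsto_finsetSum (Finset.univ : Finset (Fin n)) fun i _ =>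
    ((tendsto_const_nhds (x := e i)).inner (𝕜 := ℝ) (h.tendsto_flux hm hm2 hη hηc (e i)))
  simpa using this

/-- Dominated convergence: `u |v| / (1 + |x|)` is integrable, while `|∇χ_N| (1 + |x|)` is bounded
and tends to zero pointwise. -/
theorem tendsto_drift_inner (h : AttractiveFlow A m M₀ K₀ u G) (hn : 1 ≤ n) (hA : 2 - (n : ℝ) < A) (hA2 : A ≤ 2) {η : ℝ → ℝ}
    (hη : ContDiff ℝ ((⊤ : ℕ∞) : WithTop ℕ∞) η) (hηc : HasCompactSupport η) :
    Tendsto (fun N : ℕ => ∫ z : Z n, inner ℝ (u z • drift A u z) (η z.1 • gradient (cutoff n N) z.2)) atTop (𝓝 0) := by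
  obtain ⟨r, hr, hη0⟩ := exists_support_radius hηc
  obtain ⟨B, hB⟩ := hηc.exists_bound_of_continuous hη.continuous
  have hB0 : 0 ≤ B := (norm_nonneg _).trans (hB 0)
  have hu0 := h.toDriftDiffusion.nonneg
  have hum := h.toDriftDiffusion.measurable
  obtain ⟨C, hC0, hC⟩ := exists_gradient_cutoff_bound n
  obtain ⟨K, hK, hKb⟩ := h.bdd (r + 1) (by positivity)
  have hF := integrableOn_drift hn hA hA2 hum hu0 (by positivity) hK hK.le hKb h.absDrift_sq
  set F : Z n → ℝ := fun z => u z * ‖drift A u z‖ / (1 + ‖z.2‖) with hFdef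
  have hFm : Measurable F :=
    (hum.mul (stronglyMeasurable_drift hum).measurable.norm).div (measurable_const.add measurable_snd.norm)
  have hF0 : ∀ z, 0 ≤ F z := fun z => by have := hu0 z; positivity
  have hF' : IntegrableOn F {z : Z n | z.1 < r + 1} volume := by
    refine BoundedUpTo.integrableOn_of_le (c := 1) hF hFm.aestronglyMeasurable (fun z hz => ?_) (ae_of_all _ fun z _ _ => ?_)
    · simp [hFdef, drift_of_nonpos hz]
    · rw [one_mul, abs_of_nonneg (hF0 z)]
  set a : ℕ → Z n → ℝ := fun N z => ‖gradient (cutoff n N) z.2‖ * (1 + ‖z.2‖) * |η z.1| with ha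
  have hac : ∀ N, Continuous (a N) := fun N => by
    have := continuous_gradient_cutoff (n := n) N
    have := hη.continuous
    simp only [ha]; fun_prop
  have ha0 : ∀ N z, 0 ≤ a N z := fun N z => by simp only [ha]; positivity
  have haB : ∀ N z, |a N z| ≤ C * B := fun N z => by
    rw [abs_of_nonneg (ha0 N z)]
    exact mul_le_mul (hC N z.2).2 (hB z.1) (abs_nonneg _) hC0
  have haT : ∀ N z, r + 1 ≤ z.1 → a N z = 0 := fun N z hz => by
    simp [ha, (hη0 z.1 (by linarith [le_abs_self z.1])).1]
  have hlim : ∀ z, Tendsto (fun N => a N z) atTop (𝓝 0) := by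
    intro z
    have h1 : Tendsto (fun N : ℕ => C / ((N : ℝ) + 1)) atTop (𝓝 0) := by
      have := (tendsto_one_div_add_atTop_nhds_zero_nat (𝕜 := ℝ)).const_mul C
      simpa [div_eq_mul_inv] using this
    have h2 := squeeze_zero (fun _ => norm_nonneg _) (fun N => (hC N z.2).1) h1
    simpa [ha] using (h2.mul_const (1 + ‖z.2‖)).mul_const |η z.1|
  have t1 := tendsto_integral_weight hF' hac haB haT hlim
  simp only [mul_zero, integral_zero] at t1
  refine squeeze_zero_norm (fun N => ?_) t1
  refine norm_integral_le_of_norm_le ?_ (ae_of_all _ fun z => ?_)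
  · have hi := (integrable_indicator_iff (measurableSet_lt measurable_fst measurable_const)).2 hF'
    refine (hi.mul_bdd (c := C * B) (hac N).aestronglyMeasurable (ae_of_all _ fun z => haB N z)).congr (ae_of_all _ fun z => ?_)
    by_cases hz : z.1 < r + 1
    · simp [hz]
    · simp [haT N z (not_lt.1 hz)]
  · refine (norm_inner_le_norm _ _).trans (le_of_eq ?_)
    rw [norm_smul, norm_smul, Real.norm_of_nonneg (hu0 z)]
    simp only [hFdef, ha, Real.norm_eq_abs]
    have : 1 + ‖z.2‖ ≠ 0 := by positivity
    field_simp

/-- Conservation of mass, in the sense of distributions in time. -/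
theorem integral_mul_deriv_eq_zero (h : AttractiveFlow A m M₀ K₀ u G) (hn : 1 ≤ n) (hA : 2 - (n : ℝ) < A) (hA2 : A ≤ 2)
    (hm : 0 < m) (hm2 : n * (1 - m) < 2) {η : ℝ → ℝ}
    (hη : ContDiff ℝ ((⊤ : ℕ∞) : WithTop ℕ∞) η) (hηc : HasCompactSupport η) :
    ∫ z : Z n, u z * deriv η z.1 = 0 := by
  obtain ⟨r, hr, hη0⟩ := exists_support_radius hηc
  have hdd := h.toDriftDiffusion
  have hdc : Continuous (deriv η) := hη.continuous_deriv (by simp)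
  obtain ⟨B, hB⟩ := hηc.deriv.exists_bound_of_continuous hdc
  have hwm := measurableSet_window (n := n) r
  set F : Z n → ℝ := {z : Z n | |z.1| ≤ r}.indicator u with hF
  have hFi : Integrable F volume := (integrable_indicator_iff hwm).2 (h.integrableOn_window r)
  have hFu : ∀ (z : Z n) (c : ℝ), F z * (c * deriv η z.1) = u z * (c * deriv η z.1) := by
    intro z c
    by_cases hz : |z.1| ≤ r
    · have : z ∈ {z : Z n | |z.1| ≤ r} := hz
      rw [hF, indicator_of_mem this]
    · rw [(hη0 _ (not_le.1 hz)).2]; simp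
  have t1 := tendsto_integral_weight (hFi.integrableOn (s := {z : Z n | z.1 < r + 1}))
    (a := fun N z => cutoff n N z.2 * deriv η z.1) (a₀ := fun z => 1 * deriv η z.1) (B := B)
    (fun N => ((cutoff_contDiff N).continuous.comp continuous_snd).mul (hdc.comp continuous_fst))
    (fun N z => by
      rw [abs_mul, abs_of_nonneg (cutoff_nonneg N z.2)]
      exact (mul_le_of_le_one_left (abs_nonneg _) (cutoff_le_one N z.2)).trans (hB z.1))
    (fun N z hz => by rw [(hη0 z.1 (by linarith [le_abs_self z.1])).2, mul_zero])
    (fun z => (tendsto_cutoff z.2).mul_const _)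
  simp_rw [hFu, one_mul] at t1
  have t2 := (h.tendsto_flux_inner hm hm2 hη hηc).add (h.tendsto_drift_inner hn hA hA2 hη hηc)
  rw [add_zero] at t2
  refine tendsto_nhds_unique t1 (t2.congr fun N => ?_)
  have hφ := isTest_prod (cutoff_contDiff (n := n) N) (cutoff_hasCompactSupport N) hη hηc
  have hg : ∀ z, spaceGrad (fun z : Z n => cutoff n N z.2 * η z.1) z = η z.1 • gradient (cutoff n N) z.2 :=
    spaceGrad_prod ((cutoff_contDiff N).differentiable (by simp))
  obtain ⟨R, hR, hs⟩ := hφ.exists_radius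
  have hint : ∀ {J : Z n → E n}, LocL2 J → Integrable (fun z => inner ℝ (J z) (η z.1 • gradient (cutoff n N) z.2)) volume := by
    intro J hJ
    simp_rw [← hg]
    refine (integrable_inner_of_memLp (hJ.memLp_indicator R) (hφ.memLp_spaceGrad 2)).congr (ae_of_all _ fun z => ?_)
    by_cases hzr : z ∈ Metric.closedBall (0 : Z n) R
    · simp [indicator_of_mem hzr]
    · simp [(hs z hzr).2.1]
  have i1 := hint hdd.locL2_flux
  have i2 := hint (hdd.locL2_drift.smul_bdd hdd.measurable.aestronglyMeasurable hdd.locBdd)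
  have i0 : Integrable (fun z : Z n => u z * (cutoff n N z.2 * deriv η z.1)) volume := by
    have := hdd.locL2_u.locallyIntegrable.integrable_smul_right_of_hasCompactSupport hφ.continuous_timeDeriv hφ.hasCompactSupport_timeDeriv
    refine this.congr (ae_of_all _ fun z => ?_)
    simp only [timeDeriv_prod, smul_eq_mul]
  have hev := hdd.evolution _ hφ
  simp_rw [timeDeriv_prod, hg, inner_add_left] at hev
  have h1 := (integral_sub i0 (i1.add i2)).symm.trans hev
  have h2 := integral_add i1 i2
  simp only [Pi.add_apply] at h1
  linarith

/-- The mass never exceeds the initial mass. -/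
theorem mass_le (h : AttractiveFlow A m M₀ K₀ u G) (hM : 0 ≤ M₀) (hn : 1 ≤ n) (hA : 2 - (n : ℝ) < A) (hA2 : A ≤ 2)
    (hm : 0 < m) (hm2 : n * (1 - m) < 2) :
    ∀ᵐ t : ℝ, ∫⁻ x, ENNReal.ofReal (u (t, x)) ≤ ENNReal.ofReal M₀ := by
  have hum := h.toDriftDiffusion.measurable
  have hu0 := h.toDriftDiffusion.nonneg
  set y : ℝ → ℝ := fun t => ∫ x, u (t, x) with hy
  have hwi : ∀ r : ℝ, IntegrableOn y (Icc (-r) r) volume := by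
    intro r
    have h1 : Integrable ({z : Z n | |z.1| ≤ r}.indicator u) ((volume : Measure ℝ).prod volume) :=
      (integrable_indicator_iff (measurableSet_window r)).2 (h.integrableOn_window r)
    have h2 := h1.integral_prod_left.integrableOn (s := Icc (-r) r)
    refine h2.congr_fun (fun t ht => ?_) measurableSet_Icc
    refine integral_congr_ae (ae_of_all _ fun x => ?_)
    have : ((t, x) : Z n) ∈ {z : Z n | |z.1| ≤ r} := abs_le.2 ht
    simp only [indicator_of_mem this]
  have hloc : LocallyIntegrable (fun t => y t - M₀) volume := by
    refine LocallyIntegrable.sub ?_ (locallyIntegrable_const M₀)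
    rw [locallyIntegrable_iff]
    intro S hS
    obtain ⟨R, hR⟩ := hS.isBounded.subset_closedBall (0 : ℝ)
    refine (hwi R).mono_set (hR.trans ?_)
    rw [Real.closedBall_eq_Icc]; simp
  have hfin : ∀ᵐ t : ℝ, ∫⁻ x, ENNReal.ofReal (u (t, x)) < ⊤ := by
    have : ∀ N : ℕ, ∀ᵐ t : ℝ, 0 < t → t < (N : ℝ) + 1 → ∫⁻ x, ENNReal.ofReal (u (t, x)) < ⊤ := by
      intro N
      obtain ⟨K, hK, hb⟩ := h.bdd (N + 1) (by positivity)
      filter_upwards [hb] with t ht h0 hN using (ht h0 hN).2.trans_lt ENNReal.ofReal_lt_top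
    filter_upwards [ae_all_iff.2 this] with t ht
    rcases le_or_gt t 0 with h0 | h0
    · exact (h.init_mass t h0).trans_lt ENNReal.ofReal_lt_top
    · obtain ⟨N, hN⟩ := exists_nat_ge t
      exact ht N h0 (by linarith)
  have hylint : ∀ t, y t = (∫⁻ x, ENNReal.ofReal (u (t, x))).toReal := fun t =>
    integral_eq_lintegral_of_nonneg_ae (ae_of_all _ fun x => hu0 _) (hum.comp measurable_prodMk_left).aestronglyMeasurable
  have hN : ∀ N : ℕ, ∀ᵐ t : ℝ, t < N → y t - M₀ ≤ 0 := by
    intro N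
    -- Conservation of mass makes the mass minus `M₀` have zero derivative; it is nonpositive in the
    -- past, where the density is the initial datum.
    refine ae_nonpos_of_distributional_ode hloc (μ := 0) (fun η hη hηc _ _ => ?_) (ae_of_all _ fun t ht => ?_)
    · have hdc : Continuous (deriv η) := hη.continuous_deriv (by simp)
      have i1 : Integrable (fun t => y t * deriv η t) volume := by
        refine LocallyIntegrable.integrable_smul_right_of_hasCompactSupport (f := y) ?_ hdc hηc.deriv
        have := hloc.add (locallyIntegrable_const M₀)
        refine this.congr (ae_of_all _ fun t => ?_)
        simp
      have i2 : Integrable (fun t => M₀ * deriv η t) volume := (hdc.integrable_of_hasCompactSupport hηc.deriv).const_mul _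
      have e1 : ∫ t, deriv η t = 0 := by
        have := integral_of_hasDerivAt_of_tendsto (f := η) (f' := deriv η) (m := 0) (n := 0)
          (fun t => (hη.differentiable (by simp) t).hasDerivAt) (hdc.integrable_of_hasCompactSupport hηc.deriv)
          (hηc.is_zero_at_infty.mono_left atBot_le_cocompact)
          (hηc.is_zero_at_infty.mono_left atTop_le_cocompact)
        simpa using this
      have e2 : ∫ t, y t * deriv η t = 0 := by
        rw [← h.integral_mul_deriv_eq_zero hn hA hA2 hm hm2 hη hηc]
        obtain ⟨r, hr, hη0⟩ := exists_support_radius hηc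
        obtain ⟨B, hB⟩ := hηc.deriv.exists_bound_of_continuous hdc
        have h1 : Integrable ({z : Z n | |z.1| ≤ r}.indicator u) ((volume : Measure ℝ).prod volume) :=
          (integrable_indicator_iff (measurableSet_window r)).2 (h.integrableOn_window r)
        have h2 : Integrable (fun z : Z n => u z * deriv η z.1) ((volume : Measure ℝ).prod volume) := by
          refine (h1.mul_bdd (c := B) (hdc.comp continuous_fst).aestronglyMeasurable (ae_of_all _ fun z => hB z.1)).congr (ae_of_all _ fun z => ?_)
          by_cases hz : |z.1| ≤ r
          · simp [hz]
          · simp [(hη0 _ (not_le.1 hz)).2]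
        rw [Measure.volume_eq_prod, integral_prod _ h2]
        refine integral_congr_ae (ae_of_all _ fun t => ?_)
        simp only [hy]
        rw [integral_mul_const]
      simp_rw [sub_mul]
      rw [integral_sub i1 i2, e2, integral_const_mul, e1]
      simp
    · rw [sub_nonpos, hylint]
      exact ENNReal.toReal_le_of_le_ofReal hM (h.init_mass t ht.le)
  filter_upwards [ae_all_iff.2 hN, hfin] with t ht hf
  obtain ⟨N, hN⟩ := exists_nat_gt t
  have := ht N hN
  rw [sub_nonpos, hylint] at this
  rw [← ENNReal.ofReal_toReal hf.ne]
  exact ENNReal.ofReal_le_ofReal this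

end AttractiveFlow

/-! ### The bound uniform in time -/

/-- In the diffusion-dominated range the smallness condition of the De Giorgi iteration holds for
all large bounds. -/
theorem exists_smallness_threshold (hn : 2 ≤ n) {A m c M S : ℝ}
    (hm0 : 0 < m) (hm : 1 - A / (n : ℝ) < m) (hM : 0 < M) :
    ∃ K₁ : ℝ, 0 < K₁ ∧ ∀ K : ℝ, K₁ ≤ K →
      4096 * S ^ 2 * ((n + A - 2) * ((c + M) * K ^ ((2 - A) / n))) * (M / K) ^ (2 / (n : ℝ)) ≤
        m * min (K ^ (m - 1)) ((K / 4) ^ (m - 1)) * 8 ^ (-((n : ℝ) / 2)) := by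
  have hn0 : (0 : ℝ) < n := by exact_mod_cast (by omega : 0 < n)
  set B : ℝ := 4096 * S ^ 2 * ((n + A - 2) * (c + M)) * M ^ (2 / (n : ℝ)) with hB
  set κ : ℝ := min 1 ((1 / 4) ^ (m - 1)) with hκ
  have hκ0 : 0 < κ := lt_min one_pos (by positivity)
  set e : ℝ := m * κ * 8 ^ (-((n : ℝ) / 2)) with he
  have he0 : 0 < e := by positivity
  -- The left side is of order `K^((2-A)/n - 2/n) = K^(-A/n)`, the right side of order `K^(m-1)`;
  -- the condition on `m` says that the right side wins for large `K`.
  have hγ : 0 < m - 1 + A / n := by linarith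
  obtain ⟨K₁, hK₁⟩ := (eventually_atTop.1 ((tendsto_rpow_atTop hγ).eventually_ge_atTop (B / e)))
  refine ⟨max K₁ 1, by positivity, fun K hK => ?_⟩
  have hK0 : 0 < K := lt_of_lt_of_le one_pos ((le_max_right _ _).trans hK)
  have h1 := hK₁ K ((le_max_left _ _).trans hK)
  rw [div_le_iff₀ he0] at h1
  have e1 : min (K ^ (m - 1)) ((K / 4) ^ (m - 1)) = K ^ (m - 1) * κ := by
    rw [hκ, mul_min_of_nonneg _ _ (by positivity), mul_one, ← Real.mul_rpow hK0.le (by norm_num), mul_one_div]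
  have e2 : (M / K) ^ (2 / (n : ℝ)) = M ^ (2 / (n : ℝ)) * K ^ (-(2 / (n : ℝ))) := by
    rw [Real.div_rpow hM.le hK0.le, Real.rpow_neg hK0.le, div_eq_mul_inv]
  have e3 : K ^ ((2 - A) / n) * K ^ (-(2 / (n : ℝ))) = K ^ (-(A / n)) := by
    rw [← Real.rpow_add hK0]; congr 1; ring
  have e4 : K ^ (m - 1 + A / n) * K ^ (-(A / n)) = K ^ (m - 1) := by
    rw [← Real.rpow_add hK0]; congr 1; ring
  rw [e1, e2]
  calc 4096 * S ^ 2 * ((n + A - 2) * ((c + M) * K ^ ((2 - A) / n))) * (M ^ (2 / (n : ℝ)) * K ^ (-(2 / (n : ℝ))))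
      = B * (K ^ ((2 - A) / n) * K ^ (-(2 / (n : ℝ)))) := by rw [hB]; ring
    _ = B * K ^ (-(A / n)) := by rw [e3]
    _ ≤ K ^ (m - 1 + A / n) * e * K ^ (-(A / n)) := by gcongr
    _ = (K ^ (m - 1 + A / n) * K ^ (-(A / n))) * e := by ring
    _ = _ := by rw [e4, he]; ring

/-- The density is bounded uniformly in time, by a constant depending only on the data. -/
theorem exists_flow_bound (hn : 2 ≤ n) {A m M₀ K₀ : ℝ} (hA : 2 - (n : ℝ) < A) (hA2 : A ≤ 2)
    (hm : 1 - A / (n : ℝ) < m) (hM : 0 ≤ M₀) :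
    ∃ C : ℝ, 0 ≤ C ∧ ∀ (u : Z n → ℝ) (G : Z n → E n), AttractiveFlow A m M₀ K₀ u G → ∀ᵐ z, u z ≤ C := by
  have hn0 : (0 : ℝ) < n := by exact_mod_cast (by omega : 0 < n)
  have hn2 : (2 : ℝ) ≤ n := by exact_mod_cast hn
  have hn1 : 1 ≤ n := by omega
  have hm0 : 0 < m := by
    have : A / n ≤ 1 := by rw [div_le_one hn0]; linarith
    linarith
  have hm2 : n * (1 - m) < 2 := by
    have h1 : 1 - m < A / n := by linarith
    rw [lt_div_iff₀ hn0] at h1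
    linarith
  obtain ⟨c, hc0, hc⟩ := exists_divLE_drift (n := n) hn1 hA hA2
  -- The iteration requires a positive mass bound, while `M₀` may be zero.
  have hM1 : 0 < M₀ + 1 := by linarith
  obtain ⟨K₁, hK₁0, hK₁⟩ := exists_smallness_threshold (n := n) hn (c := c) (S := (sobolevConst n : ℝ) + 1) hm0 hm hM1
  -- Beyond `K₁` the smallness condition holds; beyond `4 K₀` the initial datum lies below the first
  -- level `K / 4`.
  set C : ℝ := max K₁ (4 * K₀) with hC
  have hC0 : 0 < C := lt_of_lt_of_le hK₁0 (le_max_left _ _)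
  refine ⟨C, hC0.le, fun u G h => ?_⟩
  have hdd := h.toDriftDiffusion
  have hmass := h.mass_le hM hn1 hA hA2 hm0 hm2
  have hMM : ENNReal.ofReal M₀ ≤ ENNReal.ofReal (M₀ + 1) := ENNReal.ofReal_le_ofReal (by linarith)
  have halve : ∀ T : ℝ, 0 < T → ∀ K : ℝ, C ≤ K → (∀ᵐ z : Z n, z.1 < T → u z ≤ K) → ∀ᵐ z : Z n, z.1 < T → u z ≤ K / 2 := by
    intro T hT K hCK hK
    have hK0 : 0 < K := hC0.trans_le hCK
    have hK2 := hK
    rw [Measure.volume_eq_prod] at hK2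
    have hKM : ∀ᵐ t : ℝ, 0 < t → t < T → (∀ᵐ x : E n, u (t, x) ≤ K) ∧ ∫⁻ x, ENNReal.ofReal (u (t, x)) ≤ ENNReal.ofReal (M₀ + 1) := by
      filter_upwards [Measure.ae_ae_of_ae_prod hK2, hmass] with t ht hm h0 hT
      exact ⟨ht.mono fun x hx => hx hT, hm.trans hMM⟩
    refine hdd.halve_bound hn hm0 hK0 hM1 (mul_nonneg (by linarith) (by positivity))
      (hc u T K (M₀ + 1) hdd.measurable hdd.nonneg hT hK0 hM1.le hKM h.absDrift_sq)
      ⟨hK, hmass.mono fun t ht _ _ => ht.trans hMM,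
        integrableOn_drift hn1 hA hA2 hdd.measurable hdd.nonneg hT hK0 hM1.le hKM h.absDrift_sq⟩ ?_
      (hK₁ K ((le_max_left _ _).trans hCK))
    filter_upwards [h.init_le] with z hz h0
    have := (le_max_right K₁ (4 * K₀)).trans hCK
    linarith [hz h0]
  have hT : ∀ N : ℕ, ∀ᵐ z : Z n, z.1 < (N : ℝ) + 1 → u z ≤ C := by
    intro N
    have hN : (0 : ℝ) < (N : ℝ) + 1 := by positivity
    obtain ⟨K, hK, hb⟩ := h.exists_window_bound ((N : ℝ) + 1)
    -- The starting bound `K` may depend on the time interval, but it affects only the number of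
    -- halvings and not the final constant `C`.
    have hiter : ∀ j : ℕ, ∀ᵐ z : Z n, z.1 < (N : ℝ) + 1 → u z ≤ max C (K / 2 ^ j) := by
      intro j
      induction j with
      | zero =>
        filter_upwards [hb, h.init_le] with z hz hi hT
        rcases le_or_gt z.1 0 with h0 | h0
        · refine le_trans ?_ (le_max_left _ _)
          have h1 := hi h0
          have h2 := le_max_right K₁ (4 * K₀)
          have h3 := hdd.nonneg z
          linarith
        · simpa using Or.inr (hz h0 (by rw [abs_of_pos h0]; exact hT.le))
      | succ j ih =>
        filter_upwards [halve _ hN _ (le_max_left _ _) ih] with z hz hT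
        refine (hz hT).trans ?_
        rcases max_cases C (K / 2 ^ j) with ⟨e, -⟩ | ⟨e, -⟩ <;> rw [e]
        · exact le_trans (by linarith) (le_max_left _ _)
        · refine le_trans (le_of_eq ?_) (le_max_right _ _)
          rw [pow_succ]; field_simp
    obtain ⟨j, hj⟩ := pow_unbounded_of_one_lt (K / C) (one_lt_two (α := ℝ))
    have : K / 2 ^ j ≤ C := by
      rw [div_lt_iff₀ hC0] at hj
      rw [div_le_iff₀ (by positivity)]
      linarith
    filter_upwards [hiter j] with z hz hT
    exact (hz hT).trans (max_le le_rfl this)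
  filter_upwards [ae_all_iff.2 hT] with z hz
  obtain ⟨N, hN⟩ := exists_nat_ge z.1
  exact hz N (by linarith)

end AggDiff

theorem theorem2p3 (n : ℕ) (hn : 2 ≤ n) (A m : ℝ) (hA : 2 - (n : ℝ) < A) (hA2 : A ≤ 2)
    (hm : 1 - A / (n : ℝ) < m) (M₀ K₀ : ℝ≥0) :
    ∃ C : ℝ≥0, ∀ ρ₀ : AggDiff.E n → ℝ, 0 ≤ᵐ[volume] ρ₀ →
      MemLp ρ₀ 1 volume → MemLp ρ₀ ⊤ volume →
      eLpNorm ρ₀ 1 volume ≤ M₀ → eLpNorm ρ₀ ⊤ volume ≤ K₀ →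
      ∀ ρ : ℝ → AggDiff.E n → ℝ, AggDiff.IsGlobalWeakSolution A m ρ₀ ρ →
        ∀ᵐ t ∂(volume.restrict (Ioi (0 : ℝ))), eLpNorm (ρ t) ⊤ volume ≤ C := by
  obtain ⟨C, hC0, hC⟩ := AggDiff.exists_flow_bound (K₀ := K₀) hn hA hA2 hm M₀.2
  refine ⟨⟨C, hC0⟩, fun ρ₀ h0 h1 _ hM hK ρ hρ => ?_⟩
  obtain ⟨u, G, hflow, hslice⟩ := hρ.exists_flow (by omega) h0 h1 hM hK
  have hb := hC u G hflow
  rw [Measure.volume_eq_prod] at hb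
  rw [ae_restrict_iff' measurableSet_Ioi]
  filter_upwards [hslice, Measure.ae_ae_of_ae_prod hb] with t ht hbt htpos
  rw [← eLpNorm_congr_ae (ht htpos), eLpNorm_exponent_top]
  refine (eLpNormEssSup_le_of_ae_bound (C := C) ?_).trans (le_of_eq ?_)
  · filter_upwards [hbt] with x hx
    rw [Real.norm_of_nonneg (hflow.toDriftDiffusion.nonneg _)]
    exact hx
  · rw [ENNReal.ofReal_eq_coe_nnreal hC0]
    rfl
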